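/- **Setting.** Sum over repeated indices. $\mathbf 1_n$ is the unit $n\times n$ matrix, $\tau$ the flip of a tensor product, $e_1,e_2$ the standard basis of $\mathbb C^2$ and $e^1,e^2$ the dual basis. Let $E\in\mathbb C^2\otimes\mathbb C^2$, $E'\in(\mathbb C^2\otimes\mathbb C^2)^*$, $Q'\in M_4(\mathbb C)$ (basis order $11,12,21,22$) and $X=\tau Q'$ be one of: 1. $E=e_1\otimes e_2-e_2\otimes e_1$, $E'=-e^1\otimes e^2+e^2\otimes e^1$, $Q'=\mathrm{diag}(t^{-1},t,t,t^{-1})$, $0<t\le1$; 2. $E,E'$ as in 1, $Q'=\mathbf 1_4+c^2\epsilon_{14}$; 3. $E=e_1\otimes e_2-e_2\otimes e_1+c\,e_1\otimes e_1$, $E'=-e^1\otimes e^2+e^2\otimes e^1+c\,e^2\otimes e^2$, $Q'=\mathbf 1_4+rc^2\epsilon_{14}$, $r\ge0$; 4. $E,E'$ as in 3, $Q'=\mathbf 1_4+c(\epsilon_{12}+\epsilon_{13}-\epsilon_{24}-\epsilon_{34})$; 5. $E=e_1\otimes e_2+e_2\otimes e_1$, $E'=e^1\otimes e^2+e^2\otimes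 e^1$, $Q'=i\,\mathrm{diag}(t^{-1},-t,-t,t^{-1})$, $0<t\le1$; 6. $E,E'$ as in 5, $Q'=i(\mathrm{diag}(1,-1,-1,1)+c^2\epsilon_{14})$; 7. $E,E'$ as in 5, $Q'=i\big(r\,\mathrm{diag}(1,-1,-1,1)+\varsigma(\epsilon_{14}+\epsilon_{23}+\epsilon_{32}+\epsilon_{41})\big)$, $r=\frac{t+t^{-1}}2$, $\varsigma=\frac{t-t^{-1}}2$, $0<t<1$; where $c$ is a nonzero real number and $\epsilon_{jk}$ are the matrix units. Put $q=1,\ q^{1/2}=1$ in cases 1–4 and $q=-1,\ q^{1/2}=i$ in cases 5–7. Let $s=\pm1$, let $\sigma_0=\mathbf 1_2,\sigma_1,\sigma_2,\sigma_3$ be the Pauli matrices, $V^{AB}{}_i=(\sigma_i)_{AB}$, $L=sq^{1/2}(\mathbf 1_4+qEE')$, $\tilde L=q\tau L\tau$, and $$R=(V^{-1}\otimes V^{-1})(\mathbf 1_2\otimes X\otimes\mathbf 1_2)(L\otimes\tilde L)(\mathbf 1_2\otimes X^{-1}\otimes\mathbf 1_2)(V\otimes V),$$ $$G=(V^{-1}\otimes\mathbf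 1_2)(\mathbf 1_2\otimes X)(L\otimes\mathbf 1_2)(\mathbf 1_2\otimes V),\qquad g=-2q^{1/2}(V^{-1}\otimes V^{-1})(\mathbf 1_2\otimes X\otimes\mathbf 1_2)(E\otimes\tau E).$$ For $H^{ABC}{}_D,T^{ABCD}\in\mathbb C$ put $(H_V)^{iC}{}_D=(V^{-1})^i{}_{AB}H^{ABC}{}_D$, $T^{ij}=(V^{-1})^i{}_{AB}(V^{-1})^j{}_{CD}T^{ABCD}$, $\tilde H_V=-\tau\overline{G^{-1}H_V}$ and $Z=(\mathbf 1_4\otimes V^{-1})[H_V\otimes\mathbf 1_2+(G\otimes\mathbf 1_2)(\mathbf 1_2\otimes\tilde H_V)]V$. Let $\mathcal A$ be the universal unital complex $*$-algebra generated by $w^A{}_B$ ($A,B=1,2$) with $(w\otimes w)E=E$, $E'(w\otimes w)=E'$, $X(w\otimes\bar w)=(\bar w\otimes w)X$, and put $\Lambda=V^{-1}(w\otimes\bar w)V$. Let $\mathcal B$ be the universal unital $*$-algebra generated by $\mathcal A$ and selfadjoint $y^i$, $i=0,\dots,3$, with $$(R-\mathbf 1)^{ij}{}_{kl}(y^ky^l-Z^{kl}{}_my^m+T^{kl}-\Lambda^k{}_m\Lambda^l{}_nT^{mn})=0,$$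 $$y^iw^A{}_B=G^{iA}{}_{Cj}w^C{}_By^j+(H_V)^{iA}{}_Cw^C{}_B-\Lambda^i{}_jw^A{}_C(H_V)^{jC}{}_B .$$ Let $\mathcal C$ be the universal unital $*$-algebra generated by selfadjoint $x^i$, $i=0,\dots,3$, with $(R-\mathbf 1)^{ij}{}_{kl}(x^kx^l-Z^{kl}{}_mx^m+T^{kl})=0$. Assume that $H,T$ are allowed, in the sense that the canonical map $\mathcal A\to\mathcal B$ is injective and $\mathcal C\ne\{0\}$, and that $$[(R-\mathbf 1)\otimes\mathbf 1_4]\{(\mathbf 1_4\otimes Z)Z-(Z\otimes\mathbf 1_4)Z+T\otimes\mathbf 1_4-(\mathbf 1_4\otimes R)(R\otimes\mathbf 1_4)(\mathbf 1_4\otimes T)\}=0 .$$ For $a,b\in\mathbb C$ and $i=0,1,2,3$ let $$\gamma^i=\gamma^i_{a,b}=\begin{pmatrix}0&bA_i\\ a\sigma_i&0\end{pmatrix},\quad A_i=q^{-1/2}E^T(\sigma_i\circ D)E,\quad(\sigma_i\circ D)_{KL}=(\sigma_i)_{AB}D^{AB}{}_{KL},\quad D=\tau X^{-1}\tau,$$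 with $E$ read as a $2\times2$ matrix. **Theorem.** There are unique linear maps $\partial_i:\mathcal C\to\mathcal C$, $i=0,\dots,3$, with $\partial_i(1)=0$ and $\partial_i(x^kf)=\delta^k{}_if+(R^{kl}{}_{in}x^n+Z^{kl}{}_i)\,\partial_lf$ for all $f\in\mathcal C$. With $\Box=g^{ij}\partial_j\partial_i$ and the Dirac operator $\partial\!\!\!/=\gamma^i\otimes\partial_i$ on $\mathbb C^4\otimes\mathcal C$, the following are equivalent: 1. $\partial\!\!\!/^{\,2}=\mathrm{id}\otimes\Box$; 2. $\gamma^i\gamma^j+R^{ji}{}_{lk}\gamma^k\gamma^l=2g^{ji}\mathbf 1$ for $i,j=0,1,2,3$; 3. $ab=1$. Moreover, for each $x\in\mathbb C\setminus\{0\}$ and $D_x=x\mathbf 1_2\oplus\mathbf 1_2$ one has $\gamma^i_{x^{-1}a,\,xb}=D_x\gamma^i_{a,b}D_x^{-1}$ for all $i$; and if $ab=1$, then there is $x\ne0$ with $\gamma^i_{1,1}=D_x\gamma^i_{a,b}D_x^{-1}$ for all $i$, so that one may normalize $a=b=1$. -/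

import Mathlib

open scoped Kronecker TensorProduct Matrix

noncomputable section

namespace QuantumMinkowski

/-! ### Universal unital star-algebras given by generators and relations -/

/-- The universal property of the free complex algebra, as a ring homomorphism. -/
def liftRing {X A : Type} [Semiring A] [Algebra ℂ A] (f : X → A) : FreeAlgebra ℂ X →+* A :=
  (FreeAlgebra.lift ℂ f).toRingHom

theorem liftRing_gen {X A : Type} [Semiring A] [Algebra ℂ A] (f : X → A) (x : X) :
    liftRing f (FreeAlgebra.ι ℂ x) = f x :=
  FreeAlgebra.lift_ι_apply f x

theorem liftRing_algebraMap {X A : Type} [Semiring A] [Algebra ℂ A] (f : X → A) (c : ℂ) :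
    liftRing f (algebraMap ℂ _ c) = algebraMap ℂ A c :=
  (FreeAlgebra.lift ℂ f).commutes c

/-- The conjugate-linear unital ring endomorphism of the free complex algebra on `X` that sends
each generator `x` to the generator `σ x` (it keeps the order of products). -/
def freeConj {X : Type} (σ : X → X) : FreeAlgebra ℂ X →+* FreeAlgebra ℂ X :=
  @liftRing X (FreeAlgebra ℂ X) _ (Algebra.compHom (FreeAlgebra ℂ X) (starRingEnd ℂ))
    (fun x => FreeAlgebra.ι ℂ (σ x))

/-- The formal adjoint on the free complex algebra on `X`: the conjugate-linear antimultiplicative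
map with `x ↦ σ x` on generators. (Mathlib's `star` on `FreeAlgebra` is the *linear* reversal of
words, so coefficients have to be conjugated in addition.) -/
def adj {X : Type} (σ : X → X) (a : FreeAlgebra ℂ X) : FreeAlgebra ℂ X :=
  star (freeConj σ a)

theorem adj_gen {X : Type} (σ : X → X) (x : X) :
    adj σ (FreeAlgebra.ι ℂ x) = FreeAlgebra.ι ℂ (σ x) := by
  have h : freeConj σ (FreeAlgebra.ι ℂ x) = FreeAlgebra.ι ℂ (σ x) :=
    @liftRing_gen X (FreeAlgebra ℂ X) _
      (Algebra.compHom (FreeAlgebra ℂ X) (starRingEnd ℂ)) _ x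
  rw [adj, h, FreeAlgebra.star_ι]

theorem adj_algebraMap {X : Type} (σ : X → X) (c : ℂ) :
    adj σ (algebraMap ℂ _ c) = algebraMap ℂ _ (starRingEnd ℂ c) := by
  have h : freeConj σ (algebraMap ℂ _ c) = algebraMap ℂ _ (starRingEnd ℂ c) :=
    @liftRing_algebraMap X (FreeAlgebra ℂ X) _
      (Algebra.compHom (FreeAlgebra ℂ X) (starRingEnd ℂ)) _ c
  rw [adj, h, FreeAlgebra.star_algebraMap]

theorem adj_add {X : Type} (σ : X → X) (a b : FreeAlgebra ℂ X) :
    adj σ (a + b) = adj σ a + adj σ b := by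
  simp [adj]

theorem adj_mul {X : Type} (σ : X → X) (a b : FreeAlgebra ℂ X) :
    adj σ (a * b) = adj σ b * adj σ a := by
  simp [adj]

/-- The elements of `P` and their formal adjoints are set equal to zero. -/
def StarRel {X : Type} (σ : X → X) (P : Set (FreeAlgebra ℂ X)) (a b : FreeAlgebra ℂ X) : Prop :=
  b = 0 ∧ (a ∈ P ∨ ∃ c ∈ P, a = adj σ c)

/-- The universal unital complex star-algebra generated by `X`, with `x* = σ x` on generators
(`σ` an involution) and relations `p = 0` for `p ∈ P`: as an algebra, this is the free algebra
divided by the relations and their adjoints. -/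
abbrev StarPres {X : Type} (σ : X → X) (P : Set (FreeAlgebra ℂ X)) : Type :=
  RingQuot (StarRel σ P)

/-- The quotient map onto the presented algebra. -/
def StarPres.mk {X : Type} (σ : X → X) (P : Set (FreeAlgebra ℂ X)) :
    FreeAlgebra ℂ X →ₐ[ℂ] StarPres σ P :=
  RingQuot.mkAlgHom ℂ (StarRel σ P)

/-! ### Pauli matrices -/

/-- The Pauli matrices `σ₀ = 1, σ₁, σ₂, σ₃`. -/
def pauli : Fin 4 → Matrix (Fin 2) (Fin 2) ℂ :=
  ![!![1, 0; 0, 1], !![0, 1; 1, 0], !![0, -Complex.I; Complex.I, 0], !![1, 0; 0, -1]]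

/-- `V^{AB}_i = (σ_i)_{AB}`. -/
def V : Matrix (Fin 2 × Fin 2) (Fin 4) ℂ :=
  Matrix.of fun p i => pauli i p.1 p.2

/-- `(V⁻¹)^i_{AB} = ½ (σ_i)_{BA}`. -/
def Vinv : Matrix (Fin 4) (Fin 2 × Fin 2) ℂ :=
  Matrix.of fun i p => (1 / 2) * pauli i p.2 p.1

/-- A `4 × 4` array as a matrix on `ℂ² ⊗ ℂ²`, basis order `11, 12, 21, 22`. -/
def onPairs (M : Matrix (Fin 4) (Fin 4) ℂ) : Matrix (Fin 2 × Fin 2) (Fin 2 × Fin 2) ℂ :=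
  M.submatrix finProdFinEquiv finProdFinEquiv

/-- The flip `τ` of `ℂ² ⊗ ℂ²`. -/
def flip : Matrix (Fin 2 × Fin 2) (Fin 2 × Fin 2) ℂ :=
  Matrix.of fun p p' => if p = p'.swap then 1 else 0

/-- `1₂ ⊗ M ⊗ 1₂` on `(ℂ² ⊗ ℂ²) ⊗ (ℂ² ⊗ ℂ²)`. -/
def mid (M : Matrix (Fin 2 × Fin 2) (Fin 2 × Fin 2) ℂ) :
    Matrix ((Fin 2 × Fin 2) × (Fin 2 × Fin 2)) ((Fin 2 × Fin 2) × (Fin 2 × Fin 2)) ℂ :=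
  Matrix.of fun p p' =>
    if p.1.1 = p'.1.1 ∧ p.2.2 = p'.2.2 then M (p.1.2, p.2.1) (p'.1.2, p'.2.1) else 0

/-! ### Quantum Lorentz groups -/

/-- The seven families of quantum Lorentz groups underlying quantum Poincaré groups, with their
parameters. The classical group `SL(2, ℂ)` is the first family at `t = 1`. -/
inductive LorentzType
  | one (t : ℝ) (pos : 0 < t) (le_one : t ≤ 1)
  | two (c : ℝ) (ne : c ≠ 0)
  | three (c r : ℝ) (ne : c ≠ 0) (nonneg : 0 ≤ r)
  | four (c : ℝ) (ne : c ≠ 0)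
  | five (t : ℝ) (pos : 0 < t) (le_one : t ≤ 1)
  | six (c : ℝ) (ne : c ≠ 0)
  | seven (t : ℝ) (pos : 0 < t) (lt_one : t < 1)

namespace LorentzType

/-- `q = 1` for the first four families and `q = -1` for the others. -/
def q : LorentzType → ℂ
  | one .. | two .. | three .. | four .. => 1
  | five .. | six .. | seven .. => -1

/-- `q^{1/2}`, with the convention `1^{1/2} = 1`, `(-1)^{1/2} = i`. -/
def qHalf : LorentzType → ℂ
  | one .. | two .. | three .. | four .. => 1
  | five .. | six .. | seven .. => Complex.I

/-- The vector `E ∈ ℂ² ⊗ ℂ²`, as the `2 × 2` matrix `E^{AB}`. -/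
def E : LorentzType → Matrix (Fin 2) (Fin 2) ℂ
  | one .. | two .. => !![0, 1; -1, 0]
  | three c .. | four c .. => !![(c : ℂ), 1; -1, 0]
  | five .. | six .. | seven .. => !![0, 1; 1, 0]

/-- The covector `E'`, as the `2 × 2` matrix `E'_{AB}`. -/
def E' : LorentzType → Matrix (Fin 2) (Fin 2) ℂ
  | one .. | two .. => !![0, -1; 1, 0]
  | three c .. | four c .. => !![0, -1; 1, (c : ℂ)]
  | five .. | six .. | seven .. => !![0, 1; 1, 0]

/-- The matrix `Q' = τ X`. -/
def Q' : LorentzType → Matrix (Fin 2 × Fin 2) (Fin 2 × Fin 2) ℂ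
  | one t .. => onPairs
      !![(t : ℂ)⁻¹, 0, 0, 0; 0, (t : ℂ), 0, 0; 0, 0, (t : ℂ), 0; 0, 0, 0, (t : ℂ)⁻¹]
  | two c .. => onPairs !![1, 0, 0, (c : ℂ) ^ 2; 0, 1, 0, 0; 0, 0, 1, 0; 0, 0, 0, 1]
  | three c r .. => onPairs
      !![1, 0, 0, (r : ℂ) * (c : ℂ) ^ 2; 0, 1, 0, 0; 0, 0, 1, 0; 0, 0, 0, 1]
  | four c .. => onPairs
      !![1, (c : ℂ), (c : ℂ), 0; 0, 1, 0, -(c : ℂ); 0, 0, 1, -(c : ℂ); 0, 0, 0, 1]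
  | five t .. => Complex.I • onPairs
      !![(t : ℂ)⁻¹, 0, 0, 0; 0, -(t : ℂ), 0, 0; 0, 0, -(t : ℂ), 0; 0, 0, 0, (t : ℂ)⁻¹]
  | six c .. => Complex.I • onPairs
      !![1, 0, 0, (c : ℂ) ^ 2; 0, -1, 0, 0; 0, 0, -1, 0; 0, 0, 0, 1]
  | seven t .. =>
      let r : ℂ := ((t : ℂ) + (t : ℂ)⁻¹) / 2
      let z : ℂ := ((t : ℂ) - (t : ℂ)⁻¹) / 2
      Complex.I • onPairs !![r, 0, 0, z; 0, -r, z, 0; 0, z, -r, 0; z, 0, 0, r]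

/-- The matrix `X = τ Q'`. -/
def X (d : LorentzType) : Matrix (Fin 2 × Fin 2) (Fin 2 × Fin 2) ℂ :=
  flip * d.Q'

/-- The metric tensor
`g = -2 q^{1/2} (V⁻¹ ⊗ V⁻¹)(1 ⊗ X ⊗ 1)(E ⊗ τE)`, as the matrix `g^{ij}`. -/
def g (d : LorentzType) : Matrix (Fin 4) (Fin 4) ℂ :=
  Matrix.of fun i j =>
    (-2 * d.qHalf) *
      (((Vinv ⊗ₖ Vinv) * mid d.X) *ᵥ (fun p => d.E p.1.1 p.1.2 * d.E p.2.2 p.2.1)) (i, j)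

/-- `D = τ X⁻¹ τ`. -/
def D (d : LorentzType) : Matrix (Fin 2 × Fin 2) (Fin 2 × Fin 2) ℂ :=
  flip * d.X⁻¹ * flip

/-- `(σ_i ∘ D)_{KL} = (σ_i)_{AB} D^{AB}_{KL}`. -/
def pauliD (d : LorentzType) (i : Fin 4) : Matrix (Fin 2) (Fin 2) ℂ :=
  Matrix.of fun K L => ∑ A, ∑ B, pauli i A B * d.D (A, B) (K, L)

/-- `A_i = q^{-1/2} Eᵀ (σ_i ∘ D) E`. -/
def Amat (d : LorentzType) (i : Fin 4) : Matrix (Fin 2) (Fin 2) ℂ :=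
  d.qHalf⁻¹ • (d.Eᵀ * d.pauliD i * d.E)

/-- The invariant gamma matrices: `γ^i` has upper right block `b A_i`, lower left block `a σ_i`
and zero diagonal blocks, with respect to `ℂ⁴ = ℂ² ⊕ ℂ²`. -/
def gamma (d : LorentzType) (a b : ℂ) (i : Fin 4) :
    Matrix (Fin 2 ⊕ Fin 2) (Fin 2 ⊕ Fin 2) ℂ :=
  Matrix.fromBlocks 0 (b • d.Amat i) (a • pauli i) 0

end LorentzType

/-- Generators of the algebra of a quantum Lorentz group: the entries `w^A_B` and their
adjoints. -/
inductive LorentzGen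
  | w (A B : Fin 2)
  | wstar (A B : Fin 2)

/-- The adjoint on Lorentz generators. -/
def LorentzGen.inv : LorentzGen → LorentzGen
  | w A B => wstar A B
  | wstar A B => w A B

/-- The relations of a quantum Lorentz group, for elements `w A B` and `ws A B` (standing for
`(w^A_B)*`) of an algebra:
`(w ⊗ w) E = E`, `E' (w ⊗ w) = E'` and `X (w ⊗ w̄) = (w̄ ⊗ w) X`. -/
def lorentzRelations {F : Type} [Ring F] [Algebra ℂ F] (d : LorentzType)
    (w ws : Fin 2 → Fin 2 → F) : Set F :=
  { p | (∃ A C, p = ∑ B, ∑ D, d.E B D • (w A B * w C D) - algebraMap ℂ F (d.E A C)) ∨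
    (∃ B D, p = ∑ A, ∑ C, d.E' A C • (w A B * w C D) - algebraMap ℂ F (d.E' B D)) ∨
    (∃ A B K L, p = ∑ C, ∑ D, d.X (A, B) (C, D) • (w C K * ws D L) -
      ∑ C, ∑ D, d.X (C, D) (K, L) • (ws A C * w B D)) }

/-- The relations of the quantum Lorentz group inside the free algebra on its generators. -/
def lorentzFreeRelations (d : LorentzType) : Set (FreeAlgebra ℂ LorentzGen) :=
  lorentzRelations d (fun A B => FreeAlgebra.ι ℂ (LorentzGen.w A B))
    (fun A B => FreeAlgebra.ι ℂ (LorentzGen.wstar A B))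

/-- The algebra `𝒜` of polynomials on the quantum Lorentz group. -/
abbrev LorentzAlgebra (d : LorentzType) : Type :=
  StarPres LorentzGen.inv (lorentzFreeRelations d)

/-! ### Quantum Poincaré groups and quantum Minkowski spaces -/

/-- The data of a quantum Poincaré group: a quantum Lorentz group, a sign `s` and the coefficients
`H^{ABC}_D`, `T^{ABCD}`. Which `H`, `T` are allowed is expressed by `Admissible` below. -/
structure PoincareDatum where
  /-- the underlying quantum Lorentz group -/
  lor : LorentzType
  /-- the sign `s = ±1` -/
  s : ℤˣ
  /-- `H A B C D` is `H^{ABC}_D` -/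
  H : Fin 2 → Fin 2 → Fin 2 → Fin 2 → ℂ
  /-- `T' A B C D` is `T^{ABCD}` -/
  T' : Fin 2 → Fin 2 → Fin 2 → Fin 2 → ℂ

namespace PoincareDatum

/-- `L = s q^{1/2} (1 + q E E')`. -/
def L (P : PoincareDatum) : Matrix (Fin 2 × Fin 2) (Fin 2 × Fin 2) ℂ :=
  (((P.s : ℤ) : ℂ) * P.lor.qHalf) •
    (1 + P.lor.q • Matrix.of fun p p' => P.lor.E p.1 p.2 * P.lor.E' p'.1 p'.2)

/-- `L̃ = q τ L τ`. -/
def Ltilde (P : PoincareDatum) : Matrix (Fin 2 × Fin 2) (Fin 2 × Fin 2) ℂ :=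
  P.lor.q • (flip * P.L * flip)

/-- `R = (V⁻¹ ⊗ V⁻¹)(1 ⊗ X ⊗ 1)(L ⊗ L̃)(1 ⊗ X⁻¹ ⊗ 1)(V ⊗ V)`; the entry `R (i, j) (k, l)` is
`R^{ij}_{kl}`. -/
def R (P : PoincareDatum) : Matrix (Fin 4 × Fin 4) (Fin 4 × Fin 4) ℂ :=
  (Vinv ⊗ₖ Vinv) * mid P.lor.X * (P.L ⊗ₖ P.Ltilde) * mid P.lor.X⁻¹ * (V ⊗ₖ V)

/-- `G = (V⁻¹ ⊗ 1)(1 ⊗ X)(L ⊗ 1)(1 ⊗ V) : ℂ² ⊗ ℂ⁴ → ℂ⁴ ⊗ ℂ²`; the entry `G (i, A) (C, j)` is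
`G^{iA}_{Cj}`. -/
def G (P : PoincareDatum) : Matrix (Fin 4 × Fin 2) (Fin 2 × Fin 4) ℂ :=
  Matrix.of fun iA Cj =>
    ∑ M, ∑ N, ∑ S, ∑ U, ∑ W,
      Vinv iA.1 (M, N) * P.lor.X (N, iA.2) (S, U) * P.L (M, S) (Cj.1, W) * V (W, U) Cj.2

/-- `(H_V)^{iC}_D = (V⁻¹)^i_{AB} H^{ABC}_D`. -/
def HV (P : PoincareDatum) : Matrix (Fin 4 × Fin 2) (Fin 2) ℂ :=
  Matrix.of fun iC D => ∑ A, ∑ B, Vinv iC.1 (A, B) * P.H A B iC.2 D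

/-- `H̃_V = -τ \overline{G⁻¹ H_V}`. Here `G τ` is formed as a square matrix on `ℂ⁴ ⊗ ℂ²`, and
`τ G⁻¹ = (G τ)⁻¹`. -/
def HVtilde (P : PoincareDatum) : Matrix (Fin 4 × Fin 2) (Fin 2) ℂ :=
  -(((P.G.submatrix id Prod.swap)⁻¹ * P.HV).map (starRingEnd ℂ))

/-- `Z = (1 ⊗ V⁻¹)[H_V ⊗ 1 + (G ⊗ 1)(1 ⊗ H̃_V)] V`; the entry `Z (i, j) k` is `Z^{ij}_k`. -/
def Z (P : PoincareDatum) : Matrix (Fin 4 × Fin 4) (Fin 4) ℂ :=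
  Matrix.of fun ij k =>
    ∑ A, ∑ B, ∑ C, ∑ D,
      Vinv ij.2 (A, B) *
        (P.HV (ij.1, A) C * (if B = D then 1 else 0) +
          ∑ l, P.G (ij.1, A) (C, l) * P.HVtilde (l, B) D) *
        V (C, D) k

/-- `T^{ij} = (V⁻¹)^i_{AB} (V⁻¹)^j_{CD} T^{ABCD}`. -/
def T (P : PoincareDatum) : Matrix (Fin 4) (Fin 4) ℂ :=
  Matrix.of fun i j =>
    ∑ A, ∑ B, ∑ C, ∑ D, Vinv i (A, B) * Vinv j (C, D) * P.T' A B C D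

/-- `F̃ = [(R - 1) ⊗ 1]{(1 ⊗ Z)Z - (Z ⊗ 1)Z + T ⊗ 1 - (1 ⊗ R)(R ⊗ 1)(1 ⊗ T)}`, a matrix from `ℂ⁴`
to `ℂ⁴ ⊗ ℂ⁴ ⊗ ℂ⁴`; `Ftilde P i j k m` is the entry in row `ijk` and column `m`. -/
def Ftilde (P : PoincareDatum) (i j k m : Fin 4) : ℂ :=
  ∑ a, ∑ b, (P.R - 1) (i, j) (a, b) *
    (∑ n, P.Z (b, k) n * P.Z (a, n) m - ∑ n, P.Z (a, b) n * P.Z (n, k) m +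
      P.T a b * (if k = m then 1 else 0) -
      ∑ n, ∑ c, ∑ e, P.R (a, n) (m, c) * P.R (b, k) (n, e) * P.T c e)

end PoincareDatum

/-- Generators of the algebra of a quantum Poincaré group. -/
inductive PoincareGen
  | w (A B : Fin 2)
  | wstar (A B : Fin 2)
  | y (i : Fin 4)

/-- The adjoint on Poincaré generators; the `y^i` are selfadjoint. -/
def PoincareGen.inv : PoincareGen → PoincareGen
  | w A B => wstar A B
  | wstar A B => w A B
  | y i => y i

/-- Lorentz generators as Poincaré generators. -/
def LorentzGen.toPoincare : LorentzGen → PoincareGen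
  | w A B => PoincareGen.w A B
  | wstar A B => PoincareGen.wstar A B

/-- `Λ = V⁻¹ (w ⊗ w̄) V`. -/
def lambda {F : Type} [Ring F] [Algebra ℂ F] (w ws : Fin 2 → Fin 2 → F) (i j : Fin 4) : F :=
  ∑ A, ∑ B, ∑ C, ∑ D, (Vinv i (A, B) * V (C, D) j) • (w A C * ws B D)

/-- The relations of a quantum Poincaré group involving the translation generators:
`(R - 1)^{ij}_{kl} (y^k y^l - Z^{kl}_m y^m + T^{kl} - Λ^k_m Λ^l_n T^{mn}) = 0` and
`y^i w^A_B = G^{iA}_{Cj} w^C_B y^j + (H_V)^{iA}_C w^C_B - Λ^i_j w^A_C (H_V)^{jC}_B`. -/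
def translationRelations {F : Type} [Ring F] [Algebra ℂ F] (P : PoincareDatum)
    (w ws : Fin 2 → Fin 2 → F) (y : Fin 4 → F) : Set F :=
  { p | (∃ i j, p = ∑ k, ∑ l, (P.R - 1) (i, j) (k, l) •
      (y k * y l - ∑ m, P.Z (k, l) m • y m + algebraMap ℂ F (P.T k l) -
        ∑ m, ∑ n, P.T m n • (lambda w ws k m * lambda w ws l n))) ∨
    (∃ i A B, p = y i * w A B -
      (∑ C, ∑ j, P.G (i, A) (C, j) • (w C B * y j) + ∑ C, P.HV (i, A) C • w C B -
        ∑ j, ∑ C, P.HV (j, C) B • (lambda w ws i j * w A C))) }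

/-- All relations of a quantum Poincaré group, inside the free algebra on its generators. -/
def poincareFreeRelations (P : PoincareDatum) : Set (FreeAlgebra ℂ PoincareGen) :=
  lorentzRelations P.lor (fun A B => FreeAlgebra.ι ℂ (PoincareGen.w A B))
      (fun A B => FreeAlgebra.ι ℂ (PoincareGen.wstar A B)) ∪
    translationRelations P (fun A B => FreeAlgebra.ι ℂ (PoincareGen.w A B))
      (fun A B => FreeAlgebra.ι ℂ (PoincareGen.wstar A B))
      (fun i => FreeAlgebra.ι ℂ (PoincareGen.y i))

/-- The algebra `ℬ` of polynomials on the quantum Poincaré group: the universal unital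
star-algebra generated by `𝒜` and the selfadjoint `y^i` with the above relations. -/
abbrev PoincareAlgebra (P : PoincareDatum) : Type :=
  StarPres PoincareGen.inv (poincareFreeRelations P)

/-- Substitution of Lorentz generators by Poincaré generators. -/
def freeInclusion : FreeAlgebra ℂ LorentzGen →ₐ[ℂ] FreeAlgebra ℂ PoincareGen :=
  FreeAlgebra.lift ℂ (fun x => FreeAlgebra.ι ℂ x.toPoincare)

theorem freeInclusion_adj (a : FreeAlgebra ℂ LorentzGen) :
    freeInclusion (adj LorentzGen.inv a) = adj PoincareGen.inv (freeInclusion a) := by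
  induction a using FreeAlgebra.induction with
  | grade0 c => simp [adj_algebraMap]
  | grade1 x => cases x <;> simp [adj_gen, freeInclusion, LorentzGen.inv, LorentzGen.toPoincare,
      PoincareGen.inv]
  | mul a b ha hb => simp [adj_mul, ha, hb]
  | add a b ha hb => simp [adj_add, ha, hb]

theorem freeInclusion_mem (P : PoincareDatum) (a : FreeAlgebra ℂ LorentzGen)
    (ha : a ∈ lorentzFreeRelations P.lor) : freeInclusion a ∈ poincareFreeRelations P := by
  refine Or.inl ?_
  rcases ha with ⟨A, C, rfl⟩ | ⟨B, D, rfl⟩ | ⟨A, B, K, L, rfl⟩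
  · exact Or.inl ⟨A, C, by simp [freeInclusion, LorentzGen.toPoincare]⟩
  · exact Or.inr (Or.inl ⟨B, D, by simp [freeInclusion, LorentzGen.toPoincare]⟩)
  · exact Or.inr (Or.inr ⟨A, B, K, L, by simp [freeInclusion, LorentzGen.toPoincare]⟩)

/-- The canonical homomorphism `𝒜 → ℬ`. -/
def lorentzToPoincare (P : PoincareDatum) : LorentzAlgebra P.lor →ₐ[ℂ] PoincareAlgebra P :=
  RingQuot.liftAlgHom ℂ
    ⟨(StarPres.mk PoincareGen.inv (poincareFreeRelations P)).comp freeInclusion, by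
      rintro a b ⟨rfl, h⟩
      have key : StarRel PoincareGen.inv (poincareFreeRelations P) (freeInclusion a) 0 := by
        refine ⟨rfl, ?_⟩
        rcases h with h | ⟨c, hc, rfl⟩
        · exact Or.inl (freeInclusion_mem P a h)
        · exact Or.inr ⟨freeInclusion c, freeInclusion_mem P c hc, freeInclusion_adj c⟩
      simpa [StarPres.mk] using RingQuot.mkAlgHom_rel ℂ key⟩

/-- The relations of the quantum Minkowski space:
`(R - 1)^{ij}_{kl} (x^k x^l - Z^{kl}_m x^m + T^{kl}) = 0`. -/
def minkowskiFreeRelations (P : PoincareDatum) : Set (FreeAlgebra ℂ (Fin 4)) :=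
  { p | ∃ i j, p = ∑ k, ∑ l, (P.R - 1) (i, j) (k, l) •
      (FreeAlgebra.ι ℂ k * FreeAlgebra.ι ℂ l - ∑ m, P.Z (k, l) m • FreeAlgebra.ι ℂ m +
        algebraMap ℂ _ (P.T k l)) }

/-- The algebra `𝒞` of polynomials on the quantum Minkowski space: the universal unital
star-algebra generated by selfadjoint `x^0, …, x^3` with the above relations. -/
abbrev MinkowskiAlgebra (P : PoincareDatum) : Type :=
  StarPres (id : Fin 4 → Fin 4) (minkowskiFreeRelations P)

/-- The coordinates `x^i`. -/
def coord (P : PoincareDatum) (i : Fin 4) : MinkowskiAlgebra P :=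
  StarPres.mk id (minkowskiFreeRelations P) (FreeAlgebra.ι ℂ i)

/-- The allowed `H` and `T`: the polynomials on the quantum Lorentz group stay a subalgebra of those
on the quantum Poincaré group (so the relations between translations and Lorentz variables
do not collapse `𝒜`), and the algebra of the quantum Minkowski space is not the zero ring. -/
structure PoincareDatum.Admissible (P : PoincareDatum) : Prop where
  lorentz_injective : Function.Injective (lorentzToPoincare P)
  minkowski_nontrivial : Nontrivial (MinkowskiAlgebra P)

/-! ### Partial derivatives, Laplacian and Dirac operator -/

/-- The properties that determine the partial derivatives on the quantum Minkowski space: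
`∂_i(1) = 0` and `∂_i(x^k f) = δ^k_i f + (R^{kl}_{in} x^n + Z^{kl}_i) ∂_l f`. -/
structure IsPartialDerivatives (P : PoincareDatum)
    (pd : Fin 4 → MinkowskiAlgebra P →ₗ[ℂ] MinkowskiAlgebra P) : Prop where
  map_one : ∀ i, pd i 1 = 0
  map_coord_mul : ∀ (i k : Fin 4) (f : MinkowskiAlgebra P),
    pd i (coord P k * f) = (if k = i then f else 0) +
      ∑ l, (∑ n, P.R (k, l) (i, n) • coord P n + algebraMap ℂ _ (P.Z (k, l) i)) * pd l f

/-- The Laplacian `□ = g^{ij} ∂_j ∂_i`. -/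
def laplacian (P : PoincareDatum)
    (pd : Fin 4 → MinkowskiAlgebra P →ₗ[ℂ] MinkowskiAlgebra P) :
    MinkowskiAlgebra P →ₗ[ℂ] MinkowskiAlgebra P :=
  ∑ i, ∑ j, P.lor.g i j • (pd j ∘ₗ pd i)

/-- The Dirac operator `γ^i ⊗ ∂_i` on bispinor functions `ℂ⁴ ⊗ 𝒞`, where `ℂ⁴ = ℂ² ⊕ ℂ²`. -/
def dirac (P : PoincareDatum) (γ : Fin 4 → Matrix (Fin 2 ⊕ Fin 2) (Fin 2 ⊕ Fin 2) ℂ)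
    (pd : Fin 4 → MinkowskiAlgebra P →ₗ[ℂ] MinkowskiAlgebra P) :
    ((Fin 2 ⊕ Fin 2 → ℂ) ⊗[ℂ] MinkowskiAlgebra P) →ₗ[ℂ]
      ((Fin 2 ⊕ Fin 2 → ℂ) ⊗[ℂ] MinkowskiAlgebra P) :=
  ∑ i, TensorProduct.map (Matrix.toLin' (γ i)) (pd i)

/-- The matrix `x 1₂ ⊕ 1₂`, which rescales the undotted spinor. -/
def spinorScaling (x : ℂ) : Matrix (Fin 2 ⊕ Fin 2) (Fin 2 ⊕ Fin 2) ℂ :=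
  Matrix.fromBlocks (x • 1) 0 0 1

end QuantumMinkowski

end

open scoped Kronecker TensorProduct Matrix

noncomputable section

namespace QuantumMinkowski

namespace LorentzType

/-! The structure constants `R` and `Z` are values of `Λ` in finite-dimensional representations of
the Lorentz relations. The braidings `L`, `X⁻¹` and `X`, `L̃` represent `w`, `w*` on the two kinds
of spinors, their convolution product represents them on vectors, and evaluating `Λ` there gives `R`
(`lambda_vec`). Adjoining `H` and `H̃` as an extra column gives block triangular matrices in which
`Λ` becomes `R, Z, 0, 1` (`lambda_aff`). Since `Λ` satisfies an exchange relation with `R` in every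
representation, the Yang–Baxter equation and an exchange relation between `R` and `Z` follow
(`lambda_exchange`). Compatibility with conjugation gives the reality of `R` and `Z`.

Admissibility is what makes the affine extension a representation (`lorentzRep_aff`). In `ℬ` the
matrix with blocks `Λ, y, 0, 1` intertwines the entries of `w` with the extended matrices. The
defect of each Lorentz relation can be nonzero only in the upper right block, where the intertwining
identity contains no `y`. It can therefore be pulled back to `𝒜` by injectivity. The character `w ↦
-1`, `w* ↦ 1` sends `Λ` to `-1`, so the defect equals its own negative.

The derivatives are built as matrix entries. The rule for `∂_i(x^k f)` says that `x^k` acts on the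
column of the `∂_i f` and `f` by a `5 × 5` matrix over `𝒞`. These matrices satisfy the relations of
`𝒞`: the quadratic part is handled by Yang–Baxter, the linear part by the `R`–`Z` exchange together
with `R² = 1`, and the constant part is `F̃ = 0` (`derivBlock_relation`). Adjoint relations add no
further condition, because conjugation reproduces the original relations up to a scalar, which
vanishes as `𝒞 ≠ 0` (`realityDefect_eq_zero`). Uniqueness is induction on words.

For the Dirac operator, the same identities show that second derivatives are symmetric with respect
to `R` (`IsPartialDerivatives.commutation`), so the Clifford relations give the square. Conversely,
second derivatives of `x^m x^n` are the scalars `δδ + R`, and `Rg = g`, so the square formula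
returns the Clifford relations. Finally `R` is conjugate to `L ⊗ L̃`. In the corresponding
coordinates `A_i σ_j` and `σ_i A_j` are product vectors with one factor an eigenvector, and the
`R`-symmetrization of either is `2g` times the identity (`A_mul_pauli_symm`, `pauli_mul_A_symm`). As
`g ≠ 0`, the Clifford relations amount to `ab = 1`. -/

/-! ### Crossing and reality of `X`, `E` and `E'`. -/

theorem flip_mul_apply (M : Matrix (Fin 2 × Fin 2) (Fin 2 × Fin 2) ℂ) (A B : Fin 2)
    (p : Fin 2 × Fin 2) : (flip * M) (A, B) p = M (B, A) p := by
  simp only [flip, Matrix.mul_apply, Matrix.of_apply]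
  rw [Finset.sum_eq_single (B, A)]
  · simp
  · rintro ⟨a, b⟩ _ h
    rw [if_neg, zero_mul]
    intro h'
    simp only [Prod.swap_prod_mk, Prod.mk.injEq] at h'
    exact h (by rw [h'.1, h'.2])
  · simp

theorem mul_flip_apply (M : Matrix (Fin 2 × Fin 2) (Fin 2 × Fin 2) ℂ) (A B : Fin 2)
    (p : Fin 2 × Fin 2) : (M * flip) p (A, B) = M p (B, A) := by
  simp only [flip, Matrix.mul_apply, Matrix.of_apply]
  rw [Finset.sum_eq_single (B, A)]
  · simp
  · rintro ⟨a, b⟩ _ h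
    rw [if_neg, mul_zero]
    intro h'
    simp only [Prod.swap_prod_mk, Prod.mk.injEq] at h'
    exact h (by rw [h'.1, h'.2])
  · simp

theorem flip_mul_flip : flip * flip = 1 := by
  ext ⟨A, B⟩ ⟨C, D⟩
  rw [flip_mul_apply]
  simp only [flip, Matrix.of_apply, Matrix.one_apply, Prod.swap_prod_mk, Prod.mk.injEq, and_comm]

theorem X_apply (d : LorentzType) (A B : Fin 2) (p : Fin 2 × Fin 2) :
    d.X (A, B) p = d.Q' (B, A) p :=
  flip_mul_apply _ _ _ _

/-- The inverse of `Q'`. -/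
def Qinv : LorentzType → Matrix (Fin 2 × Fin 2) (Fin 2 × Fin 2) ℂ
  | one t .. => onPairs
      !![(t : ℂ), 0, 0, 0; 0, (t : ℂ)⁻¹, 0, 0; 0, 0, (t : ℂ)⁻¹, 0; 0, 0, 0, (t : ℂ)]
  | two c .. => onPairs !![1, 0, 0, -(c : ℂ) ^ 2; 0, 1, 0, 0; 0, 0, 1, 0; 0, 0, 0, 1]
  | three c r .. => onPairs
      !![1, 0, 0, -((r : ℂ) * (c : ℂ) ^ 2); 0, 1, 0, 0; 0, 0, 1, 0; 0, 0, 0, 1]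
  | four c .. => onPairs
      !![1, -(c : ℂ), -(c : ℂ), -2 * (c : ℂ) ^ 2; 0, 1, 0, (c : ℂ); 0, 0, 1, (c : ℂ); 0, 0, 0, 1]
  | five t .. => (-Complex.I) • onPairs
      !![(t : ℂ), 0, 0, 0; 0, -(t : ℂ)⁻¹, 0, 0; 0, 0, -(t : ℂ)⁻¹, 0; 0, 0, 0, (t : ℂ)]
  | six c .. => (-Complex.I) • onPairs
      !![1, 0, 0, -(c : ℂ) ^ 2; 0, -1, 0, 0; 0, 0, -1, 0; 0, 0, 0, 1]
  | seven t .. =>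
      let r : ℂ := ((t : ℂ) + (t : ℂ)⁻¹) / 2
      let z : ℂ := ((t : ℂ) - (t : ℂ)⁻¹) / 2
      (-Complex.I) • onPairs !![r, 0, 0, -z; 0, -r, -z, 0; 0, -z, -r, 0; -z, 0, 0, r]

theorem onPairs_mul (M N : Matrix (Fin 4) (Fin 4) ℂ) : onPairs M * onPairs N = onPairs (M * N) :=
  Matrix.submatrix_mul_equiv _ _ _ _ _

theorem onPairs_one : onPairs 1 = 1 := Matrix.submatrix_one_equiv _

theorem Q'_mul_Qinv (d : LorentzType) : d.Q' * d.Qinv = 1 := by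
  rcases d with ⟨t, ht, h⟩ | ⟨c, hc⟩ | ⟨c, r, hc, hr⟩ | ⟨c, hc⟩ | ⟨t, ht, h⟩ | ⟨c, hc⟩ | ⟨t, ht, h⟩
  all_goals
    simp only [Q', Qinv, Matrix.smul_mul, Matrix.mul_smul, smul_smul, onPairs_mul, neg_mul,
      Complex.I_mul_I, neg_neg, one_smul]
    rw [← onPairs_one]
    refine congrArg onPairs ?_
    ext i j
    fin_cases i <;> fin_cases j
  all_goals simp [Matrix.mul_apply, Fin.sum_univ_four]
  all_goals try have ht' : (t : ℂ) ≠ 0 := by exact_mod_cast ht.ne'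
  all_goals try field_simp
  all_goals try ring

theorem X_inv (d : LorentzType) : d.X⁻¹ = d.Qinv * flip := by
  apply Matrix.inv_eq_right_inv
  rw [X, Matrix.mul_assoc, ← Matrix.mul_assoc d.Q', Q'_mul_Qinv, Matrix.one_mul, flip_mul_flip]

theorem X_mul_inv (d : LorentzType) : d.X * d.X⁻¹ = 1 := by
  rw [X_inv, X, Matrix.mul_assoc, ← Matrix.mul_assoc d.Q', Q'_mul_Qinv, Matrix.one_mul,
    flip_mul_flip]

theorem X_inv_mul (d : LorentzType) : d.X⁻¹ * d.X = 1 :=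
  mul_eq_one_comm.mp d.X_mul_inv

theorem X_inv_apply (d : LorentzType) (p : Fin 2 × Fin 2) (C D : Fin 2) :
    d.X⁻¹ p (C, D) = d.Qinv p (D, C) := by
  rw [X_inv, mul_flip_apply]

theorem onPairs_apply (M : Matrix (Fin 4) (Fin 4) ℂ) (A B C D : Fin 2) :
    onPairs M (A, B) (C, D) =
      M ((![![0, 1], ![2, 3]] : Fin 2 → Fin 2 → Fin 4) A B)
        ((![![0, 1], ![2, 3]] : Fin 2 → Fin 2 → Fin 4) C D) := by
  fin_cases A <;> fin_cases B <;> fin_cases C <;> fin_cases D <;> rfl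

/-- Bending one leg with `E` turns `Q'` into its inverse. This is the essential input from the list
of seven families about how `X` meets `E`; it is checked entry by entry, and the other crossing
identities are formal consequences of it and of reality. -/
theorem Q'_crossing (d : LorentzType) : ∀ U C V S : Fin 2,
    ∑ T, d.Q' (C, U) (T, V) * d.E S T = ∑ A, d.Qinv (S, U) (A, V) * d.E A C := by
  rcases d with ⟨t, ht, h⟩ | ⟨c, hc⟩ | ⟨c, r, hc, hr⟩ | ⟨c, hc⟩ | ⟨t, ht, h⟩ | ⟨c, hc⟩ | ⟨t, ht, h⟩
  all_goals
    simp [Q', Qinv, onPairs_apply, Fin.forall_fin_two, Fin.sum_univ_two,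
      E]
  ring

theorem X_crossing (d : LorentzType) (U C V S : Fin 2) :
    ∑ T, d.X (U, C) (T, V) * d.E S T = ∑ A, d.X⁻¹ (S, U) (V, A) * d.E A C := by
  simp only [X_apply, X_inv_apply, Q'_crossing]

/-- Reality of `X` up to the sign `q`, which comes from the prefactor `i` in the last three
families. It makes the adjoint of the exchange relation between `w` and `w*` a multiple of an
exchange relation. -/
theorem conj_Q' (d : LorentzType) : ∀ A B C D : Fin 2,
    starRingEnd ℂ (d.Q' (A, B) (C, D)) = d.q * d.Q' (B, A) (D, C) := by
  rcases d with ⟨t, ht, h⟩ | ⟨c, hc⟩ | ⟨c, r, hc, hr⟩ | ⟨c, hc⟩ | ⟨t, ht, h⟩ | ⟨c, hc⟩ | ⟨t, ht, h⟩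
  all_goals
    simp [Q', onPairs_apply, Fin.forall_fin_two, q, Complex.conj_ofNat]

theorem conj_X (d : LorentzType) (A B C D : Fin 2) :
    starRingEnd ℂ (d.X (A, B) (C, D)) = d.q * d.X (B, A) (D, C) := by
  simp only [X_apply, conj_Q']

theorem E'_mul_E (d : LorentzType) : d.E' * d.E = 1 := by
  rcases d <;> ext i j <;> fin_cases i <;> fin_cases j <;> simp [E, E']

theorem E_mul_E' (d : LorentzType) : d.E * d.E' = 1 := mul_eq_one_comm.mp d.E'_mul_E

theorem conj_E (d : LorentzType) : ∀ A B, starRingEnd ℂ (d.E A B) = d.E A B := by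
  rcases d <;> simp [E, Fin.forall_fin_two]

theorem conj_E' (d : LorentzType) : ∀ A B, starRingEnd ℂ (d.E' A B) = d.E' A B := by
  rcases d <;> simp [E', Fin.forall_fin_two]

theorem E'_apply_E (d : LorentzType) : ∑ A, ∑ B, d.E' A B * d.E A B = -2 * d.q := by
  rcases d <;> simp [E, E', q] <;> ring

theorem q_mul_q (d : LorentzType) : d.q * d.q = 1 := by rcases d <;> simp [q]

theorem qHalf_mul_qHalf (d : LorentzType) : d.qHalf * d.qHalf = d.q := by
  rcases d <;> simp [q, qHalf]

theorem conj_q (d : LorentzType) : starRingEnd ℂ d.q = d.q := by rcases d <;> simp [q]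

theorem conj_qHalf (d : LorentzType) : starRingEnd ℂ d.qHalf = d.q * d.qHalf := by
  rcases d <;> simp [q, qHalf]

theorem X_mul_inv_apply (d : LorentzType) (A B C D : Fin 2) :
    ∑ S, ∑ U, d.X (A, B) (S, U) * d.X⁻¹ (S, U) (C, D) = if A = C ∧ B = D then 1 else 0 := by
  have h := congrFun (congrFun d.X_mul_inv (A, B)) (C, D)
  simpa only [Matrix.mul_apply, Fintype.sum_prod_type, Matrix.one_apply, Prod.mk.injEq] using h

theorem X_inv_mul_apply (d : LorentzType) (A B C D : Fin 2) :
    ∑ S, ∑ U, d.X⁻¹ (A, B) (S, U) * d.X (S, U) (C, D) = if A = C ∧ B = D then 1 else 0 := by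
  have h := congrFun (congrFun d.X_inv_mul (A, B)) (C, D)
  simpa only [Matrix.mul_apply, Fintype.sum_prod_type, Matrix.one_apply, Prod.mk.injEq] using h

theorem E'_mul_E_apply (d : LorentzType) (A C : Fin 2) :
    ∑ B, d.E' A B * d.E B C = if A = C then 1 else 0 := by
  have h := congrFun (congrFun d.E'_mul_E A) C
  simpa only [Matrix.mul_apply, Matrix.one_apply] using h

theorem E_mul_E'_apply (d : LorentzType) (A C : Fin 2) :
    ∑ B, d.E A B * d.E' B C = if A = C then 1 else 0 := by
  have h := congrFun (congrFun d.E_mul_E' A) C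
  simpa only [Matrix.mul_apply, Matrix.one_apply] using h

theorem conj_X_inv (d : LorentzType) (A B C D : Fin 2) :
    starRingEnd ℂ (d.X⁻¹ (A, B) (C, D)) = d.q * d.X⁻¹ (B, A) (D, C) := by
  have h1 : d.X.map (starRingEnd ℂ) = d.q • (flip * d.X * flip) := by
    ext ⟨A, B⟩ ⟨C, D⟩
    simp only [Matrix.map_apply, conj_X, Matrix.smul_apply, mul_flip_apply, flip_mul_apply,
      smul_eq_mul]
  have h2 : d.X⁻¹.map (starRingEnd ℂ) = d.q • (flip * d.X⁻¹ * flip) := by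
    have h3 : d.X⁻¹.map (starRingEnd ℂ) * d.X.map (starRingEnd ℂ) = 1 := by
      rw [← Matrix.map_mul, X_inv_mul, Matrix.map_one _ (map_zero _) (map_one _)]
    have h4 : d.X.map (starRingEnd ℂ) * (d.q • (flip * d.X⁻¹ * flip)) = 1 := by
      rw [h1, Matrix.smul_mul, Matrix.mul_smul, smul_smul, q_mul_q, one_smul]
      calc flip * d.X * flip * (flip * d.X⁻¹ * flip)
          = flip * (d.X * ((flip * flip) * d.X⁻¹)) * flip := by simp only [Matrix.mul_assoc]
        _ = 1 := by rw [flip_mul_flip, Matrix.one_mul, X_mul_inv, Matrix.mul_one, flip_mul_flip]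
    exact left_inv_eq_right_inv h3 h4
  have h := congrFun (congrFun h2 (A, B)) (C, D)
  simpa only [Matrix.map_apply, Matrix.smul_apply, mul_flip_apply, flip_mul_apply,
      smul_eq_mul] using h

/-- Contract `X_crossing` with `E'` on both open legs and cancel through `E'E = EE' = 1`. -/
theorem X_crossing' (d : LorentzType) (U P V Q : Fin 2) :
    ∑ C, d.X (U, C) (P, V) * d.E' C Q = ∑ S, d.E' P S * d.X⁻¹ (S, U) (V, Q) := by
  calc ∑ C, d.X (U, C) (P, V) * d.E' C Q
      = ∑ C, (∑ T, (∑ S, d.E' P S * d.E S T) * d.X (U, C) (T, V)) * d.E' C Q := by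
        simp only [E'_mul_E_apply, ite_mul, one_mul, zero_mul, Finset.sum_ite_eq, Finset.mem_univ,
          if_true]
    _ = ∑ C, (∑ S, d.E' P S * ∑ T, d.X (U, C) (T, V) * d.E S T) * d.E' C Q := by
        simp only [Fin.sum_univ_two]; ring
    _ = ∑ C, (∑ S, d.E' P S * ∑ A, d.X⁻¹ (S, U) (V, A) * d.E A C) * d.E' C Q := by
        simp only [X_crossing]
    _ = ∑ S, d.E' P S * ∑ A, d.X⁻¹ (S, U) (V, A) * ∑ C, d.E A C * d.E' C Q := by
        simp only [Fin.sum_univ_two]; ring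
    _ = _ := by
        simp only [E_mul_E'_apply, mul_ite, mul_one, mul_zero, Finset.sum_ite_eq', Finset.mem_univ,
          if_true]

/-- The complex conjugate of `X_crossing`: `E` is real, and each side acquires one factor `q`,
removed by `q² = 1`. -/
theorem X_crossing_flip (d : LorentzType) (U C V S : Fin 2) :
    ∑ T, d.X (C, U) (V, T) * d.E S T = ∑ A, d.X⁻¹ (U, S) (A, V) * d.E A C := by
  have h := congrArg (fun z => d.q * starRingEnd ℂ z) (d.X_crossing U C V S)
  simp only [map_sum, map_mul, conj_X, conj_X_inv, conj_E, Finset.mul_sum] at h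
  simpa only [← mul_assoc, q_mul_q, one_mul] using h

theorem X_crossing'_flip (d : LorentzType) (U P V Q : Fin 2) :
    ∑ C, d.X (C, U) (V, P) * d.E' C Q = ∑ S, d.E' P S * d.X⁻¹ (U, S) (Q, V) := by
  have h := congrArg (fun z => d.q * starRingEnd ℂ z) (d.X_crossing' U P V Q)
  simp only [map_sum, map_mul, conj_X, conj_X_inv, conj_E', Finset.mul_sum,
    mul_left_comm _ d.q] at h
  simpa only [← mul_assoc, q_mul_q, one_mul] using h

/-- Identities involving `L` but not `X` depend only on `q` and `c`, so this replaces seven families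
by two polynomial checks. -/
theorem E_normal_form (d : LorentzType) : ∃ c : ℂ, d.E = !![c, 1; -d.q, 0] ∧
    d.E' = !![0, -d.q; 1, c] ∧ (d.q = 1 ∨ d.q = -1 ∧ c = 0) := by
  rcases d with ⟨t, ht, h⟩ | ⟨c, hc⟩ | ⟨c, r, hc, hr⟩ | ⟨c, hc⟩ | ⟨t, ht, h⟩ | ⟨c, hc⟩ | ⟨t, ht, h⟩
  · exact ⟨0, by simp [E, E', q]⟩
  · exact ⟨0, by simp [E, E', q]⟩
  · exact ⟨c, by simp [E, E', q]⟩
  · exact ⟨c, by simp [E, E', q]⟩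
  · exact ⟨0, by simp [E, E', q]⟩
  · exact ⟨0, by simp [E, E', q]⟩
  · exact ⟨0, by simp [E, E', q]⟩

end LorentzType

/-! ### Representations of the Lorentz relations and the universal property of `𝒜`. -/

/-- Elements `w A B` and `ws A B` of an algebra that satisfy the relations of the entries of the
fundamental corepresentation of a quantum Lorentz group and of its conjugate. -/
structure LorentzRep (d : LorentzType) {F : Type} [Ring F] [Algebra ℂ F]
    (w ws : Fin 2 → Fin 2 → F) : Prop where
  E : ∀ A C, ∑ B, ∑ D, d.E B D • (w A B * w C D) = algebraMap ℂ F (d.E A C)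
  E' : ∀ B D, ∑ A, ∑ C, d.E' A C • (w A B * w C D) = algebraMap ℂ F (d.E' B D)
  conjE : ∀ A C, ∑ B, ∑ D, d.E B D • (ws C D * ws A B) = algebraMap ℂ F (d.E A C)
  conjE' : ∀ B D, ∑ A, ∑ C, d.E' A C • (ws C D * ws A B) = algebraMap ℂ F (d.E' B D)
  X : ∀ A B K L, ∑ C, ∑ D, d.X (A, B) (C, D) • (w C K * ws D L) =
    ∑ C, ∑ D, d.X (C, D) (K, L) • (ws A C * w B D)

/-- The convolution product of two commuting representations. -/
theorem LorentzRep.mul {d : LorentzType} {F : Type} [Ring F] [Algebra ℂ F]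
    {w ws w' ws' : Fin 2 → Fin 2 → F} (h : LorentzRep d w ws) (h' : LorentzRep d w' ws')
    (hww : ∀ A B C D, w' A B * w C D = w C D * w' A B)
    (hws : ∀ A B C D, w' A B * ws C D = ws C D * w' A B)
    (hsw : ∀ A B C D, ws' A B * w C D = w C D * ws' A B)
    (hss : ∀ A B C D, ws' A B * ws C D = ws C D * ws' A B) :
    LorentzRep d (fun A C => ∑ S, w A S * w' S C) (fun A C => ∑ S, ws A S * ws' S C) where
  E A C := by
    calc _ = ∑ S, ∑ T, (w A S * w C T) * ∑ B, ∑ D, d.E B D • (w' S B * w' T D) := by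
          simp only [Fin.sum_univ_two, mul_add, add_mul, smul_add, mul_smul_comm, mul_assoc]
          simp only [← mul_assoc (w' _ _) (w _ _), hww, mul_assoc]
          abel
      _ = _ := by
          simp only [h'.E, ← h.E A C, Algebra.algebraMap_eq_smul_one, mul_smul_comm, mul_one]
  E' B D := by
    calc _ = ∑ S, ∑ T, (∑ A, ∑ C, d.E' A C • (w A S * w C T)) * (w' S B * w' T D) := by
          simp only [Fin.sum_univ_two, mul_add, add_mul, smul_add, smul_mul_assoc, mul_assoc]
          simp only [← mul_assoc (w' _ _) (w _ _), hww, mul_assoc]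
          abel
      _ = _ := by
          simp only [h.E', ← h'.E' B D, Algebra.algebraMap_eq_smul_one, smul_mul_assoc, one_mul]
  conjE A C := by
    calc _ = ∑ S, ∑ T, (ws C T * ws A S) * ∑ B, ∑ D, d.E B D • (ws' T D * ws' S B) := by
          simp only [Fin.sum_univ_two, mul_add, add_mul, smul_add, mul_smul_comm, mul_assoc]
          simp only [← mul_assoc (ws' _ _) (ws _ _), hss, mul_assoc]
          abel
      _ = _ := by
          simp only [h'.conjE, ← h.conjE A C, Algebra.algebraMap_eq_smul_one, mul_smul_comm,
            mul_one]
  conjE' B D := by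
    calc _ = ∑ S, ∑ T, (∑ A, ∑ C, d.E' A C • (ws C T * ws A S)) * (ws' T D * ws' S B) := by
          simp only [Fin.sum_univ_two, mul_add, add_mul, smul_add, smul_mul_assoc, mul_assoc]
          simp only [← mul_assoc (ws' _ _) (ws _ _), hss, mul_assoc]
          abel
      _ = _ := by
          simp only [h.conjE', ← h'.conjE' B D, Algebra.algebraMap_eq_smul_one, smul_mul_assoc,
            one_mul]
  X A B K L := by
    calc _ = ∑ S, ∑ T, (∑ C, ∑ D, d.X (A, B) (C, D) • (w C S * ws D T)) * (w' S K * ws' T L) := by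
          simp only [Fin.sum_univ_two, mul_add, add_mul, smul_add, smul_mul_assoc, mul_assoc]
          simp only [← mul_assoc (w' _ _) (ws _ _), hws, mul_assoc]
          abel
      _ = ∑ S, ∑ T, (ws A S * w B T) * ∑ C, ∑ D, d.X (S, T) (C, D) • (w' C K * ws' D L) := by
          simp only [h.X]
          simp only [Fin.sum_univ_two, mul_add, add_mul, smul_add, smul_mul_assoc, mul_smul_comm,
            mul_assoc]
          abel
      _ = _ := by
          simp only [h'.X]
          simp only [Fin.sum_univ_two, mul_add, add_mul, smul_add, mul_smul_comm,
            mul_assoc]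
          simp only [← mul_assoc (ws' _ _) (w _ _), hsw, mul_assoc]
          abel

/-- The image of a representation under a homomorphism of algebras. -/
theorem LorentzRep.map {d : LorentzType} {F F' : Type} [Ring F] [Algebra ℂ F] [Ring F']
    [Algebra ℂ F'] {w ws : Fin 2 → Fin 2 → F} (h : LorentzRep d w ws) (φ : F →ₐ[ℂ] F') :
    LorentzRep d (fun A B => φ (w A B)) (fun A B => φ (ws A B)) where
  E A C := by simpa only [map_sum, map_smul, map_mul, AlgHom.commutes] using congrArg φ (h.E A C)
  E' A C := by simpa only [map_sum, map_smul, map_mul, AlgHom.commutes] using congrArg φ (h.E' A C)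
  conjE A C := by
    simpa only [map_sum, map_smul, map_mul, AlgHom.commutes] using congrArg φ (h.conjE A C)
  conjE' A C := by
    simpa only [map_sum, map_smul, map_mul, AlgHom.commutes] using congrArg φ (h.conjE' A C)
  X A B K L := by
    simpa only [map_sum, map_smul, map_mul] using congrArg φ (h.X A B K L)

theorem adj_smul {X : Type} (σ : X → X) (c : ℂ) (a : FreeAlgebra ℂ X) :
    adj σ (c • a) = starRingEnd ℂ c • adj σ a := by
  rw [Algebra.smul_def, adj_mul, adj_algebraMap, Algebra.smul_def, Algebra.commutes]

theorem adj_sub {X : Type} (σ : X → X) (a b : FreeAlgebra ℂ X) :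
    adj σ (a - b) = adj σ a - adj σ b := by
  simp [adj]

theorem adj_sum {X ι : Type} (σ : X → X) (s : Finset ι) (f : ι → FreeAlgebra ℂ X) :
    adj σ (∑ i ∈ s, f i) = ∑ i ∈ s, adj σ (f i) :=
  map_sum (AddMonoidHom.mk' (adj σ) (adj_add σ)) f s

/-- The defining elements of an algebra with the star-relations of a quantum Lorentz group
satisfy the relations of a representation. -/
theorem LorentzRep.of_star {d : LorentzType} {G F : Type} [Ring F] [Algebra ℂ F] {σ : G → G}
    (φ : FreeAlgebra ℂ G →ₐ[ℂ] F) {w ws : Fin 2 → Fin 2 → G}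
    (hw : ∀ A B, σ (w A B) = ws A B) (hws : ∀ A B, σ (ws A B) = w A B)
    (h : ∀ p ∈ lorentzRelations d (fun A B => FreeAlgebra.ι ℂ (w A B))
      (fun A B => FreeAlgebra.ι ℂ (ws A B)), φ p = 0 ∧ φ (adj σ p) = 0) :
    LorentzRep d (fun A B => φ (FreeAlgebra.ι ℂ (w A B))) (fun A B => φ (FreeAlgebra.ι ℂ (ws A B)))
    where
  E A C := by
    have := (h _ (Or.inl ⟨A, C, rfl⟩)).1
    simpa only [map_sub, map_sum, map_smul, map_mul, AlgHom.commutes, sub_eq_zero] using this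
  E' A C := by
    have := (h _ (Or.inr (Or.inl ⟨A, C, rfl⟩))).1
    simpa only [map_sub, map_sum, map_smul, map_mul, AlgHom.commutes, sub_eq_zero] using this
  conjE A C := by
    have := (h _ (Or.inl ⟨A, C, rfl⟩)).2
    simpa only [adj_sub, adj_sum, adj_smul, adj_mul, adj_gen, adj_algebraMap, hw,
      LorentzType.conj_E, map_sub, map_sum, map_smul, map_mul, AlgHom.commutes, sub_eq_zero]
      using this
  conjE' A C := by
    have := (h _ (Or.inr (Or.inl ⟨A, C, rfl⟩))).2
    simpa only [adj_sub, adj_sum, adj_smul, adj_mul, adj_gen, adj_algebraMap, hw,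
      LorentzType.conj_E', map_sub, map_sum, map_smul, map_mul, AlgHom.commutes, sub_eq_zero]
      using this
  X A B K L := by
    have := (h _ (Or.inr (Or.inr ⟨A, B, K, L, rfl⟩))).1
    simpa only [map_sub, map_sum, map_smul, map_mul, AlgHom.commutes, sub_eq_zero] using this

/-- Shows that the five relations of a `LorentzRep` suffice although `F` carries no star. The
adjoints of the `E` and `E'` relations are among the five, and the adjoint of an exchange relation
is `q` times the one with swapped indices. -/
theorem LorentzRep.adj_relation {d : LorentzType} {F : Type} [Ring F] [Algebra ℂ F]
    (φ : FreeAlgebra ℂ LorentzGen →ₐ[ℂ] F)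
    (h : LorentzRep d (fun A B => φ (FreeAlgebra.ι ℂ (LorentzGen.w A B)))
      (fun A B => φ (FreeAlgebra.ι ℂ (LorentzGen.wstar A B))))
    (p : FreeAlgebra ℂ LorentzGen) (hp : p ∈ lorentzFreeRelations d) :
    φ p = 0 ∧ φ (adj LorentzGen.inv p) = 0 := by
  rcases hp with ⟨A, C, rfl⟩ | ⟨B, D, rfl⟩ | ⟨A, B, K, L, rfl⟩
  · simp only [adj_sub, adj_sum, adj_smul, adj_mul, adj_gen, adj_algebraMap, LorentzGen.inv,
      LorentzType.conj_E, map_sub, map_sum, map_smul, map_mul, AlgHom.commutes, sub_eq_zero]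
    exact ⟨h.E A C, h.conjE A C⟩
  · simp only [adj_sub, adj_sum, adj_smul, adj_mul, adj_gen, adj_algebraMap, LorentzGen.inv,
      LorentzType.conj_E', map_sub, map_sum, map_smul, map_mul, AlgHom.commutes, sub_eq_zero]
    exact ⟨h.E' B D, h.conjE' B D⟩
  · simp only [adj_sub, adj_sum, adj_smul, adj_mul, adj_gen, LorentzGen.inv,
      LorentzType.conj_X, map_sub, map_sum, map_smul, map_mul, sub_eq_zero]
    refine ⟨h.X A B K L, ?_⟩
    simp only [mul_smul, ← Finset.smul_sum]
    congr 1
    rw [Finset.sum_comm, h.X B A L K, Finset.sum_comm]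

/-- The homomorphism from the algebra of a quantum Lorentz group given by a representation. -/
def LorentzRep.lift {d : LorentzType} {F : Type} [Ring F] [Algebra ℂ F]
    {w ws : Fin 2 → Fin 2 → F} (h : LorentzRep d w ws) : LorentzAlgebra d →ₐ[ℂ] F :=
  RingQuot.liftAlgHom ℂ
    ⟨FreeAlgebra.lift ℂ (fun g => match g with
      | LorentzGen.w A B => w A B
      | LorentzGen.wstar A B => ws A B), by
      have key := LorentzRep.adj_relation (d := d)
        (FreeAlgebra.lift ℂ (fun g => match g with
          | LorentzGen.w A B => w A B
          | LorentzGen.wstar A B => ws A B)) (by simpa only [FreeAlgebra.lift_ι_apply] using h)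
      rintro a b ⟨rfl, ha | ⟨c, hc, rfl⟩⟩
      · rw [map_zero]
        exact (key a ha).1
      · rw [map_zero]
        exact (key c hc).2⟩

/-- The entries of the fundamental corepresentation. -/
def lorentzW (d : LorentzType) (A B : Fin 2) : LorentzAlgebra d :=
  StarPres.mk _ _ (FreeAlgebra.ι ℂ (LorentzGen.w A B))

/-- The adjoints of the entries of the fundamental corepresentation. -/
def lorentzWstar (d : LorentzType) (A B : Fin 2) : LorentzAlgebra d :=
  StarPres.mk _ _ (FreeAlgebra.ι ℂ (LorentzGen.wstar A B))

theorem StarPres.mk_relation {X : Type} {σ : X → X} {P : Set (FreeAlgebra ℂ X)}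
    {p : FreeAlgebra ℂ X} (hp : p ∈ P) :
    StarPres.mk σ P p = 0 ∧ StarPres.mk σ P (adj σ p) = 0 := by
  constructor
  · simpa [StarPres.mk] using
      RingQuot.mkAlgHom_rel ℂ (show StarRel σ P p 0 from ⟨rfl, Or.inl hp⟩)
  · simpa [StarPres.mk] using
      RingQuot.mkAlgHom_rel ℂ (show StarRel σ P (adj σ p) 0 from ⟨rfl, Or.inr ⟨p, hp, rfl⟩⟩)

theorem LorentzRep.lift_w {d : LorentzType} {F : Type} [Ring F] [Algebra ℂ F]
    {w ws : Fin 2 → Fin 2 → F} (h : LorentzRep d w ws) (A B : Fin 2) :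
    h.lift (lorentzW d A B) = w A B := by
  simp [LorentzRep.lift, lorentzW, StarPres.mk]

theorem LorentzRep.lift_wstar {d : LorentzType} {F : Type} [Ring F] [Algebra ℂ F]
    {w ws : Fin 2 → Fin 2 → F} (h : LorentzRep d w ws) (A B : Fin 2) :
    h.lift (lorentzWstar d A B) = ws A B := by
  simp [LorentzRep.lift, lorentzWstar, StarPres.mk]

/-- The character of the quantum Lorentz group with `w ↦ -1` and `w* ↦ 1`. -/
theorem lorentzRep_parity (d : LorentzType) :
    LorentzRep d (F := ℂ) (fun A B => if A = B then -1 else 0) (fun A B => if A = B then 1 else 0)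
    where
  -- Signs cancel in relations quadratic in `w`, and the exchange relation is of degree one in `w`
  -- on both sides. This character does not respect the star; one with `w` and `w*` both equal to
  -- `-1` would send `Λ` to `+1` and be useless later.
  E A C := by simp [Finset.sum_ite_eq]
  E' A C := by simp
  conjE A C := by simp
  conjE' A C := by simp
  X A B K L := by simp

/-! ### Identities of `L` and `L̃`. -/

namespace PoincareDatum

theorem s_mul_s (P : PoincareDatum) : (((P.s : ℤ) : ℂ)) * ((P.s : ℤ) : ℂ) = 1 := by
  rcases Int.units_eq_one_or P.s with h | h <;> simp [h]

theorem conj_s (P : PoincareDatum) : starRingEnd ℂ ((P.s : ℤ) : ℂ) = ((P.s : ℤ) : ℂ) := by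
  rcases Int.units_eq_one_or P.s with h | h <;> simp [h]

/-- The scalar `s q^{1/2}`. -/
def kappa (P : PoincareDatum) : ℂ := ((P.s : ℤ) : ℂ) * P.lor.qHalf

theorem kappa_mul_kappa (P : PoincareDatum) : P.kappa * P.kappa = P.lor.q := by
  rw [kappa, mul_mul_mul_comm, s_mul_s, one_mul, LorentzType.qHalf_mul_qHalf]

theorem conj_kappa (P : PoincareDatum) : starRingEnd ℂ P.kappa = P.lor.q * P.kappa := by
  rw [kappa, map_mul, conj_s, LorentzType.conj_qHalf]
  ring

theorem L_apply (P : PoincareDatum) (A B C D : Fin 2) : P.L (A, B) (C, D) =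
    P.kappa * ((if A = C ∧ B = D then 1 else 0) + P.lor.q * (P.lor.E A B * P.lor.E' C D)) := by
  simp [L, kappa, Matrix.one_apply]

theorem Ltilde_apply (P : PoincareDatum) (A B C D : Fin 2) :
    P.Ltilde (A, B) (C, D) = P.lor.q * P.L (B, A) (D, C) := by
  simp [Ltilde, LorentzType.mul_flip_apply, LorentzType.flip_mul_apply]

theorem conj_L (P : PoincareDatum) (A B C D : Fin 2) :
    starRingEnd ℂ (P.L (A, B) (C, D)) = P.lor.q * P.L (A, B) (C, D) := by
  rw [L_apply, map_mul, conj_kappa, map_add, map_mul, map_mul, LorentzType.conj_q,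
    LorentzType.conj_E, LorentzType.conj_E', mul_assoc]
  congr 3
  split_ifs <;> simp

/-- Because `E'E = -2q`, the element `1 + qEE'` squares to `1`; what remains is the square of the
prefactor, `κ² = q`. -/
theorem L_mul_L (P : PoincareDatum) (A B C D : Fin 2) :
    ∑ S, ∑ U, P.L (A, B) (S, U) * P.L (S, U) (C, D) =
      P.lor.q * if A = C ∧ B = D then 1 else 0 := by
  obtain ⟨c, hE, hE', hq⟩ := P.lor.E_normal_form
  have hk := P.kappa_mul_kappa
  revert A B C D
  simp only [L_apply, hE, hE']
  rcases hq with hq | ⟨hq, rfl⟩ <;> simp [Fin.forall_fin_two, hq] <;> simp [hq] at hk <;> grind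

/-- A strand passes through the invariant vector `E`: this is the relation `(w ⊗ w)E = E` for the
matrices obtained from `L`. -/
theorem L_E (P : PoincareDatum) : ∀ M A C U, ∑ B, ∑ D, ∑ W,
    P.lor.E B D * (P.L (M, A) (B, W) * P.L (W, C) (D, U)) = if M = U then P.lor.E A C else 0 := by
  obtain ⟨c, hE, hE', hq⟩ := P.lor.E_normal_form
  have hk := P.kappa_mul_kappa
  simp only [L_apply, hE, hE']
  rcases hq with hq | ⟨hq, rfl⟩ <;> simp [Fin.forall_fin_two, hq] <;> simp [hq] at hk <;> grind

theorem L_E' (P : PoincareDatum) : ∀ M B D U, ∑ A, ∑ C, ∑ W,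
    P.lor.E' A C * (P.L (M, A) (B, W) * P.L (W, C) (D, U)) = if M = U then P.lor.E' B D else 0 := by
  obtain ⟨c, hE, hE', hq⟩ := P.lor.E_normal_form
  have hk := P.kappa_mul_kappa
  simp only [L_apply, hE, hE']
  rcases hq with hq | ⟨hq, rfl⟩ <;> simp [Fin.forall_fin_two, hq] <;> simp [hq] at hk <;> grind

theorem Ltilde_E (P : PoincareDatum) : ∀ M A C U, ∑ B, ∑ D, ∑ W,
    P.lor.E B D * (P.Ltilde (M, C) (D, W) * P.Ltilde (W, A) (B, U)) =
      if M = U then P.lor.E A C else 0 := by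
  obtain ⟨c, hE, hE', hq⟩ := P.lor.E_normal_form
  have hk := P.kappa_mul_kappa
  simp only [Ltilde_apply, L_apply, hE, hE']
  rcases hq with hq | ⟨hq, rfl⟩ <;> simp [Fin.forall_fin_two, hq] <;> simp [hq] at hk <;> grind

theorem Ltilde_E' (P : PoincareDatum) : ∀ M B D U, ∑ A, ∑ C, ∑ W,
    P.lor.E' A C * (P.Ltilde (M, C) (D, W) * P.Ltilde (W, A) (B, U)) =
      if M = U then P.lor.E' B D else 0 := by
  obtain ⟨c, hE, hE', hq⟩ := P.lor.E_normal_form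
  have hk := P.kappa_mul_kappa
  simp only [Ltilde_apply, L_apply, hE, hE']
  rcases hq with hq | ⟨hq, rfl⟩ <;> simp [Fin.forall_fin_two, hq] <;> simp [hq] at hk <;> grind

end PoincareDatum

namespace LorentzType

/-- Crossing converts the second `X` into `X⁻¹`, which cancels the first. The three analogues below
work the same way. -/
theorem X_X_E (d : LorentzType) (N A C V : Fin 2) :
    ∑ S, ∑ T, ∑ U, d.E S T * (d.X (N, A) (S, U) * d.X (U, C) (T, V)) =
      if N = V then d.E A C else 0 := by
  calc _ = ∑ S, ∑ U, d.X (N, A) (S, U) * ∑ T, d.X (U, C) (T, V) * d.E S T := by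
        simp only [Fin.sum_univ_two]; ring
    _ = ∑ A', (∑ S, ∑ U, d.X (N, A) (S, U) * d.X⁻¹ (S, U) (V, A')) * d.E A' C := by
        simp only [X_crossing]; simp only [Fin.sum_univ_two]; ring
    _ = _ := by simp only [X_mul_inv_apply, ite_and, ite_mul, one_mul, zero_mul]; split_ifs <;> simp

theorem X_X_E' (d : LorentzType) (N S T V : Fin 2) :
    ∑ A, ∑ C, ∑ U, d.E' A C * (d.X (N, A) (S, U) * d.X (U, C) (T, V)) =
      if N = V then d.E' S T else 0 := by
  calc _ = ∑ U, ∑ C, (∑ A, d.X (N, A) (S, U) * d.E' A C) * d.X (U, C) (T, V) := by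
        simp only [Fin.sum_univ_two]; ring
    _ = ∑ S', d.E' S S' * ∑ U, ∑ C, d.X⁻¹ (S', N) (U, C) * d.X (U, C) (T, V) := by
        simp only [X_crossing']; simp only [Fin.sum_univ_two]; ring
    _ = _ := by
      simp only [X_inv_mul_apply, ite_and, mul_ite, mul_one, mul_zero]; simp

theorem X_inv_X_inv_E (d : LorentzType) (M A C U : Fin 2) :
    ∑ B, ∑ D, ∑ W, d.E B D * (d.X⁻¹ (M, C) (D, W) * d.X⁻¹ (W, A) (B, U)) =
      if M = U then d.E A C else 0 := by
  calc _ = ∑ D, ∑ W, d.X⁻¹ (M, C) (D, W) * ∑ B, d.X⁻¹ (W, A) (B, U) * d.E B D := by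
        simp only [Fin.sum_univ_two]; ring
    _ = ∑ T, d.E A T * ∑ D, ∑ W, d.X⁻¹ (M, C) (D, W) * d.X (D, W) (U, T) := by
        simp only [← X_crossing_flip]; simp only [Fin.sum_univ_two]; ring
    _ = _ := by
      simp only [X_inv_mul_apply, ite_and, mul_ite, mul_one, mul_zero]; simp

theorem X_inv_X_inv_E' (d : LorentzType) (M B D U : Fin 2) :
    ∑ A, ∑ C, ∑ W, d.E' A C * (d.X⁻¹ (M, C) (D, W) * d.X⁻¹ (W, A) (B, U)) =
      if M = U then d.E' B D else 0 := by
  calc _ = ∑ W, ∑ A, (∑ C, d.E' A C * d.X⁻¹ (M, C) (D, W)) * d.X⁻¹ (W, A) (B, U) := by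
        simp only [Fin.sum_univ_two]; ring
    _ = ∑ C, (∑ W, ∑ A, d.X (C, M) (W, A) * d.X⁻¹ (W, A) (B, U)) * d.E' C D := by
        simp only [← X_crossing'_flip]; simp only [Fin.sum_univ_two]; ring
    _ = _ := by simp only [X_mul_inv_apply, ite_and, ite_mul, one_mul, zero_mul]; simp

theorem X_EE'_X_inv (d : LorentzType) (A B M K F U : Fin 2) :
    ∑ C, ∑ D, ∑ W, d.X (A, B) (C, D) * ((d.E M C * d.E' K W) * d.X⁻¹ (W, D) (F, U)) =
      ∑ C, ∑ D, ∑ W, d.X (C, D) (K, F) * (d.X⁻¹ (M, A) (C, W) * (d.E W B * d.E' D U)) := by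
  calc _ = ∑ D, (∑ C, d.X (A, B) (C, D) * d.E M C) * ∑ W, d.E' K W * d.X⁻¹ (W, D) (F, U) := by
        simp only [Fin.sum_univ_two]; ring
    _ = _ := by
        simp only [X_crossing, ← X_crossing']
        simp only [Fin.sum_univ_two]; ring

theorem X_X_EE' (d : LorentzType) (A B M K F U : Fin 2) :
    ∑ C, ∑ D, ∑ W, d.X (A, B) (C, D) * (d.X (M, C) (K, W) * (d.E D W * d.E' U F)) =
      ∑ C, ∑ D, ∑ W, d.X (C, D) (K, F) * ((d.E A M * d.E' W C) * d.X (W, B) (D, U)) := by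
  calc _ = (∑ A', (∑ C, ∑ D, d.X (A, B) (C, D) * d.X⁻¹ (C, D) (A', K)) * d.E A' M) * d.E' U F := by
        calc _ = (∑ C, ∑ D, d.X (A, B) (C, D) * ∑ W, d.X (M, C) (K, W) * d.E D W) * d.E' U F := by
              simp only [Fin.sum_univ_two]; ring
          _ = _ := by
              simp only [X_crossing_flip]; simp only [Fin.sum_univ_two]; ring
    _ = (if B = K then 1 else 0) * d.E A M * d.E' U F := by
        simp only [X_mul_inv_apply, ite_and, ite_mul, one_mul, zero_mul]; simp
    _ = d.E A M * ∑ S, d.E' U S * ∑ C, ∑ D, d.X⁻¹ (B, S) (C, D) * d.X (C, D) (K, F) := by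
        simp only [X_inv_mul_apply, ite_and, mul_ite, mul_one, mul_zero]
        split_ifs <;> simp
    _ = d.E A M * ∑ C, ∑ D, (∑ W, d.X (W, B) (D, U) * d.E' W C) * d.X (C, D) (K, F) := by
        simp only [X_crossing'_flip]; simp only [Fin.sum_univ_two]; ring
    _ = _ := by
        simp only [Fin.sum_univ_two]; ring

end LorentzType

/-! ### Braiding matrices as representations on spinors and vectors. -/

namespace PoincareDatum

/-- The representation of the quantum Lorentz group on `ℂ²` given by the braiding of the
fundamental corepresentation: action of `w`. -/
def braidW (P : PoincareDatum) (A C : Fin 2) : Matrix (Fin 2) (Fin 2) ℂ :=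
  Matrix.of fun M W => P.L (M, A) (C, W)

/-- Braiding of the fundamental corepresentation: action of `w*`. -/
def braidWstar (P : PoincareDatum) (A C : Fin 2) : Matrix (Fin 2) (Fin 2) ℂ :=
  Matrix.of fun M W => P.lor.X⁻¹ (M, A) (C, W)

/-- Braiding of the conjugate corepresentation: action of `w`. -/
def conjBraidW (P : PoincareDatum) (A C : Fin 2) : Matrix (Fin 2) (Fin 2) ℂ :=
  Matrix.of fun N U => P.lor.X (N, A) (C, U)

/-- Braiding of the conjugate corepresentation: action of `w*`. -/
def conjBraidWstar (P : PoincareDatum) (A C : Fin 2) : Matrix (Fin 2) (Fin 2) ℂ :=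
  Matrix.of fun N U => P.Ltilde (N, A) (C, U)

/-- Since `L = κ(1 + qEE')`, the identity part reduces to the inverse property of `X` and the rank
one part is `X_EE'_X_inv`. This is the mixed Yang–Baxter relation required of the braiding by the
exchange relation of `w` and `w*`. -/
theorem X_L_X_inv (P : PoincareDatum) (A B M K F U : Fin 2) :
    ∑ C, ∑ D, ∑ W, P.lor.X (A, B) (C, D) * (P.L (M, C) (K, W) * P.lor.X⁻¹ (W, D) (F, U)) =
      ∑ C, ∑ D, ∑ W, P.lor.X (C, D) (K, F) * (P.lor.X⁻¹ (M, A) (C, W) * P.L (W, B) (D, U)) := by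
  have h := P.lor.X_EE'_X_inv A B M K F U
  have h1 : ∑ C, ∑ D, ∑ W, P.lor.X (A, B) (C, D) *
      ((if M = K ∧ C = W then 1 else 0) * P.lor.X⁻¹ (W, D) (F, U)) =
      (if M = K then 1 else 0) * ∑ C, ∑ D, P.lor.X (A, B) (C, D) * P.lor.X⁻¹ (C, D) (F, U) := by
    simp only [ite_and, ite_mul, one_mul, zero_mul, mul_ite, mul_zero]
    split_ifs <;> simp
  have h2 : ∑ C, ∑ D, ∑ W, P.lor.X (C, D) (K, F) *
      (P.lor.X⁻¹ (M, A) (C, W) * (if W = D ∧ B = U then 1 else 0)) =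
      (if B = U then 1 else 0) * ∑ C, ∑ D, P.lor.X⁻¹ (M, A) (C, D) * P.lor.X (C, D) (K, F) := by
    simp only [and_comm, ite_and, ite_mul, one_mul, zero_mul, mul_ite, mul_zero, mul_one]
    split_ifs <;> simp [mul_comm]
  rw [LorentzType.X_mul_inv_apply] at h1
  rw [LorentzType.X_inv_mul_apply] at h2
  have h3 : ((if M = K then 1 else 0) * if A = F ∧ B = U then 1 else 0 : ℂ) =
      (if B = U then 1 else 0) * if M = K ∧ A = F then 1 else 0 := by
    split_ifs <;> simp_all
  rw [h3, ← h2] at h1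
  simp only [L_apply]
  calc _ = P.kappa * (∑ C, ∑ D, ∑ W, P.lor.X (A, B) (C, D) *
      ((if M = K ∧ C = W then 1 else 0) * P.lor.X⁻¹ (W, D) (F, U)) + P.lor.q *
      ∑ C, ∑ D, ∑ W, P.lor.X (A, B) (C, D) *
        ((P.lor.E M C * P.lor.E' K W) * P.lor.X⁻¹ (W, D) (F, U))) := by
        simp only [Finset.mul_sum, ← Finset.sum_add_distrib]
        refine Finset.sum_congr rfl fun _ _ => Finset.sum_congr rfl fun _ _ =>
          Finset.sum_congr rfl fun _ _ => ?_
        ring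
    _ = _ := by
        rw [h1, h]
        simp only [Finset.mul_sum, ← Finset.sum_add_distrib]
        refine Finset.sum_congr rfl fun _ _ => Finset.sum_congr rfl fun _ _ =>
          Finset.sum_congr rfl fun _ _ => ?_
        ring

theorem X_X_Ltilde (P : PoincareDatum) (A B M K F U : Fin 2) :
    ∑ C, ∑ D, ∑ W, P.lor.X (A, B) (C, D) * (P.lor.X (M, C) (K, W) * P.Ltilde (W, D) (F, U)) =
      ∑ C, ∑ D, ∑ W, P.lor.X (C, D) (K, F) * (P.Ltilde (M, A) (C, W) * P.lor.X (W, B) (D, U)) := by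
  have h := P.lor.X_X_EE' A B M K F U
  have h1 : ∑ C, ∑ D, ∑ W, P.lor.X (A, B) (C, D) *
      (P.lor.X (M, C) (K, W) * (if D = U ∧ W = F then 1 else 0)) =
      ∑ C, P.lor.X (A, B) (C, U) * P.lor.X (M, C) (K, F) := by
    simp [ite_and, -Fin.sum_univ_two]
  have h2 : ∑ C, ∑ D, ∑ W, P.lor.X (C, D) (K, F) *
      ((if A = W ∧ M = C then 1 else 0) * P.lor.X (W, B) (D, U)) =
      ∑ C, P.lor.X (A, B) (C, U) * P.lor.X (M, C) (K, F) := by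
    simp [ite_and, -Fin.sum_univ_two, mul_comm]
  rw [← h2] at h1
  simp only [Ltilde_apply, L_apply]
  calc _ = P.lor.q * P.kappa * (∑ C, ∑ D, ∑ W, P.lor.X (A, B) (C, D) *
      (P.lor.X (M, C) (K, W) * (if D = U ∧ W = F then 1 else 0)) + P.lor.q *
      ∑ C, ∑ D, ∑ W, P.lor.X (A, B) (C, D) *
        (P.lor.X (M, C) (K, W) * (P.lor.E D W * P.lor.E' U F))) := by
        simp only [Finset.mul_sum, ← Finset.sum_add_distrib]
        refine Finset.sum_congr rfl fun _ _ => Finset.sum_congr rfl fun _ _ =>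
          Finset.sum_congr rfl fun _ _ => ?_
        ring
    _ = _ := by
        rw [h1, h]
        simp only [Finset.mul_sum, ← Finset.sum_add_distrib]
        refine Finset.sum_congr rfl fun _ _ => Finset.sum_congr rfl fun _ _ =>
          Finset.sum_congr rfl fun _ _ => ?_
        ring

theorem lorentzRep_braid (P : PoincareDatum) : LorentzRep P.lor P.braidW P.braidWstar where
  E A C := by
    ext M U
    simpa only [Matrix.sum_apply, Matrix.smul_apply, Matrix.mul_apply, braidW, Matrix.of_apply,
      smul_eq_mul, Finset.mul_sum, Matrix.algebraMap_matrix_apply, Algebra.algebraMap_self,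
      RingHom.id_apply] using P.L_E M A C U
  E' B D := by
    ext M U
    simpa only [Matrix.sum_apply, Matrix.smul_apply, Matrix.mul_apply, braidW, Matrix.of_apply,
      smul_eq_mul, Finset.mul_sum, Matrix.algebraMap_matrix_apply, Algebra.algebraMap_self,
      RingHom.id_apply] using P.L_E' M B D U
  conjE A C := by
    ext M U
    simpa only [Matrix.sum_apply, Matrix.smul_apply, Matrix.mul_apply, braidWstar, Matrix.of_apply,
      smul_eq_mul, Finset.mul_sum, Matrix.algebraMap_matrix_apply, Algebra.algebraMap_self,
      RingHom.id_apply] using P.lor.X_inv_X_inv_E M A C U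
  conjE' B D := by
    ext M U
    simpa only [Matrix.sum_apply, Matrix.smul_apply, Matrix.mul_apply, braidWstar, Matrix.of_apply,
      smul_eq_mul, Finset.mul_sum, Matrix.algebraMap_matrix_apply, Algebra.algebraMap_self,
      RingHom.id_apply] using P.lor.X_inv_X_inv_E' M B D U
  X A B K F := by
    ext M U
    simpa only [Matrix.sum_apply, Matrix.smul_apply, Matrix.mul_apply, braidW, braidWstar,
      Matrix.of_apply, smul_eq_mul, Finset.mul_sum] using P.X_L_X_inv A B M K F U

theorem lorentzRep_conjBraid (P : PoincareDatum) :
    LorentzRep P.lor P.conjBraidW P.conjBraidWstar where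
  E A C := by
    ext M U
    simpa only [Matrix.sum_apply, Matrix.smul_apply, Matrix.mul_apply, conjBraidW, Matrix.of_apply,
      smul_eq_mul, Finset.mul_sum, Matrix.algebraMap_matrix_apply, Algebra.algebraMap_self,
      RingHom.id_apply] using P.lor.X_X_E M A C U
  E' B D := by
    ext M U
    simpa only [Matrix.sum_apply, Matrix.smul_apply, Matrix.mul_apply, conjBraidW, Matrix.of_apply,
      smul_eq_mul, Finset.mul_sum, Matrix.algebraMap_matrix_apply, Algebra.algebraMap_self,
      RingHom.id_apply] using P.lor.X_X_E' M B D U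
  conjE A C := by
    ext M U
    simpa only [Matrix.sum_apply, Matrix.smul_apply, Matrix.mul_apply, conjBraidWstar,
      Matrix.of_apply, smul_eq_mul, Finset.mul_sum, Matrix.algebraMap_matrix_apply,
      Algebra.algebraMap_self, RingHom.id_apply] using P.Ltilde_E M A C U
  conjE' B D := by
    ext M U
    simpa only [Matrix.sum_apply, Matrix.smul_apply, Matrix.mul_apply, conjBraidWstar,
      Matrix.of_apply, smul_eq_mul, Finset.mul_sum, Matrix.algebraMap_matrix_apply,
      Algebra.algebraMap_self, RingHom.id_apply] using P.Ltilde_E' M B D U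
  X A B K F := by
    ext M U
    simpa only [Matrix.sum_apply, Matrix.smul_apply, Matrix.mul_apply, conjBraidW, conjBraidWstar,
      Matrix.of_apply, smul_eq_mul, Finset.mul_sum] using P.X_X_Ltilde A B M K F U

end PoincareDatum

theorem V_mul_Vinv : V * Vinv = 1 := by
  ext ⟨A, B⟩ ⟨C, D⟩
  fin_cases A <;> fin_cases B <;> fin_cases C <;> fin_cases D <;>
    simp [V, Vinv, pauli, Matrix.mul_apply, Fin.sum_univ_four, Matrix.one_apply] <;> ring_nf <;>
    simp <;> norm_num

theorem Vinv_mul_V : Vinv * V = 1 := by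
  ext i j
  fin_cases i <;> fin_cases j <;>
    simp [V, Vinv, pauli, Matrix.mul_apply, Fintype.sum_prod_type, Matrix.one_apply] <;> ring_nf <;>
    simp <;> norm_num

theorem conj_pauli : ∀ i A B, starRingEnd ℂ (pauli i A B) = pauli i B A := by
  intro i
  fin_cases i <;> simp [pauli, Fin.forall_fin_two]

theorem conj_V (A B : Fin 2) (i : Fin 4) : starRingEnd ℂ (V (A, B) i) = V (B, A) i :=
  conj_pauli i A B

theorem conj_Vinv (A B : Fin 2) (i : Fin 4) : starRingEnd ℂ (Vinv i (A, B)) = Vinv i (B, A) := by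
  simp [Vinv, conj_pauli, Complex.conj_ofNat]

/-- The passage from the spinor basis of `ℂ² ⊗ ℂ²` to the basis of Pauli matrices. -/
def vectorBasis : Matrix (Fin 2 × Fin 2) (Fin 2 × Fin 2) ℂ →ₐ[ℂ] Matrix (Fin 4) (Fin 4) ℂ where
  toFun m := Vinv * m * V
  map_one' := by rw [Matrix.mul_one, Vinv_mul_V]
  map_mul' m n := by
    have h : Vinv * m * V * (Vinv * n * V) = Vinv * m * ((V * Vinv) * (n * V)) := by
      simp only [Matrix.mul_assoc]
    rw [h, V_mul_Vinv, Matrix.one_mul]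
    simp only [Matrix.mul_assoc]
  map_zero' := by simp
  map_add' m n := by rw [Matrix.mul_add, Matrix.add_mul]
  commutes' r := by
    simp only [Algebra.algebraMap_eq_smul_one, Matrix.mul_smul, Matrix.smul_mul, Matrix.mul_one,
      Vinv_mul_V]

/-- The first factor of `M₂(ℂ) ⊗ M₂(ℂ)`. -/
def kroneckerLeft : Matrix (Fin 2) (Fin 2) ℂ →ₐ[ℂ] Matrix (Fin 2 × Fin 2) (Fin 2 × Fin 2) ℂ where
  toFun m := m ⊗ₖ 1
  map_one' := Matrix.one_kronecker_one
  map_mul' m n := by rw [← Matrix.mul_kronecker_mul, Matrix.mul_one]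
  map_zero' := Matrix.zero_kronecker _
  map_add' m n := Matrix.add_kronecker _ _ _
  commutes' r := by
    simp only [Algebra.algebraMap_eq_smul_one, Matrix.smul_kronecker, Matrix.one_kronecker_one]

/-- The second factor of `M₂(ℂ) ⊗ M₂(ℂ)`. -/
def kroneckerRight : Matrix (Fin 2) (Fin 2) ℂ →ₐ[ℂ] Matrix (Fin 2 × Fin 2) (Fin 2 × Fin 2) ℂ where
  toFun m := 1 ⊗ₖ m
  map_one' := Matrix.one_kronecker_one
  map_mul' m n := by rw [← Matrix.mul_kronecker_mul, Matrix.mul_one]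
  map_zero' := Matrix.kronecker_zero _
  map_add' m n := Matrix.kronecker_add _ _ _
  commutes' r := by
    simp only [Algebra.algebraMap_eq_smul_one, Matrix.kronecker_smul, Matrix.one_kronecker_one]

theorem kroneckerLeft_mul_kroneckerRight (m n : Matrix (Fin 2) (Fin 2) ℂ) :
    kroneckerLeft m * kroneckerRight n = kroneckerRight n * kroneckerLeft m := by
  change (m ⊗ₖ 1) * (1 ⊗ₖ n) = (1 ⊗ₖ n) * (m ⊗ₖ 1)
  rw [← Matrix.mul_kronecker_mul, ← Matrix.mul_kronecker_mul]
  simp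

namespace PoincareDatum

/-- The representation on vectors in the spinor basis: action of `w`. -/
def spinW (P : PoincareDatum) (A C : Fin 2) : Matrix (Fin 2 × Fin 2) (Fin 2 × Fin 2) ℂ :=
  ∑ S, kroneckerRight (P.conjBraidW A S) * kroneckerLeft (P.braidW S C)

/-- The representation on vectors in the spinor basis: action of `w*`. -/
def spinWstar (P : PoincareDatum) (A C : Fin 2) : Matrix (Fin 2 × Fin 2) (Fin 2 × Fin 2) ℂ :=
  ∑ S, kroneckerRight (P.conjBraidWstar A S) * kroneckerLeft (P.braidWstar S C)

theorem spinW_apply (P : PoincareDatum) (A C M N W U : Fin 2) :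
    P.spinW A C (M, N) (W, U) = ∑ S, P.lor.X (N, A) (S, U) * P.L (M, S) (C, W) := by
  rw [spinW, Matrix.sum_apply]
  refine Finset.sum_congr rfl fun S _ => ?_
  change (((1 : Matrix (Fin 2) (Fin 2) ℂ) ⊗ₖ P.conjBraidW A S) *
    (P.braidW S C ⊗ₖ (1 : Matrix (Fin 2) (Fin 2) ℂ))) (M, N) (W, U) = _
  rw [← Matrix.mul_kronecker_mul, Matrix.one_mul, Matrix.mul_one, Matrix.kronecker_apply, mul_comm]
  rfl

theorem spinWstar_apply (P : PoincareDatum) (A C M N W U : Fin 2) :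
    P.spinWstar A C (M, N) (W, U) = ∑ S, P.Ltilde (N, A) (S, U) * P.lor.X⁻¹ (M, S) (C, W) := by
  rw [spinWstar, Matrix.sum_apply]
  refine Finset.sum_congr rfl fun S _ => ?_
  change (((1 : Matrix (Fin 2) (Fin 2) ℂ) ⊗ₖ P.conjBraidWstar A S) *
    (P.braidWstar S C ⊗ₖ (1 : Matrix (Fin 2) (Fin 2) ℂ))) (M, N) (W, U) = _
  rw [← Matrix.mul_kronecker_mul, Matrix.one_mul, Matrix.mul_one, Matrix.kronecker_apply, mul_comm]
  rfl

/-- The factors act on different tensor legs, so they commute. The conjugate braiding stands first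
in the convolution to match the order of `X` and `L` in `G`; after the passage to the Pauli basis
the matrices of `w` are exactly the entries of `G`. -/
theorem lorentzRep_spin (P : PoincareDatum) : LorentzRep P.lor P.spinW P.spinWstar :=
  (P.lorentzRep_conjBraid.map kroneckerRight).mul (P.lorentzRep_braid.map kroneckerLeft)
    (fun _ _ _ _ => kroneckerLeft_mul_kroneckerRight _ _)
    (fun _ _ _ _ => kroneckerLeft_mul_kroneckerRight _ _)
    (fun _ _ _ _ => kroneckerLeft_mul_kroneckerRight _ _)
    (fun _ _ _ _ => kroneckerLeft_mul_kroneckerRight _ _)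

/-- The representation on vectors: action of `w`. -/
def vecW (P : PoincareDatum) (A C : Fin 2) : Matrix (Fin 4) (Fin 4) ℂ := vectorBasis (P.spinW A C)

/-- The representation on vectors: action of `w*`. -/
def vecWstar (P : PoincareDatum) (A C : Fin 2) : Matrix (Fin 4) (Fin 4) ℂ :=
  vectorBasis (P.spinWstar A C)

theorem lorentzRep_vec (P : PoincareDatum) : LorentzRep P.lor P.vecW P.vecWstar :=
  P.lorentzRep_spin.map vectorBasis

theorem vecW_apply (P : PoincareDatum) (A C : Fin 2) (i j : Fin 4) :
    P.vecW A C i j = P.G (i, A) (C, j) := by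
  change (Vinv * P.spinW A C * V) i j = _
  simp only [G, Matrix.mul_apply, Fintype.sum_prod_type, spinW_apply, Matrix.of_apply]
  simp only [Fin.sum_univ_two]
  ring

/-- Conjugating `L` and `X`, unfolding `L̃` and using `L² = q` each contribute a factor `q`; the
product of the four is `1`, and `X X⁻¹ = 1` does the rest. The swapped pair `(U, W)` reflects that
conjugation exchanges dotted and undotted indices. -/
theorem conj_spinW_mul (P : PoincareDatum) (A B M N R Q : Fin 2) :
    ∑ C, ∑ W, ∑ U, starRingEnd ℂ (P.spinW A C (M, N) (W, U)) * P.spinWstar C B (U, W) (R, Q) =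
      if A = B ∧ N = R ∧ M = Q then 1 else 0 := by
  have hL : ∀ S T, ∑ C, ∑ W, P.L (M, S) (C, W) * P.L (C, W) (Q, T) =
      P.lor.q * if M = Q ∧ S = T then 1 else 0 := fun S T => P.L_mul_L M S Q T
  have hX := P.lor.X_mul_inv_apply A N B R
  simp only [spinW_apply, spinWstar_apply, Ltilde_apply, map_sum, map_mul, conj_L,
    LorentzType.conj_X]
  calc _ = P.lor.q * (P.lor.q * P.lor.q) * ∑ U, ∑ S, P.lor.X (A, N) (U, S) *
        ∑ T, P.lor.X⁻¹ (U, T) (B, R) * ∑ C, ∑ W, P.L (M, S) (C, W) * P.L (C, W) (Q, T) := by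
        simp only [Fin.sum_univ_two]; ring
    _ = if M = Q then P.lor.q * P.lor.q * ∑ U, ∑ S, P.lor.X (A, N) (U, S) * P.lor.X⁻¹ (U, S) (B, R)
        else 0 := by
        simp only [hL, P.lor.q_mul_q, ite_and]
        split_ifs with h
        · simp only [mul_ite, mul_one, mul_zero, Finset.sum_ite_eq, Finset.mem_univ, if_true]
          simp only [← mul_assoc, ← Finset.sum_mul]
          rw [mul_comm, ← mul_assoc, ← P.lor.q_mul_q]
        · simp
    _ = _ := by
        rw [hX, P.lor.q_mul_q]
        split_ifs <;> simp_all

end PoincareDatum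

/-! ### Intertwining matrices and the transport of defects. -/

section

section Intertwining

variable {F n : Type} [Ring F] [Algebra ℂ F] [Fintype n] [DecidableEq n]

/-- Constant matrices. -/
def constMat (F : Type) {n : Type} [Ring F] [Algebra ℂ F] [Fintype n] [DecidableEq n] :
    Matrix n n ℂ →ₐ[ℂ] Matrix n n F :=
  (Algebra.ofId ℂ F).mapMatrix

theorem constMat_apply (m : Matrix n n ℂ) (i j : n) :
    constMat F m i j = algebraMap ℂ F (m i j) := rfl

theorem scalar_mul_constMat (x : F) (m : Matrix n n ℂ) :
    Matrix.scalar n x * constMat F m = constMat F m * Matrix.scalar n x := by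
  ext i j
  simp [constMat_apply, Algebra.commutes, Matrix.scalar_apply]

/-- The square matrix `U` over `F` intertwines `(id ⊗ ρ) Δ` and `(ρ ⊗ id) Δ` on the entries of the
`2 × 2` corepresentation `u`. -/
def Intertwines (U : Matrix n n F) (u : Fin 2 → Fin 2 → F) (ρ : Fin 2 → Fin 2 → Matrix n n ℂ) :
    Prop :=
  ∀ A B, U * ∑ C, Matrix.scalar n (u A C) * constMat F (ρ C B) =
    (∑ C, constMat F (ρ A C) * Matrix.scalar n (u C B)) * U

theorem intertwines_iff {U : Matrix n n F} {u : Fin 2 → Fin 2 → F}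
    {ρ : Fin 2 → Fin 2 → Matrix n n ℂ} : Intertwines U u ρ ↔
      ∀ A B i k, ∑ C, ∑ j, ρ C B j k • (U i j * u A C) = ∑ C, ∑ j, ρ A C i j • (u C B * U j k) := by
  have h1 : ∀ A B i k, (U * ∑ C, Matrix.scalar n (u A C) * constMat F (ρ C B)) i k =
      ∑ C, ∑ j, ρ C B j k • (U i j * u A C) := by
    intro A B i k
    rw [Matrix.mul_sum, Matrix.sum_apply]
    refine Finset.sum_congr rfl fun C _ => ?_
    rw [Matrix.mul_apply]
    refine Finset.sum_congr rfl fun j _ => ?_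
    simp [constMat_apply, Matrix.scalar_apply, Algebra.smul_def, Algebra.commutes, mul_assoc]
  have h2 : ∀ A B i k, ((∑ C, constMat F (ρ A C) * Matrix.scalar n (u C B)) * U) i k =
      ∑ C, ∑ j, ρ A C i j • (u C B * U j k) := by
    intro A B i k
    rw [Matrix.sum_mul, Matrix.sum_apply]
    refine Finset.sum_congr rfl fun C _ => ?_
    rw [Matrix.mul_apply]
    refine Finset.sum_congr rfl fun j _ => ?_
    simp [constMat_apply, Matrix.scalar_apply, Algebra.smul_def, mul_assoc]
  constructor
  · intro h A B i k
    rw [← h1, ← h2, h A B]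
  · intro h A B
    ext i k
    rw [h1, h2, h]

theorem Intertwines.word {U : Matrix n n F} {u v : Fin 2 → Fin 2 → F}
    {ρ τ : Fin 2 → Fin 2 → Matrix n n ℂ} (h : Intertwines U u ρ) (h' : Intertwines U v τ)
    (A B C D : Fin 2) :
    U * ∑ K, ∑ M, Matrix.scalar n (u A K * v C M) * constMat F (ρ K B * τ M D) =
      (∑ K, ∑ M, constMat F (ρ A K * τ C M) * Matrix.scalar n (u K B * v M D)) * U := by
  calc _ = (U * ∑ K, Matrix.scalar n (u A K) * constMat F (ρ K B)) *
        ∑ M, Matrix.scalar n (v C M) * constMat F (τ M D) := by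
        rw [mul_assoc]
        congr 1
        rw [Finset.sum_mul_sum]
        refine Finset.sum_congr rfl fun K _ => Finset.sum_congr rfl fun M _ => ?_
        rw [map_mul, map_mul, mul_assoc, ← mul_assoc (Matrix.scalar n (v C M)), scalar_mul_constMat]
        simp only [mul_assoc]
    _ = _ := by
        rw [h, mul_assoc, h', ← mul_assoc]
        congr 1
        rw [Finset.sum_mul_sum]
        refine Finset.sum_congr rfl fun K _ => Finset.sum_congr rfl fun M _ => ?_
        rw [map_mul, map_mul, mul_assoc, mul_assoc, ← mul_assoc _ (constMat F _),
          scalar_mul_constMat]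
        simp only [mul_assoc]

/-- `ρ` and `τ` are not assumed to satisfy any relation. If `e` is fixed by `u ⊗ v`, the failure of
`ρ`, `τ` to fix `e` is itself intertwined by `U`. This, with `covector` and `exchange`, is what
later forces the failure to vanish. -/
theorem Intertwines.vector {U : Matrix n n F} {u v : Fin 2 → Fin 2 → F}
    {ρ τ : Fin 2 → Fin 2 → Matrix n n ℂ} (h : Intertwines U u ρ) (h' : Intertwines U v τ)
    {e : Fin 2 → Fin 2 → ℂ}
    (he : ∀ A C, ∑ B, ∑ D, e B D • (u A B * v C D) = algebraMap ℂ F (e A C)) (A C : Fin 2) :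
    U * ∑ K, ∑ M, Matrix.scalar n (u A K * v C M) *
      constMat F (∑ B, ∑ D, e B D • (ρ K B * τ M D) - algebraMap ℂ _ (e K M)) =
    constMat F (∑ B, ∑ D, e B D • (ρ A B * τ C D) - algebraMap ℂ _ (e A C)) * U := by
  have hs : ∀ A C, ∑ B, ∑ D, e B D • Matrix.scalar n (u A B * v C D) =
      algebraMap ℂ (Matrix n n F) (e A C) := by
    intro A C
    ext i j
    have := he A C
    by_cases hij : i = j <;>
      simp [Matrix.sum_apply, Matrix.scalar_apply, hij, this, Matrix.algebraMap_matrix_apply,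
        -Fin.sum_univ_two]
  calc _ = ∑ B, ∑ D, e B D • (U * ∑ K, ∑ M, Matrix.scalar n (u A K * v C M) *
        constMat F (ρ K B * τ M D)) - U * ∑ K, ∑ M, e K M • Matrix.scalar n (u A K * v C M) := by
        simp only [map_sub, map_add, map_smul, map_one, one_mul, mul_one, Fin.sum_univ_two, mul_add, mul_sub,
          smul_add, Algebra.algebraMap_eq_smul_one, mul_smul_comm]
        abel
    _ = ∑ K, ∑ M, constMat F (ρ A K * τ C M) * (∑ B, ∑ D, e B D •
          Matrix.scalar n (u K B * v M D)) * U - algebraMap ℂ _ (e A C) * U := by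
        rw [hs, ← Algebra.commutes (e A C) U]
        simp only [h.word h']
        simp only [Fin.sum_univ_two, mul_add, add_mul, smul_add, mul_smul_comm, smul_mul_assoc]
        abel
    _ = _ := by
        simp only [hs]
        simp only [map_sub, map_add, map_smul, map_one, one_mul, mul_one, Fin.sum_univ_two, add_mul, sub_mul,
          Algebra.algebraMap_eq_smul_one, mul_smul_comm, smul_mul_assoc]

theorem Intertwines.covector {U : Matrix n n F} {u v : Fin 2 → Fin 2 → F}
    {ρ τ : Fin 2 → Fin 2 → Matrix n n ℂ} (h : Intertwines U u ρ) (h' : Intertwines U v τ)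
    {e : Fin 2 → Fin 2 → ℂ}
    (he : ∀ B D, ∑ A, ∑ C, e A C • (u A B * v C D) = algebraMap ℂ F (e B D)) (B D : Fin 2) :
    U * constMat F (∑ A, ∑ C, e A C • (ρ A B * τ C D) - algebraMap ℂ _ (e B D)) =
    (∑ K, ∑ M, constMat F (∑ A, ∑ C, e A C • (ρ A K * τ C M) - algebraMap ℂ _ (e K M)) *
      Matrix.scalar n (u K B * v M D)) * U := by
  have hs : ∀ B D, ∑ A, ∑ C, e A C • Matrix.scalar n (u A B * v C D) =
      algebraMap ℂ (Matrix n n F) (e B D) := by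
    intro A C
    ext i j
    have := he A C
    by_cases hij : i = j <;>
      simp [Matrix.sum_apply, Matrix.scalar_apply, hij, this, Matrix.algebraMap_matrix_apply,
        -Fin.sum_univ_two]
  symm
  calc _ = ∑ A, ∑ C, e A C • ((∑ K, ∑ M, constMat F (ρ A K * τ C M) *
        Matrix.scalar n (u K B * v M D)) * U) - (∑ K, ∑ M, e K M •
          Matrix.scalar n (u K B * v M D)) * U := by
        simp only [map_sub, map_add, map_smul, map_one, one_mul, mul_one, Fin.sum_univ_two, add_mul, sub_mul,
          smul_add, Algebra.algebraMap_eq_smul_one, smul_mul_assoc]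
        abel
    _ = ∑ K, ∑ M, U * ((∑ A, ∑ C, e A C • Matrix.scalar n (u A K * v C M)) *
          constMat F (ρ K B * τ M D)) - U * algebraMap ℂ _ (e B D) := by
        rw [hs, ← Algebra.commutes (e B D) U]
        simp only [← h.word h']
        simp only [Fin.sum_univ_two, mul_add, add_mul, smul_add, mul_smul_comm, smul_mul_assoc]
        abel
    _ = _ := by
        simp only [hs]
        simp only [map_sub, map_add, map_smul, map_one, one_mul, mul_one, Fin.sum_univ_two, mul_add, mul_sub,
          Algebra.algebraMap_eq_smul_one, mul_smul_comm, smul_mul_assoc]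

theorem Intertwines.exchange {U : Matrix n n F} {u v : Fin 2 → Fin 2 → F}
    {ρ τ : Fin 2 → Fin 2 → Matrix n n ℂ} (h : Intertwines U u ρ) (h' : Intertwines U v τ)
    {x : Fin 2 → Fin 2 → Fin 2 → Fin 2 → ℂ}
    (hx : ∀ A B K L, ∑ C, ∑ D, x A B C D • (u C K * v D L) =
      ∑ C, ∑ D, x C D K L • (v A C * u B D)) (A B K L : Fin 2) :
    U * ∑ C, ∑ D, Matrix.scalar n (v A C * u B D) *
      constMat F (∑ S, ∑ T, x C D S T • (ρ S K * τ T L) - ∑ S, ∑ T, x S T K L • (τ C S * ρ D T)) =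
    (∑ C, ∑ D, constMat F (∑ S, ∑ T, x A B S T • (ρ S C * τ T D) -
      ∑ S, ∑ T, x S T C D • (τ A S * ρ B T)) * Matrix.scalar n (u C K * v D L)) * U := by
  have hs : ∀ A B K L, ∑ C, ∑ D, x A B C D • Matrix.scalar n (u C K * v D L) =
      ∑ C, ∑ D, x C D K L • Matrix.scalar n (v A C * u B D) := by
    intro A B K L
    ext i j
    have := hx A B K L
    by_cases hij : i = j
    · simp only [Matrix.sum_apply, Matrix.smul_apply, Matrix.scalar_apply, hij,
        Matrix.diagonal_apply_eq, this]
    · simp [Matrix.sum_apply, Matrix.scalar_apply, hij]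
  calc _ = ∑ S, ∑ T, U * ((∑ C, ∑ D, x C D S T • Matrix.scalar n (v A C * u B D)) *
        constMat F (ρ S K * τ T L)) - ∑ S, ∑ T, x S T K L • (U * ∑ C, ∑ D,
          Matrix.scalar n (v A C * u B D) * constMat F (τ C S * ρ D T)) := by
        simp only [map_sub, map_add, map_smul, Fin.sum_univ_two, add_mul, mul_add, mul_sub,
          smul_add, smul_mul_assoc, mul_smul_comm]
        abel
    _ = ∑ S, ∑ T, x A B S T • ((∑ C, ∑ D, constMat F (ρ S C * τ T D) *
          Matrix.scalar n (u C K * v D L)) * U) - ∑ S, ∑ T, constMat F (τ A S * ρ B T) *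
          (∑ C, ∑ D, x C D K L • Matrix.scalar n (v S C * u T D)) * U := by
        simp only [← hs, h'.word h, ← h.word h']
        congr 1
        · simp only [Fin.sum_univ_two, add_mul, mul_add, smul_add, smul_mul_assoc, mul_smul_comm]
          abel
        · simp only [hs]
          simp only [Fin.sum_univ_two, add_mul, mul_add, smul_add, smul_mul_assoc,
            mul_smul_comm]
          abel
    _ = _ := by
        simp only [← hs]
        simp only [map_sub, map_add, map_smul, Fin.sum_univ_two, add_mul, mul_add, sub_mul,
          smul_add, smul_mul_assoc, mul_smul_comm]
        abel

end Intertwining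

end

section

variable {F : Type} [Ring F] [Algebra ℂ F]

/-- `L` is a combination of `1` and `EE'`, and `EE'` commutes with `w ⊗ w` because both `E` and `E'`
are invariant. -/
theorem LorentzRep.intertwines_w_w {P : PoincareDatum} {w ws : Fin 2 → Fin 2 → F}
    (h : LorentzRep P.lor w ws) : Intertwines (Matrix.of w) w P.braidW := by
  rw [intertwines_iff]
  intro A B i k
  simp only [PoincareDatum.braidW, Matrix.of_apply, PoincareDatum.L_apply]
  have h1 := h.E i A
  have h2 := h.E' B k
  calc _ = P.kappa • (w i B * w A k + (P.lor.q * P.lor.E' B k) •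
        ∑ C, ∑ D, P.lor.E C D • (w i C * w A D)) := by
        simp only [mul_smul, add_smul, Finset.sum_add_distrib, ite_smul, one_smul, zero_smul,
          smul_add, Finset.smul_sum, ite_and, smul_ite, smul_zero]
        congr 1
        · simp
        · rw [Finset.sum_comm]
          simp only [smul_smul, mul_comm, mul_left_comm]
    _ = P.kappa • (w i B * w A k + (P.lor.q * P.lor.E i A) •
        ∑ C, ∑ D, P.lor.E' C D • (w C B * w D k)) := by
        rw [h1, h2, Algebra.algebraMap_eq_smul_one, Algebra.algebraMap_eq_smul_one, smul_smul,
          smul_smul, mul_right_comm]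
    _ = _ := by
        simp only [mul_smul, add_smul, Finset.sum_add_distrib, ite_smul, one_smul, zero_smul,
          smul_add, Finset.smul_sum, ite_and, smul_ite, smul_zero]
        congr 1
        simp

theorem LorentzRep.intertwines_ws_ws {P : PoincareDatum} {w ws : Fin 2 → Fin 2 → F}
    (h : LorentzRep P.lor w ws) : Intertwines (Matrix.of ws) ws P.conjBraidWstar := by
  rw [intertwines_iff]
  intro A B i k
  simp only [PoincareDatum.conjBraidWstar, Matrix.of_apply, PoincareDatum.Ltilde_apply,
    PoincareDatum.L_apply]
  have h1 := h.conjE A i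
  have h2 := h.conjE' k B
  calc _ = (P.lor.q * P.kappa) • (ws i B * ws A k + (P.lor.q * P.lor.E' k B) •
        ∑ C, ∑ D, P.lor.E C D • (ws i D * ws A C)) := by
        simp only [mul_smul, add_smul, Finset.sum_add_distrib, ite_smul, one_smul, zero_smul,
          smul_add, Finset.smul_sum, ite_and, smul_ite, smul_zero]
        congr 1
        · simp
        · simp only [smul_smul, mul_comm, mul_left_comm]
    _ = (P.lor.q * P.kappa) • (ws i B * ws A k + (P.lor.q * P.lor.E A i) •
        ∑ C, ∑ D, P.lor.E' C D • (ws D B * ws C k)) := by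
        rw [h1, h2, Algebra.algebraMap_eq_smul_one, Algebra.algebraMap_eq_smul_one, smul_smul,
          smul_smul, mul_right_comm]
    _ = _ := by
        simp only [mul_smul, add_smul, Finset.sum_add_distrib, ite_smul, one_smul, zero_smul,
          smul_add, Finset.smul_sum, ite_and, smul_ite, smul_zero]
        congr 1
        · simp
        · rw [Finset.sum_comm]

theorem LorentzRep.intertwines_ws_w {P : PoincareDatum} {w ws : Fin 2 → Fin 2 → F}
    (h : LorentzRep P.lor w ws) : Intertwines (Matrix.of ws) w P.conjBraidW := by
  rw [intertwines_iff]
  intro A B i k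
  simp only [PoincareDatum.conjBraidW, Matrix.of_apply]
  rw [h.X i A B k, Finset.sum_comm]

/-- The exchange relation multiplied by `X⁻¹` from both sides. -/
theorem LorentzRep.intertwines_w_ws {P : PoincareDatum} {w ws : Fin 2 → Fin 2 → F}
    (h : LorentzRep P.lor w ws) : Intertwines (Matrix.of w) ws P.braidWstar := by
  rw [intertwines_iff]
  intro A B i k
  simp only [PoincareDatum.braidWstar, Matrix.of_apply]
  have hX : ∀ S T, ∑ K, ∑ L, (∑ C, ∑ D, P.lor.X (S, T) (C, D) • (w C K * ws D L)) =
    ∑ K, ∑ L, ∑ C, ∑ D, P.lor.X (C, D) (K, L) • (ws S C * w T D) := fun S T => by simp only [h.X]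
  calc _ = ∑ S, ∑ T, ∑ K, ∑ L, P.lor.X⁻¹ (K, L) (B, k) • ((∑ C, ∑ D,
        P.lor.X⁻¹ (i, A) (C, D) * P.lor.X (C, D) (S, T)) • (w S K * ws T L)) := by
        simp only [P.lor.X_inv_mul_apply, ite_and, ite_smul, one_smul, zero_smul]
        simp [-Fin.sum_univ_two]
        rw [Finset.sum_comm]
    _ = ∑ K, ∑ L, P.lor.X⁻¹ (K, L) (B, k) • ∑ S, ∑ T, P.lor.X⁻¹ (i, A) (S, T) •
        ∑ C, ∑ D, P.lor.X (S, T) (C, D) • (w C K * ws D L) := by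
        simp only [Fin.sum_univ_two, smul_add, add_smul, smul_smul, mul_assoc]
        abel
    _ = ∑ S, ∑ T, P.lor.X⁻¹ (i, A) (S, T) • ∑ C, ∑ D, (∑ K, ∑ L,
        P.lor.X (C, D) (K, L) * P.lor.X⁻¹ (K, L) (B, k)) • (ws S C * w T D) := by
        simp only [h.X]
        simp only [Fin.sum_univ_two, smul_add, add_smul, smul_smul, mul_comm, mul_left_comm]
        abel
    _ = _ := by
        simp only [P.lor.X_mul_inv_apply, ite_and, ite_smul, one_smul, zero_smul]
        simp [-Fin.sum_univ_two]

/-- Move `u` first through `ws`, which produces `τ`, and then through `w`, which produces `ρ`; hence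
the order of the factors in the convolution. -/
theorem intertwines_spin {u w ws : Fin 2 → Fin 2 → F}
    {ρ τ : Fin 2 → Fin 2 → Matrix (Fin 2) (Fin 2) ℂ}
    (h : Intertwines (Matrix.of w) u ρ) (h' : Intertwines (Matrix.of ws) u τ) :
    Intertwines (Matrix.of fun p p' : Fin 2 × Fin 2 => w p.1 p'.1 * ws p.2 p'.2) u
      (fun A C => ∑ S, kroneckerRight (τ A S) * kroneckerLeft (ρ S C)) := by
  rw [intertwines_iff] at h h' ⊢
  rintro A B ⟨M, N⟩ ⟨R, Q⟩
  have key : ∀ A C M N W U, (∑ S, kroneckerRight (τ A S) * kroneckerLeft (ρ S C)) (M, N) (W, U) =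
      ∑ S, τ A S N U * ρ S C M W := by
    intro A C M N W U
    rw [Matrix.sum_apply]
    refine Finset.sum_congr rfl fun S _ => ?_
    change (((1 : Matrix (Fin 2) (Fin 2) ℂ) ⊗ₖ τ A S) *
      (ρ S C ⊗ₖ (1 : Matrix (Fin 2) (Fin 2) ℂ))) (M, N) (W, U) = _
    rw [← Matrix.mul_kronecker_mul, Matrix.one_mul, Matrix.mul_one, Matrix.kronecker_apply,
      mul_comm]
  simp only [Fintype.sum_prod_type, key, Matrix.of_apply] at h h' ⊢
  calc _ = ∑ W, ∑ S, ρ S B W R • (w M W * ∑ C, ∑ U, τ C S U Q • (ws N U * u A C)) := by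
        simp only [Fin.sum_univ_two, mul_add, smul_add, add_smul, mul_smul_comm, smul_smul,
          mul_assoc, mul_comm (ρ _ _ _ _)]
        abel
    _ = ∑ C, ∑ U, τ A C N U • ((∑ S, ∑ W, ρ S B W R • (w M W * u C S)) * ws U Q) := by
        simp only [h']
        simp only [Fin.sum_univ_two, mul_add, add_mul, smul_add, add_smul, mul_smul_comm,
          smul_mul_assoc, smul_smul, mul_assoc, mul_comm (ρ _ _ _ _)]
        abel
    _ = _ := by
        simp only [h]
        simp only [Fin.sum_univ_two, add_mul, smul_add, add_smul,
          smul_mul_assoc, smul_smul, mul_assoc]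
        abel

theorem intertwines_vectorBasis {u w ws : Fin 2 → Fin 2 → F}
    {ρ : Fin 2 → Fin 2 → Matrix (Fin 2 × Fin 2) (Fin 2 × Fin 2) ℂ}
    (h : Intertwines (Matrix.of fun p p' : Fin 2 × Fin 2 => w p.1 p'.1 * ws p.2 p'.2) u ρ) :
    Intertwines (Matrix.of (lambda w ws)) u (fun A B => vectorBasis (ρ A B)) := by
  set U := Matrix.of fun p p' : Fin 2 × Fin 2 => w p.1 p'.1 * ws p.2 p'.2 with hU
  set V' : Matrix (Fin 2 × Fin 2) (Fin 4) F := V.map (algebraMap ℂ F) with hV'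
  set W' : Matrix (Fin 4) (Fin 2 × Fin 2) F := Vinv.map (algebraMap ℂ F) with hW'
  have hVW : V' * W' = 1 := by
    rw [hV', hW', ← Matrix.map_mul, V_mul_Vinv, Matrix.map_one _ (map_zero _) (map_one _)]
  have hlam : Matrix.of (lambda w ws) = W' * U * V' := by
    ext i j
    simp only [lambda, Matrix.mul_apply, Matrix.of_apply, Fintype.sum_prod_type, hV', hW',
      Matrix.map_apply, hU, Algebra.smul_def, map_mul]
    simp only [Fin.sum_univ_two, mul_add, add_mul, mul_assoc,
      ← Algebra.commutes (R := ℂ) (A := F) (V _ _)]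
    simp only [← mul_assoc, ← Algebra.commutes (R := ℂ) (A := F) (V _ _)]
    simp only [mul_assoc]
    abel
  have hc : ∀ m, constMat F (vectorBasis m) = W' * constMat F m * V' := by
    intro m
    change (Vinv * m * V).map (algebraMap ℂ F) = _
    rw [Matrix.map_mul, Matrix.map_mul]
    rfl
  have hsV : ∀ x, V' * (Matrix.scalar (Fin 4) x : Matrix (Fin 4) (Fin 4) F) =
      (Matrix.scalar (Fin 2 × Fin 2) x : Matrix (Fin 2 × Fin 2) (Fin 2 × Fin 2) F) * V' := by
    intro x
    ext i j
    simp [hV', Matrix.scalar_apply, Algebra.commutes]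
  have hsW : ∀ x, (Matrix.scalar (Fin 4) x : Matrix (Fin 4) (Fin 4) F) * W' =
      W' * (Matrix.scalar (Fin 2 × Fin 2) x : Matrix (Fin 2 × Fin 2) (Fin 2 × Fin 2) F) := by
    intro x
    ext i j
    simp [hW', Matrix.scalar_apply, Algebra.commutes]
  intro A B
  have h1 : ∑ C, Matrix.scalar (Fin 4) (u A C) * constMat F (vectorBasis (ρ C B)) =
      W' * (∑ C, Matrix.scalar (Fin 2 × Fin 2) (u A C) * constMat F (ρ C B)) * V' := by
    simp only [Matrix.mul_sum, Matrix.sum_mul, hc]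
    refine Finset.sum_congr rfl fun C _ => ?_
    rw [← Matrix.mul_assoc, ← Matrix.mul_assoc, hsW]
    simp only [Matrix.mul_assoc]
  have h2 : ∑ C, constMat F (vectorBasis (ρ A C)) * Matrix.scalar (Fin 4) (u C B) =
      W' * (∑ C, constMat F (ρ A C) * Matrix.scalar (Fin 2 × Fin 2) (u C B)) * V' := by
    simp only [Matrix.mul_sum, Matrix.sum_mul, hc]
    refine Finset.sum_congr rfl fun C _ => ?_
    rw [Matrix.mul_assoc, hsV]
    simp only [Matrix.mul_assoc]
  rw [h1, h2, hlam]
  have hVW' : ∀ (m : Matrix (Fin 2 × Fin 2) (Fin 4) F), V' * (W' * m) = m := by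
    intro m
    rw [← Matrix.mul_assoc, hVW, Matrix.one_mul]
  simp only [Matrix.mul_assoc, hVW']
  rw [← Matrix.mul_assoc U, h, Matrix.mul_assoc]

theorem LorentzRep.intertwines_lambda_w {P : PoincareDatum} {w ws : Fin 2 → Fin 2 → F}
    (h : LorentzRep P.lor w ws) : Intertwines (Matrix.of (lambda w ws)) w P.vecW :=
  intertwines_vectorBasis (intertwines_spin h.intertwines_w_w h.intertwines_ws_w)

theorem LorentzRep.intertwines_lambda_ws {P : PoincareDatum} {w ws : Fin 2 → Fin 2 → F}
    (h : LorentzRep P.lor w ws) : Intertwines (Matrix.of (lambda w ws)) ws P.vecWstar :=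
  intertwines_vectorBasis (intertwines_spin h.intertwines_w_ws h.intertwines_ws_ws)

end

/-! ### Translations against `w*`, and the affine extension by `H`. -/

namespace PoincareDatum

theorem conj_vecW_mul (P : PoincareDatum) (A B : Fin 2) (i k : Fin 4) :
    ∑ C, ∑ j, starRingEnd ℂ (P.vecW A C i j) * P.vecWstar C B j k =
      if A = B ∧ i = k then 1 else 0 := by
  have h1 : ∀ C, (P.vecW A C).map (starRingEnd ℂ) =
      Vinv * ((P.spinW A C).map (starRingEnd ℂ)).submatrix Prod.swap Prod.swap * V := by
    intro C
    ext i j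
    change starRingEnd ℂ ((Vinv * P.spinW A C * V) i j) = _
    simp only [Matrix.mul_apply, Fintype.sum_prod_type, map_sum, map_mul, conj_V, conj_Vinv,
      Matrix.submatrix_apply, Matrix.map_apply, Prod.swap_prod_mk]
    simp only [Fin.sum_univ_two]
    ring
  have h2 : ∑ C, ((P.spinW A C).map (starRingEnd ℂ)).submatrix Prod.swap Prod.swap *
      P.spinWstar C B = if A = B then 1 else 0 := by
    ext ⟨M, N⟩ ⟨R, Q⟩
    have := P.conj_spinW_mul A B N M R Q
    simp only [Matrix.sum_apply, Matrix.mul_apply, Fintype.sum_prod_type, Matrix.submatrix_apply,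
      Matrix.map_apply, Prod.swap_prod_mk]
    have h3 : (if A = B then 1 else 0 : Matrix (Fin 2 × Fin 2) (Fin 2 × Fin 2) ℂ) (M, N) (R, Q) =
      if A = B ∧ M = R ∧ N = Q then 1 else 0 := by
      split_ifs <;> simp_all [Matrix.one_apply]
    rw [h3, ← this]
    exact Finset.sum_congr rfl fun C _ => Finset.sum_comm
  have h3 : ∑ C, (P.vecW A C).map (starRingEnd ℂ) * P.vecWstar C B = if A = B then 1 else 0 := by
    have h4 : ∀ C, (P.vecW A C).map (starRingEnd ℂ) * P.vecWstar C B = vectorBasis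
        (((P.spinW A C).map (starRingEnd ℂ)).submatrix Prod.swap Prod.swap * P.spinWstar C B) := by
      intro C
      rw [map_mul, h1]
      rfl
    simp only [h4]
    rw [← map_sum, h2]
    split_ifs <;> simp
  have := congrFun (congrFun h3 i) k
  rw [Matrix.sum_apply] at this
  simp only [Matrix.mul_apply, Matrix.map_apply] at this
  rw [this]
  split_ifs <;> simp_all [Matrix.one_apply]

/-- The opposite-sided version of `conj_vecW_mul`, read as an identity of square matrices of size
`8`. -/
theorem vecWstar_mul_conj (P : PoincareDatum) (D C : Fin 2) (k j : Fin 4) :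
    ∑ i, ∑ A, P.vecWstar D A k i * starRingEnd ℂ (P.vecW A C i j) =
      if D = C ∧ k = j then 1 else 0 := by
  have h : (Matrix.of fun p p' : Fin 4 × Fin 2 => starRingEnd ℂ (P.vecW p.2 p'.2 p.1 p'.1)) *
      (Matrix.of fun p p' : Fin 4 × Fin 2 => P.vecWstar p.2 p'.2 p.1 p'.1) = 1 := by
    ext ⟨i, A⟩ ⟨k, B⟩
    rw [Matrix.mul_apply, Fintype.sum_prod_type, Finset.sum_comm]
    refine (P.conj_vecW_mul A B i k).trans ?_
    simp [Matrix.one_apply, and_comm]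
  have h'' := mul_eq_one_comm.mp h
  have h' := congrFun (congrFun h'' (k, D)) (j, C)
  rw [Matrix.mul_apply, Fintype.sum_prod_type] at h'
  refine h'.trans ?_
  simp [Matrix.one_apply, and_comm]

/-- The inverse of `Gτ` is the entrywise conjugate of the matrix of `w*` on vectors, so the
definition of `H̃` becomes free of inverses. -/
theorem HVtilde_apply (P : PoincareDatum) (j : Fin 4) (C B : Fin 2) :
    P.HVtilde (j, C) B = -∑ i, ∑ A, P.vecWstar C A j i * starRingEnd ℂ (P.HV (i, A) B) := by
  have h : (P.G.submatrix id Prod.swap) *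
      (Matrix.of fun p p' : Fin 4 × Fin 2 => starRingEnd ℂ (P.vecWstar p.2 p'.2 p.1 p'.1)) = 1 := by
    ext ⟨i, A⟩ ⟨k, B⟩
    have := congrArg (starRingEnd ℂ) (P.conj_vecW_mul A B i k)
    simp only [map_sum, map_mul, Complex.conj_conj] at this
    rw [Matrix.mul_apply, Fintype.sum_prod_type, Finset.sum_comm]
    simp only [Matrix.submatrix_apply, Prod.swap_prod_mk, id, Matrix.of_apply, ← vecW_apply]
    rw [this]
    simp [Matrix.one_apply, and_comm, apply_ite (starRingEnd ℂ)]
  rw [HVtilde, Matrix.inv_eq_right_inv h]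
  simp only [Matrix.neg_apply, Matrix.map_apply, Matrix.mul_apply, Matrix.of_apply, map_sum,
    map_mul, Complex.conj_conj, Fintype.sum_prod_type]

/-- The affine extension of the vector representation by `H`: action of `w`. -/
def affW (P : PoincareDatum) (A C : Fin 2) : Matrix (Fin 4 ⊕ Unit) (Fin 4 ⊕ Unit) ℂ :=
  Matrix.fromBlocks (P.vecW A C) (Matrix.of fun i _ => P.HV (i, A) C) 0
    (Matrix.of fun _ _ => if A = C then 1 else 0)

/-- The affine extension of the vector representation by `H`: action of `w*`. -/
def affWstar (P : PoincareDatum) (A C : Fin 2) : Matrix (Fin 4 ⊕ Unit) (Fin 4 ⊕ Unit) ℂ :=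
  Matrix.fromBlocks (P.vecWstar A C) (Matrix.of fun i _ => P.HVtilde (i, A) C) 0
    (Matrix.of fun _ _ => if A = C then 1 else 0)

end PoincareDatum

/-- The element `w^A_B` of the algebra of a quantum Poincaré group. -/
def poincareW (P : PoincareDatum) (A B : Fin 2) : PoincareAlgebra P :=
  StarPres.mk _ _ (FreeAlgebra.ι ℂ (PoincareGen.w A B))

/-- The adjoint of `w^A_B` in the algebra of a quantum Poincaré group. -/
def poincareWstar (P : PoincareDatum) (A B : Fin 2) : PoincareAlgebra P :=
  StarPres.mk _ _ (FreeAlgebra.ι ℂ (PoincareGen.wstar A B))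

/-- The element `y^i` of the algebra of a quantum Poincaré group. -/
def poincareY (P : PoincareDatum) (i : Fin 4) : PoincareAlgebra P :=
  StarPres.mk _ _ (FreeAlgebra.ι ℂ (PoincareGen.y i))

theorem lorentzRep_poincareW (P : PoincareDatum) :
    LorentzRep P.lor (poincareW P) (poincareWstar P) :=
  LorentzRep.of_star (σ := PoincareGen.inv) (StarPres.mk _ _) (fun _ _ => rfl) (fun _ _ => rfl)
    (fun _ hp => StarPres.mk_relation (Or.inl hp))

theorem lorentzToPoincare_w (P : PoincareDatum) (A B : Fin 2) :
    lorentzToPoincare P (lorentzW P.lor A B) = poincareW P A B := by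
  simp [lorentzToPoincare, lorentzW, poincareW, StarPres.mk, freeInclusion, LorentzGen.toPoincare]

theorem lorentzToPoincare_wstar (P : PoincareDatum) (A B : Fin 2) :
    lorentzToPoincare P (lorentzWstar P.lor A B) = poincareWstar P A B := by
  simp [lorentzToPoincare, lorentzWstar, poincareWstar, StarPres.mk, freeInclusion,
    LorentzGen.toPoincare]

theorem map_lambda {F F' : Type} [Ring F] [Algebra ℂ F] [Ring F'] [Algebra ℂ F'] (φ : F →ₐ[ℂ] F')
    (w ws : Fin 2 → Fin 2 → F) (i j : Fin 4) :
    φ (lambda w ws i j) = lambda (fun A B => φ (w A B)) (fun A B => φ (ws A B)) i j := by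
  simp only [lambda, map_sum, map_smul, map_mul]

theorem adj_lambda {X : Type} {σ : X → X} {w ws : Fin 2 → Fin 2 → X}
    (hw : ∀ A B, σ (w A B) = ws A B) (hws : ∀ A B, σ (ws A B) = w A B) (i j : Fin 4) :
    adj σ (lambda (fun A B => FreeAlgebra.ι ℂ (w A B)) (fun A B => FreeAlgebra.ι ℂ (ws A B)) i j) =
      lambda (fun A B => FreeAlgebra.ι ℂ (w A B)) (fun A B => FreeAlgebra.ι ℂ (ws A B)) i j := by
  simp only [lambda, adj_sum, adj_smul, adj_mul, adj_gen, hw, hws, map_mul, conj_V, conj_Vinv]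
  rw [Finset.sum_comm]
  refine Finset.sum_congr rfl fun _ _ => Finset.sum_congr rfl fun _ _ => ?_
  rw [Finset.sum_comm]

theorem poincareY_mul_w (P : PoincareDatum) (i : Fin 4) (A B : Fin 2) :
    poincareY P i * poincareW P A B =
      ∑ C, ∑ j, P.vecW A C i j • (poincareW P C B * poincareY P j) +
        ∑ C, P.HV (i, A) C • poincareW P C B -
        ∑ j, ∑ C, P.HV (j, C) B •
          (lambda (poincareW P) (poincareWstar P) i j * poincareW P A C) := by
  have h := (StarPres.mk_relation (σ := PoincareGen.inv) (P := poincareFreeRelations P)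
    (Or.inr (Or.inr ⟨i, A, B, rfl⟩))).1
  simp only [map_sub, map_add, map_sum, map_smul, map_mul, map_lambda, sub_eq_zero] at h
  simp only [P.vecW_apply]
  exact h

theorem w_star_mul_poincareY (P : PoincareDatum) (i : Fin 4) (A B : Fin 2) :
    poincareWstar P A B * poincareY P i =
      ∑ C, ∑ j, starRingEnd ℂ (P.vecW A C i j) • (poincareY P j * poincareWstar P C B) +
        ∑ C, starRingEnd ℂ (P.HV (i, A) C) • poincareWstar P C B -
        ∑ j, ∑ C, starRingEnd ℂ (P.HV (j, C) B) •
          (poincareWstar P A C * lambda (poincareW P) (poincareWstar P) i j) := by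
  have h := (StarPres.mk_relation (σ := PoincareGen.inv) (P := poincareFreeRelations P)
    (Or.inr (Or.inr ⟨i, A, B, rfl⟩))).2
  simp only [adj_sub, adj_add, adj_sum, adj_smul, adj_mul, adj_gen,
    adj_lambda (σ := PoincareGen.inv) (w := PoincareGen.w) (ws := PoincareGen.wstar)
      (fun _ _ => rfl) (fun _ _ => rfl)] at h
  simp only [map_sub, map_add, map_sum, map_smul, map_mul, map_lambda, sub_eq_zero,
    PoincareGen.inv] at h
  simp only [P.vecW_apply]
  exact h

theorem sum_comm_pairs {M α β γ δ : Type} [AddCommMonoid M] [Fintype α] [Fintype β] [Fintype γ]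
    [Fintype δ] (f : α → β → γ → δ → M) :
    ∑ a, ∑ b, ∑ c, ∑ d, f a b c d = ∑ c, ∑ d, ∑ a, ∑ b, f a b c d := by
  have h := Finset.sum_comm (s := (Finset.univ : Finset (α × β)))
    (t := (Finset.univ : Finset (γ × δ))) (f := fun p p' => f p.1 p.2 p'.1 p'.2)
  simpa only [Fintype.sum_prod_type] using h

/-- The adjoint of the commutation rule of `y` with `w` expresses `ws · y` through `y · ws`.
Contracting with the inverse coefficients solves it for `y · ws`, and the intertwining of `U` brings
the last term to standard order. The inhomogeneous coefficients that appear are precisely `H̃`. -/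
theorem translation_mul_wstar {F : Type} [Ring F] [Algebra ℂ F] {P : PoincareDatum}
    {ws : Fin 2 → Fin 2 → F} {y : Fin 4 → F} {U : Fin 4 → Fin 4 → F}
    (hU : ∀ A B i k, ∑ C, ∑ j, P.vecWstar C B j k • (U i j * ws A C) =
      ∑ C, ∑ j, P.vecWstar A C i j • (ws C B * U j k))
    (hy : ∀ i A B, ws A B * y i =
      ∑ C, ∑ j, starRingEnd ℂ (P.vecW A C i j) • (y j * ws C B) +
        ∑ C, starRingEnd ℂ (P.HV (i, A) C) • ws C B -
        ∑ j, ∑ C, starRingEnd ℂ (P.HV (j, C) B) • (ws A C * U i j))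
    (k : Fin 4) (D B : Fin 2) :
    y k * ws D B =
      ∑ C, ∑ j, P.vecWstar D C k j • (ws C B * y j) +
        ∑ C, P.HVtilde (k, D) C • ws C B -
        ∑ j, ∑ C, P.HVtilde (j, C) B •
          (U k j * ws D C) := by
  have h1 : ∑ C, ∑ j, P.vecWstar D C k j • (ws C B * y j) =
      ∑ C, ∑ j, (∑ i, ∑ A, P.vecWstar D A k i * starRingEnd ℂ (P.vecW A C i j)) •
        (y j * ws C B) +
      ∑ C, (∑ i, ∑ A, P.vecWstar D A k i * starRingEnd ℂ (P.HV (i, A) C)) • ws C B -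
      ∑ j, ∑ C, starRingEnd ℂ (P.HV (j, C) B) • ∑ A, ∑ i, P.vecWstar D A k i •
        (ws A C * U i j) := by
    simp only [hy, smul_sub, smul_add, Finset.smul_sum, Finset.sum_sub_distrib,
      Finset.sum_add_distrib, smul_smul, Finset.sum_smul]
    refine congrArg₂ (· - ·) (congrArg₂ (· + ·) ?_ ?_) ?_
    · rw [sum_comm_pairs]
      exact Finset.sum_congr rfl fun _ _ => Finset.sum_congr rfl fun _ _ => Finset.sum_comm
    · rw [Finset.sum_comm]
      calc _ = ∑ i, ∑ C, ∑ A, (P.vecWstar D A k i * starRingEnd ℂ (P.HV (i, A) C)) •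
              ws C B := Finset.sum_congr rfl fun _ _ => Finset.sum_comm
        _ = _ := Finset.sum_comm
    · rw [sum_comm_pairs]
      simp only [mul_comm (starRingEnd ℂ _)]
  simp only [h1, ← hU, P.vecWstar_mul_conj]
  have h3 : ∀ C, ∑ i, ∑ A, P.vecWstar D A k i * starRingEnd ℂ (P.HV (i, A) C) =
    - P.HVtilde (k, D) C := fun C => by rw [P.HVtilde_apply, neg_neg]
  have h4 : ∑ j, ∑ C, starRingEnd ℂ (P.HV (j, C) B) • ∑ C', ∑ j', P.vecWstar C' C j' j •
      (U k j' * ws D C') =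
      -∑ j, ∑ C, P.HVtilde (j, C) B •
        (U k j * ws D C) := by
    simp only [P.HVtilde_apply, neg_smul, Finset.sum_neg_distrib, neg_neg, Finset.smul_sum,
      Finset.sum_smul, smul_smul]
    rw [sum_comm_pairs, Finset.sum_comm]
    simp only [mul_comm (starRingEnd ℂ _)]
  rw [h4]
  simp only [h3, neg_smul, Finset.sum_neg_distrib, ite_and, ite_smul, one_smul, zero_smul,
    Finset.sum_ite_eq, Finset.mem_univ, if_true]
  simp only [Finset.sum_ite_irrel, Finset.sum_const_zero, Finset.sum_ite_eq, Finset.mem_univ, if_true]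
  abel

theorem poincareY_mul_wstar (P : PoincareDatum) (k : Fin 4) (D B : Fin 2) :
    poincareY P k * poincareWstar P D B =
      ∑ C, ∑ j, P.vecWstar D C k j • (poincareWstar P C B * poincareY P j) +
        ∑ C, P.HVtilde (k, D) C • poincareWstar P C B -
        ∑ j, ∑ C, P.HVtilde (j, C) B •
          (lambda (poincareW P) (poincareWstar P) k j * poincareWstar P D C) :=
  translation_mul_wstar (intertwines_iff.mp (lorentzRep_poincareW P).intertwines_lambda_ws)
    (w_star_mul_poincareY P) k D B

/-- The matrix with blocks `Λ, y, 0, 1`. -/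
def poincareMatrix (P : PoincareDatum) :
    Matrix (Fin 4 ⊕ Unit) (Fin 4 ⊕ Unit) (PoincareAlgebra P) :=
  Matrix.fromBlocks (Matrix.of (lambda (poincareW P) (poincareWstar P)))
    (Matrix.of fun i _ => poincareY P i) 0 1

/-- The upper right block of the intertwining identity is the commutation rule of `y` with `u`; the
upper left block is the hypothesis on `U`, and the bottom row is trivial. -/
theorem intertwines_fromBlocks {F : Type} [Ring F] [Algebra ℂ F] {U : Matrix (Fin 4) (Fin 4) F}
    {u : Fin 2 → Fin 2 → F} {y : Fin 4 → F}
    {f : Fin 2 → Fin 2 → Matrix (Fin 4) (Fin 4) ℂ} {h : Fin 4 → Fin 2 → Fin 2 → ℂ}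
    (hf : Intertwines U u f)
    (hy : ∀ i A B, y i * u A B = ∑ C, ∑ j, f A C i j • (u C B * y j) +
        ∑ C, h i A C • u C B - ∑ j, ∑ C, h j C B • (U i j * u A C)) :
    Intertwines (Matrix.fromBlocks U (Matrix.of fun i (_ : Unit) => y i) 0 1) u
      (fun A C => Matrix.fromBlocks (f A C) (Matrix.of fun i _ => h i A C) 0
        (Matrix.of fun _ _ => if A = C then 1 else 0)) := by
  rw [intertwines_iff] at hf ⊢
  rintro A B (i | i) (k | k)
  · simpa [Fintype.sum_sum_type, -Fin.sum_univ_two] using hf A B i k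
  · have := hy i A B
    rw [Finset.sum_comm (s := Finset.univ (α := Fin 4)) (t := Finset.univ (α := Fin 2))] at this
    simp [Fintype.sum_sum_type, -Fin.sum_univ_two, Finset.sum_add_distrib, this]
  · simp [Fintype.sum_sum_type, -Fin.sum_univ_two]
  · simp [Fintype.sum_sum_type, -Fin.sum_univ_two]

theorem intertwines_affW (P : PoincareDatum) :
    Intertwines (poincareMatrix P) (poincareW P) P.affW :=
  intertwines_fromBlocks (lorentzRep_poincareW P).intertwines_lambda_w (poincareY_mul_w P)

theorem intertwines_affWstar (P : PoincareDatum) :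
    Intertwines (poincareMatrix P) (poincareWstar P) P.affWstar :=
  intertwines_fromBlocks (lorentzRep_poincareW P).intertwines_lambda_ws
    (poincareY_mul_wstar P)

/-! ### Vanishing of the defects by means of the parity character. -/

section

theorem lorentzToPoincare_lambda (P : PoincareDatum) (i j : Fin 4) :
    lorentzToPoincare P (lambda (lorentzW P.lor) (lorentzWstar P.lor) i j) =
      lambda (poincareW P) (poincareWstar P) i j := by
  rw [map_lambda]
  congr 1
  · funext A B
    exact lorentzToPoincare_w P A B
  · funext A B
    exact lorentzToPoincare_wstar P A B

/-- The character with `w ↦ -1` and `w* ↦ 1`. -/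
def parity (d : LorentzType) : LorentzAlgebra d →ₐ[ℂ] ℂ := (lorentzRep_parity d).lift

theorem parity_w (d : LorentzType) (A B : Fin 2) :
    parity d (lorentzW d A B) = -(if A = B then 1 else 0) := by
  rw [parity, LorentzRep.lift_w]
  split_ifs <;> simp

theorem parity_wstar (d : LorentzType) (A B : Fin 2) :
    parity d (lorentzWstar d A B) = if A = B then 1 else 0 :=
  LorentzRep.lift_wstar _ A B

/-- `Λ` has one factor `w` and one factor `w*`, hence changes sign; this sign is the reason for
choosing the character. -/
theorem parity_lambda (d : LorentzType) (i j : Fin 4) :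
    parity d (lambda (lorentzW d) (lorentzWstar d) i j) = -(if i = j then 1 else 0) := by
  have h : ∑ A, ∑ B, Vinv i (A, B) * V (A, B) j = if i = j then 1 else 0 := by
    have := congrFun (congrFun Vinv_mul_V i) j
    simpa only [Matrix.mul_apply, Fintype.sum_prod_type, Matrix.one_apply] using this
  rw [map_lambda, ← h]
  simp only [lambda, parity_w, parity_wstar]
  simp [-Fin.sum_univ_two]

theorem parity_eq {P : PoincareDatum} (hP : P.Admissible) {a b : LorentzAlgebra P.lor}
    (h : lorentzToPoincare P a = lorentzToPoincare P b) : parity P.lor a = parity P.lor b :=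
  congrArg _ (hP.lorentz_injective h)

section Blocks

variable {F : Type} [Ring F] [Algebra ℂ F]

/-- The square matrix with blocks `U`, `y`, `0`, `1`. -/
def affineMatrix (U : Matrix (Fin 4) (Fin 4) F) (y : Fin 4 → F) :
    Matrix (Fin 4 ⊕ Unit) (Fin 4 ⊕ Unit) F :=
  Matrix.fromBlocks U (Matrix.of fun i _ => y i) 0 1

variable {U : Matrix (Fin 4) (Fin 4) F} {y : Fin 4 → F}

/-- The vanishing lower right corner of `N` removes the contribution of `y`. In
`mul_affineMatrix_apply` the vanishing upper left block does the same on the other side. -/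
theorem affineMatrix_mul_apply (N : Matrix (Fin 4 ⊕ Unit) (Fin 4 ⊕ Unit) ℂ)
    (hN : N (Sum.inr ()) (Sum.inr ()) = 0) (x : F) (i : Fin 4) :
    (affineMatrix U y * ((Matrix.scalar (Fin 4 ⊕ Unit) x * constMat F N :
      Matrix (Fin 4 ⊕ Unit) (Fin 4 ⊕ Unit) F))) (Sum.inl i) (Sum.inr ()) =
      ∑ j, N (Sum.inl j) (Sum.inr ()) • (U i j * x) := by
  simp [affineMatrix, Matrix.mul_apply, Matrix.scalar_apply, constMat_apply,
    Fintype.sum_sum_type, hN, Algebra.smul_def, Algebra.commutes, mul_assoc, -Fin.sum_univ_four,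
    -Fin.sum_univ_two, Matrix.diagonal_apply]

theorem mul_affineMatrix_apply (N : Matrix (Fin 4 ⊕ Unit) (Fin 4 ⊕ Unit) ℂ)
    (hN : ∀ i j, N (Sum.inl i) (Sum.inl j) = 0) (x : F) (i : Fin 4) :
    (((constMat F N * Matrix.scalar (Fin 4 ⊕ Unit) x : Matrix (Fin 4 ⊕ Unit) (Fin 4 ⊕ Unit) F)) *
      affineMatrix U y) (Sum.inl i) (Sum.inr ()) =
      N (Sum.inl i) (Sum.inr ()) • x := by
  simp [affineMatrix, Matrix.mul_apply, Matrix.scalar_apply, constMat_apply,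
    Fintype.sum_sum_type, hN, Algebra.smul_def, Matrix.diagonal_apply]

end Blocks

theorem poincareMatrix_eq (P : PoincareDatum) : poincareMatrix P =
    affineMatrix (Matrix.of (lambda (poincareW P) (poincareWstar P))) (poincareY P) := rfl

/-- In the upper right block the identity compares `N` contracted with `Λ u v` on one side with `N`
alone on the other. Parity sends `uv` to the identity and `Λ` to minus the identity, giving `-N =
N`. -/
theorem vector_defect {P : PoincareDatum} (hP : P.Admissible)
    {u v : Fin 2 → Fin 2 → LorentzAlgebra P.lor}
    {N : Fin 2 → Fin 2 → Matrix (Fin 4 ⊕ Unit) (Fin 4 ⊕ Unit) ℂ}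
    (hl : ∀ A C i j, N A C (Sum.inl i) (Sum.inl j) = 0)
    (hr : ∀ A C, N A C (Sum.inr ()) (Sum.inr ()) = 0)
    (huv : ∀ A K C M, parity P.lor (u A K * v C M) = if A = K ∧ C = M then 1 else 0)
    (h : ∀ A C, poincareMatrix P * ∑ K, ∑ M, Matrix.scalar (Fin 4 ⊕ Unit)
      (lorentzToPoincare P (u A K) * lorentzToPoincare P (v C M)) *
        constMat (PoincareAlgebra P) (N K M) =
      constMat (PoincareAlgebra P) (N A C) * poincareMatrix P) (A C : Fin 2) (i : Fin 4) :
    N A C (Sum.inl i) (Sum.inr ()) = 0 := by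
  have h1 := congrFun (congrFun (h A C) (Sum.inl i)) (Sum.inr ())
  have h2 := mul_affineMatrix_apply (U := Matrix.of (lambda (poincareW P) (poincareWstar P)))
    (y := poincareY P) (N A C) (hl A C) 1 i
  rw [map_one, mul_one] at h2
  rw [Matrix.mul_sum, Matrix.sum_apply] at h1
  simp only [Matrix.mul_sum, Matrix.sum_apply] at h1
  simp only [poincareMatrix_eq] at h1
  rw [h2] at h1
  simp only [affineMatrix_mul_apply _ (hr _ _), Matrix.of_apply] at h1
  -- No `y` is left, so both sides lie in the image of `𝒜` and injectivity allows applying a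
  -- character of `𝒜`, which need not extend to `ℬ`.
  simp only [← lorentzToPoincare_lambda, ← map_mul, ← map_smul, ← map_sum] at h1
  rw [← map_one (lorentzToPoincare P), ← map_smul] at h1
  have h3 := parity_eq hP h1
  simp only [map_sum, map_smul, map_mul (parity P.lor) (lambda _ _ _ _), parity_lambda, huv,
    map_one, smul_eq_mul, ite_and] at h3
  simp [-Fin.sum_univ_two] at h3
  exact self_eq_neg.mp h3.symm

theorem covector_defect {P : PoincareDatum} (hP : P.Admissible)
    {u v : Fin 2 → Fin 2 → LorentzAlgebra P.lor}
    {N : Fin 2 → Fin 2 → Matrix (Fin 4 ⊕ Unit) (Fin 4 ⊕ Unit) ℂ}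
    (hl : ∀ A C i j, N A C (Sum.inl i) (Sum.inl j) = 0)
    (hr : ∀ A C, N A C (Sum.inr ()) (Sum.inr ()) = 0)
    (huv : ∀ A K C M, parity P.lor (u A K * v C M) = if A = K ∧ C = M then 1 else 0)
    (h : ∀ B D, poincareMatrix P * constMat (PoincareAlgebra P) (N B D) =
      (∑ K, ∑ M, constMat (PoincareAlgebra P) (N K M) * Matrix.scalar (Fin 4 ⊕ Unit)
      (lorentzToPoincare P (u K B) * lorentzToPoincare P (v M D))) * poincareMatrix P)
    (A C : Fin 2) (i : Fin 4) :
    N A C (Sum.inl i) (Sum.inr ()) = 0 := by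
  have h1 := congrFun (congrFun (h A C) (Sum.inl i)) (Sum.inr ())
  have h2 := affineMatrix_mul_apply (U := Matrix.of (lambda (poincareW P) (poincareWstar P)))
    (y := poincareY P) (N A C) (hr A C) 1 i
  rw [map_one, one_mul] at h2
  simp only [Matrix.sum_mul, Matrix.sum_apply] at h1
  simp only [poincareMatrix_eq] at h1
  rw [h2] at h1
  simp only [mul_affineMatrix_apply _ (hl _ _), Matrix.of_apply, mul_one] at h1
  simp only [← lorentzToPoincare_lambda, ← map_mul, ← map_smul, ← map_sum] at h1
  have h3 := parity_eq hP h1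
  simp only [map_sum, map_smul, parity_lambda, huv, smul_eq_mul, ite_and] at h3
  simp [-Fin.sum_univ_two] at h3
  exact neg_eq_self.mp h3

/-- Here `uv` and `vu` both have parity `-1`, so their signs cancel against each other and the sign
of `Λ` again leaves `N = -N`. -/
theorem exchange_defect {P : PoincareDatum} (hP : P.Admissible)
    {u v : Fin 2 → Fin 2 → LorentzAlgebra P.lor}
    {N : Fin 2 → Fin 2 → Fin 2 → Fin 2 → Matrix (Fin 4 ⊕ Unit) (Fin 4 ⊕ Unit) ℂ}
    (hl : ∀ A B K L i j, N A B K L (Sum.inl i) (Sum.inl j) = 0)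
    (hr : ∀ A B K L, N A B K L (Sum.inr ()) (Sum.inr ()) = 0)
    (huv : ∀ A K C M, parity P.lor (u A K * v C M) = -if A = K ∧ C = M then 1 else 0)
    (hvu : ∀ A K C M, parity P.lor (v A K * u C M) = -if A = K ∧ C = M then 1 else 0)
    (h : ∀ A B K L, poincareMatrix P * ∑ C, ∑ D, Matrix.scalar (Fin 4 ⊕ Unit)
      (lorentzToPoincare P (v A C) * lorentzToPoincare P (u B D)) *
        constMat (PoincareAlgebra P) (N C D K L) =
      (∑ C, ∑ D, constMat (PoincareAlgebra P) (N A B C D) * Matrix.scalar (Fin 4 ⊕ Unit)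
      (lorentzToPoincare P (u C K) * lorentzToPoincare P (v D L))) * poincareMatrix P)
    (A B K L : Fin 2) (i : Fin 4) :
    N A B K L (Sum.inl i) (Sum.inr ()) = 0 := by
  have h1 := congrFun (congrFun (h A B K L) (Sum.inl i)) (Sum.inr ())
  simp only [Matrix.sum_mul, Matrix.mul_sum, Matrix.sum_apply] at h1
  simp only [poincareMatrix_eq] at h1
  simp only [affineMatrix_mul_apply _ (hr _ _ _ _), mul_affineMatrix_apply _ (hl _ _ _ _),
    Matrix.of_apply] at h1
  simp only [← lorentzToPoincare_lambda, ← map_mul, ← map_smul, ← map_sum] at h1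
  have h3 := parity_eq hP h1
  simp only [map_sum, map_smul, map_mul (parity P.lor) (lambda _ _ _ _), parity_lambda, huv, hvu,
    smul_eq_mul, ite_and] at h3
  simp [-Fin.sum_univ_two] at h3
  exact self_eq_neg.mp h3

end

theorem blocks_ext {M N : Matrix (Fin 4 ⊕ Unit) (Fin 4 ⊕ Unit) ℂ}
    (hl : ∀ i j, M (Sum.inl i) (Sum.inl j) = N (Sum.inl i) (Sum.inl j))
    (hlr : ∀ i, M (Sum.inl i) (Sum.inr ()) = N (Sum.inl i) (Sum.inr ()))
    (hrl : ∀ j, M (Sum.inr ()) (Sum.inl j) = N (Sum.inr ()) (Sum.inl j))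
    (hr : M (Sum.inr ()) (Sum.inr ()) = N (Sum.inr ()) (Sum.inr ())) : M = N := by
  ext (i | i) (j | j)
  · exact hl i j
  · exact hlr i
  · exact hrl j
  · exact hr

/-- The diagonal blocks are the vector and the trivial representation, so only the upper right block
of each relation is in question, and the three defect lemmas apply. This converts the qualitative
assumption on `𝒜 → ℬ` into equations for `H`. -/
theorem lorentzRep_aff {P : PoincareDatum} (hP : P.Admissible) :
    LorentzRep P.lor P.affW P.affWstar where
  E A C := by
    have hl : ∀ A C i j, (∑ B, ∑ D, P.lor.E B D • (P.affW A B * P.affW C D) -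
        algebraMap ℂ _ (P.lor.E A C)) (Sum.inl i) (Sum.inl j) = 0 := by
      intro A C i j
      have h := congrFun (congrFun (P.lorentzRep_vec.E A C) i) j
      rw [← sub_eq_zero] at h
      rw [← h]
      simp [PoincareDatum.affW, Matrix.sum_apply, Matrix.mul_apply, Fintype.sum_sum_type,
        Matrix.algebraMap_matrix_apply, -Fin.sum_univ_two]
    have hr : ∀ A C, (∑ B, ∑ D, P.lor.E B D • (P.affW A B * P.affW C D) -
        algebraMap ℂ _ (P.lor.E A C)) (Sum.inr ()) (Sum.inr ()) = 0 := by
      intro A C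
      simp [PoincareDatum.affW, Matrix.sum_apply, Matrix.mul_apply, Fintype.sum_sum_type,
        Matrix.algebraMap_matrix_apply, -Fin.sum_univ_two]
    rw [← sub_eq_zero]
    refine blocks_ext (hl A C) (fun i => ?_) (fun j => ?_) (hr A C)
    · refine vector_defect hP (u := lorentzW P.lor) (v := lorentzW P.lor) hl hr ?_ ?_ A C i
      · intro A K C M
        simp only [map_mul, parity_w, neg_mul_neg, ite_and, ite_mul, one_mul, zero_mul]
      · intro A C
        simp only [lorentzToPoincare_w]
        exact (intertwines_affW P).vector (intertwines_affW P) (lorentzRep_poincareW P).E A C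
    · simp [PoincareDatum.affW, Matrix.sum_apply, Matrix.mul_apply, Fintype.sum_sum_type,
        Matrix.algebraMap_matrix_apply, -Fin.sum_univ_two]
  E' A C := by
    have hl : ∀ B D i j, (∑ A, ∑ C, P.lor.E' A C • (P.affW A B * P.affW C D) -
        algebraMap ℂ _ (P.lor.E' B D)) (Sum.inl i) (Sum.inl j) = 0 := by
      intro A C i j
      have h := congrFun (congrFun (P.lorentzRep_vec.E' A C) i) j
      rw [← sub_eq_zero] at h
      rw [← h]
      simp [PoincareDatum.affW, Matrix.sum_apply, Matrix.mul_apply, Fintype.sum_sum_type,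
        Matrix.algebraMap_matrix_apply, -Fin.sum_univ_two]
    have hr : ∀ B D, (∑ A, ∑ C, P.lor.E' A C • (P.affW A B * P.affW C D) -
        algebraMap ℂ _ (P.lor.E' B D)) (Sum.inr ()) (Sum.inr ()) = 0 := by
      intro A C
      simp [PoincareDatum.affW, Matrix.sum_apply, Matrix.mul_apply, Fintype.sum_sum_type,
        Matrix.algebraMap_matrix_apply, -Fin.sum_univ_two]
    rw [← sub_eq_zero]
    refine blocks_ext (hl A C) (fun i => ?_) (fun j => ?_) (hr A C)
    · refine covector_defect hP (u := lorentzW P.lor) (v := lorentzW P.lor)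
        (N := fun B D => ∑ A, ∑ C, P.lor.E' A C • (P.affW A B * P.affW C D) -
        algebraMap ℂ _ (P.lor.E' B D)) hl hr ?_ ?_ A C i
      · intro A K C M
        simp only [map_mul, parity_w, neg_mul_neg, ite_and, ite_mul, one_mul, zero_mul]
      · intro A C
        simp only [lorentzToPoincare_w]
        exact (intertwines_affW P).covector (intertwines_affW P) (lorentzRep_poincareW P).E' A C
    · simp [PoincareDatum.affW, Matrix.sum_apply, Matrix.mul_apply, Fintype.sum_sum_type,
        Matrix.algebraMap_matrix_apply, -Fin.sum_univ_two]
  conjE A C := by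
    have hs : ∀ A C, ∑ B, ∑ D, P.lor.E B D • (P.affWstar C D * P.affWstar A B) =
        ∑ B, ∑ D, P.lor.E D B • (P.affWstar C B * P.affWstar A D) :=
      fun A C => Finset.sum_comm
    have hl : ∀ C A i j, (∑ B, ∑ D, P.lor.E D B • (P.affWstar C B * P.affWstar A D) -
        algebraMap ℂ _ (P.lor.E A C)) (Sum.inl i) (Sum.inl j) = 0 := by
      intro C A i j
      have h := congrFun (congrFun (P.lorentzRep_vec.conjE A C) i) j
      rw [← sub_eq_zero] at h
      rw [← h, ← hs]
      simp [PoincareDatum.affWstar, Matrix.sum_apply, Matrix.mul_apply, Fintype.sum_sum_type,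
        Matrix.algebraMap_matrix_apply, -Fin.sum_univ_two]
    have hr : ∀ C A, (∑ B, ∑ D, P.lor.E D B • (P.affWstar C B * P.affWstar A D) -
        algebraMap ℂ _ (P.lor.E A C)) (Sum.inr ()) (Sum.inr ()) = 0 := by
      intro C A
      simp [PoincareDatum.affWstar, Matrix.sum_apply, Matrix.mul_apply, Fintype.sum_sum_type,
        Matrix.algebraMap_matrix_apply, -Fin.sum_univ_two]
    rw [hs, ← sub_eq_zero]
    refine blocks_ext (hl C A) (fun i => ?_) (fun j => ?_) (hr C A)
    · refine vector_defect hP (u := lorentzWstar P.lor) (v := lorentzWstar P.lor)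
        (N := fun C A => ∑ B, ∑ D, P.lor.E D B • (P.affWstar C B * P.affWstar A D) -
        algebraMap ℂ _ (P.lor.E A C)) hl hr ?_ ?_ C A i
      · intro A K C M
        simp only [map_mul, parity_wstar, ite_and, ite_mul, one_mul, zero_mul]
      · intro C A
        simp only [lorentzToPoincare_wstar]
        refine (intertwines_affWstar P).vector (intertwines_affWstar P)
          (e := fun B D => P.lor.E D B) (fun C A => ?_) C A
        rw [Finset.sum_comm]
        exact (lorentzRep_poincareW P).conjE A C
    · simp [PoincareDatum.affWstar, Matrix.sum_apply, Matrix.mul_apply, Fintype.sum_sum_type,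
        Matrix.algebraMap_matrix_apply, -Fin.sum_univ_two]
  conjE' A C := by
    have hs : ∀ B D, ∑ A, ∑ C, P.lor.E' A C • (P.affWstar C D * P.affWstar A B) =
        ∑ A, ∑ C, P.lor.E' C A • (P.affWstar A D * P.affWstar C B) :=
      fun A C => Finset.sum_comm
    have hl : ∀ D B i j, (∑ A, ∑ C, P.lor.E' C A • (P.affWstar A D * P.affWstar C B) -
        algebraMap ℂ _ (P.lor.E' B D)) (Sum.inl i) (Sum.inl j) = 0 := by
      intro C A i j
      have h := congrFun (congrFun (P.lorentzRep_vec.conjE' A C) i) j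
      rw [← sub_eq_zero] at h
      rw [← h, ← hs]
      simp [PoincareDatum.affWstar, Matrix.sum_apply, Matrix.mul_apply, Fintype.sum_sum_type,
        Matrix.algebraMap_matrix_apply, -Fin.sum_univ_two]
    have hr : ∀ D B, (∑ A, ∑ C, P.lor.E' C A • (P.affWstar A D * P.affWstar C B) -
        algebraMap ℂ _ (P.lor.E' B D)) (Sum.inr ()) (Sum.inr ()) = 0 := by
      intro C A
      simp [PoincareDatum.affWstar, Matrix.sum_apply, Matrix.mul_apply, Fintype.sum_sum_type,
        Matrix.algebraMap_matrix_apply, -Fin.sum_univ_two]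
    rw [hs, ← sub_eq_zero]
    refine blocks_ext (hl C A) (fun i => ?_) (fun j => ?_) (hr C A)
    · refine covector_defect hP (u := lorentzWstar P.lor) (v := lorentzWstar P.lor)
        (N := fun D B => ∑ A, ∑ C, P.lor.E' C A • (P.affWstar A D * P.affWstar C B) -
        algebraMap ℂ _ (P.lor.E' B D)) hl hr ?_ ?_ C A i
      · intro A K C M
        simp only [map_mul, parity_wstar, ite_and, ite_mul, one_mul, zero_mul]
      · intro D B
        simp only [lorentzToPoincare_wstar]
        refine (intertwines_affWstar P).covector (intertwines_affWstar P)
          (e := fun B D => P.lor.E' D B) (fun C A => ?_) D B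
        rw [Finset.sum_comm]
        exact (lorentzRep_poincareW P).conjE' A C
    · simp [PoincareDatum.affWstar, Matrix.sum_apply, Matrix.mul_apply, Fintype.sum_sum_type,
        Matrix.algebraMap_matrix_apply, -Fin.sum_univ_two]
  X A B K L := by
    set N : Fin 2 → Fin 2 → Fin 2 → Fin 2 → Matrix (Fin 4 ⊕ Unit) (Fin 4 ⊕ Unit) ℂ :=
      fun A B K L => ∑ C, ∑ D, P.lor.X (A, B) (C, D) • (P.affW C K * P.affWstar D L) -
        ∑ C, ∑ D, P.lor.X (C, D) (K, L) • (P.affWstar A C * P.affW B D) with hN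
    have hl : ∀ A B K L i j, N A B K L (Sum.inl i) (Sum.inl j) = 0 := by
      intro A B K L i j
      have h := congrFun (congrFun (P.lorentzRep_vec.X A B K L) i) j
      rw [← sub_eq_zero] at h
      rw [← h]
      simp [hN, PoincareDatum.affW, PoincareDatum.affWstar, Matrix.sum_apply, Matrix.mul_apply,
        Fintype.sum_sum_type, Matrix.algebraMap_matrix_apply, -Fin.sum_univ_two,
]
    have hr : ∀ A B K L, N A B K L (Sum.inr ()) (Sum.inr ()) = 0 := by
      intro A B K L
      simp [hN, PoincareDatum.affW, PoincareDatum.affWstar, Matrix.sum_apply, Matrix.mul_apply,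
        Fintype.sum_sum_type, Matrix.algebraMap_matrix_apply, -Fin.sum_univ_two,
]
    rw [← sub_eq_zero]
    refine blocks_ext (hl A B K L) (fun i => ?_) (fun j => ?_) (hr A B K L)
    · refine exchange_defect hP (u := lorentzW P.lor) (v := lorentzWstar P.lor)
        (N := N) hl hr ?_ ?_ ?_ A B K L i
      · intro A K C M
        simp only [map_mul, parity_w, parity_wstar, ite_and, ite_mul, one_mul, zero_mul, neg_mul]
      · intro A K C M
        simp only [map_mul, parity_w, parity_wstar, ite_and, ite_mul, one_mul, zero_mul, mul_neg]
      · intro A B K L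
        simp only [lorentzToPoincare_wstar, lorentzToPoincare_w]
        exact (intertwines_affW P).exchange (intertwines_affWstar P)
          (x := fun A B C D => P.lor.X (A, B) (C, D)) (lorentzRep_poincareW P).X A B K L
    · simp [PoincareDatum.affW, PoincareDatum.affWstar, Matrix.sum_apply, Matrix.mul_apply,
        Fintype.sum_sum_type, Matrix.algebraMap_matrix_apply, -Fin.sum_univ_two,
]

/-! ### `R` and `Z` as values of `Λ`; Yang–Baxter, `R`–`Z` exchange and reality. -/

section

theorem sum_V_mul_Vinv (p p' : Fin 2 × Fin 2) :
    ∑ c, V p c * Vinv c p' = if p = p' then 1 else 0 := by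
  have := congrFun (congrFun V_mul_Vinv p) p'
  simpa only [Matrix.mul_apply, Matrix.one_apply] using this

theorem sum_Vinv_mul_V (i j : Fin 4) :
    ∑ p, Vinv i p * V p j = if i = j then 1 else 0 := by
  have := congrFun (congrFun Vinv_mul_V i) j
  simpa only [Matrix.mul_apply, Matrix.one_apply] using this

theorem lambda_eq_sum_pairs {F : Type} [Ring F] [Algebra ℂ F] (w ws : Fin 2 → Fin 2 → F)
    (i j : Fin 4) : lambda w ws i j =
      ∑ p : Fin 2 × Fin 2, ∑ p' : Fin 2 × Fin 2, (Vinv i p * V p' j) • (w p.1 p'.1 * ws p.2 p'.2) := by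
  simp only [lambda, Fintype.sum_prod_type]

/-- Matrix multiplication of two matrices `lambda` with respect to a bilinear pairing. -/
theorem sum_lambda_lambda {F G H : Type} [Ring F] [Algebra ℂ F] [Ring G] [Algebra ℂ G]
    [AddCommGroup H] [Module ℂ H] (β : F →ₗ[ℂ] G →ₗ[ℂ] H) (u us : Fin 2 → Fin 2 → F)
    (v vs : Fin 2 → Fin 2 → G) (k l : Fin 4) :
    ∑ c, β (lambda u us k c) (lambda v vs c l) =
      ∑ p : Fin 2 × Fin 2, ∑ p' : Fin 2 × Fin 2, (Vinv k p * V p' l) •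
        ∑ r : Fin 2 × Fin 2, β (u p.1 r.1 * us p.2 r.2) (v r.1 p'.1 * vs r.2 p'.2) := by
  simp only [lambda_eq_sum_pairs, map_sum, map_smul, LinearMap.sum_apply, LinearMap.smul_apply,
    Finset.smul_sum, smul_smul]
  calc _ = ∑ p : Fin 2 × Fin 2, ∑ p' : Fin 2 × Fin 2, ∑ r : Fin 2 × Fin 2, ∑ r' : Fin 2 × Fin 2,
        ∑ c, (Vinv k p * V p' l * (V r c * Vinv c r')) •
          β (u p.1 r.1 * us p.2 r.2) (v r'.1 p'.1 * vs r'.2 p'.2) := by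
        refine (Finset.sum_congr rfl fun c _ => sum_comm_pairs _).trans ?_
        rw [Finset.sum_comm]
        refine Finset.sum_congr rfl fun p _ => ?_
        rw [sum_comm_pairs, Finset.sum_comm]
        refine Finset.sum_congr rfl fun p' _ => ?_
        refine (Finset.sum_congr rfl fun r _ => Finset.sum_comm).trans ?_
        rw [Finset.sum_comm]
        refine Finset.sum_congr rfl fun r _ => Finset.sum_congr rfl fun r' _ =>
          Finset.sum_congr rfl fun c _ => ?_
        rw [mul_comm (V r c), mul_mul_mul_comm, mul_comm (Vinv c r'), mul_mul_mul_comm]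
    _ = _ := by
        simp only [← Finset.sum_smul, ← Finset.mul_sum, sum_V_mul_Vinv, mul_ite, mul_one, mul_zero,
          ite_smul, zero_smul, Finset.sum_ite_eq, Finset.mem_univ, if_true]

/-- An entry of `Λ` is a combination of words `w w*`, and the matrix product over the vector index
collapses to one over spinor indices since `V V⁻¹ = 1`; then `Intertwines.word` applies. -/
theorem Intertwines.lambda {F n : Type} [Ring F] [Algebra ℂ F] [Fintype n] [DecidableEq n]
    {U : Matrix n n F} {w ws : Fin 2 → Fin 2 → F} {ρ τ : Fin 2 → Fin 2 → Matrix n n ℂ}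
    (h : Intertwines U w ρ) (h' : Intertwines U ws τ) (k l : Fin 4) :
    U * ∑ c, Matrix.scalar n (lambda w ws k c) * constMat F (lambda ρ τ c l) =
      (∑ c, constMat F (lambda ρ τ k c) * Matrix.scalar n (lambda w ws c l)) * U := by
  let σ : F →ₗ[ℂ] Matrix n n F := (Matrix.scalarAlgHom n ℂ).toLinearMap
  have hσ : ∀ x, σ x = Matrix.scalar n x := fun x => rfl
  have h1 := sum_lambda_lambda ((LinearMap.mul ℂ (Matrix n n F)).compl₁₂ σ
    (constMat F).toLinearMap) w ws ρ τ k l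
  have h2 := sum_lambda_lambda ((LinearMap.mul ℂ (Matrix n n F)).compl₁₂
    (constMat F).toLinearMap σ) ρ τ w ws k l
  simp only [LinearMap.compl₁₂_apply, LinearMap.mul_apply', AlgHom.toLinearMap_apply, hσ] at h1 h2
  rw [h1, h2]
  simp only [Matrix.mul_sum, Matrix.sum_mul, Matrix.mul_smul, Matrix.smul_mul]
  refine Finset.sum_congr rfl fun p _ => Finset.sum_congr rfl fun p' _ => ?_
  have := h.word h' p.1 p'.1 p.2 p'.2
  simp only [Fintype.sum_prod_type, Matrix.mul_sum, Matrix.sum_mul] at this ⊢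
  rw [this]

theorem mid_mul_apply {α : Type} (m : Matrix (Fin 2 × Fin 2) (Fin 2 × Fin 2) ℂ)
    (n : Matrix ((Fin 2 × Fin 2) × (Fin 2 × Fin 2)) α ℂ) (M N A B : Fin 2) (p : α) :
    (mid m * n) ((M, N), (A, B)) p = ∑ S, ∑ U, m (N, A) (S, U) * n ((M, S), (U, B)) p := by
  simp only [mid, Matrix.mul_apply, Matrix.of_apply, Fintype.sum_prod_type]
  simp [ite_and, -Fin.sum_univ_two]

theorem mul_mid_apply {α : Type} (m : Matrix (Fin 2 × Fin 2) (Fin 2 × Fin 2) ℂ)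
    (n : Matrix α ((Fin 2 × Fin 2) × (Fin 2 × Fin 2)) ℂ) (C D K L : Fin 2) (p : α) :
    (n * mid m) p ((C, D), (K, L)) = ∑ S, ∑ U, n p ((C, S), (U, L)) * m (S, U) (D, K) := by
  simp only [mid, Matrix.mul_apply, Matrix.of_apply, Fintype.sum_prod_type]
  simp [ite_and, -Fin.sum_univ_two]

theorem mid_mul_mid (m n : Matrix (Fin 2 × Fin 2) (Fin 2 × Fin 2) ℂ) :
    mid m * mid n = mid (m * n) := by
  ext ⟨⟨M, N⟩, ⟨A, B⟩⟩ ⟨⟨C, D⟩, ⟨K, L⟩⟩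
  rw [mid_mul_apply]
  simp only [mid, Matrix.of_apply, Matrix.mul_apply, Fintype.sum_prod_type]
  split_ifs <;> simp

theorem mid_one : mid 1 = 1 := by
  ext ⟨⟨M, N⟩, ⟨A, B⟩⟩ ⟨⟨C, D⟩, ⟨K, L⟩⟩
  simp only [mid, Matrix.of_apply, Matrix.one_apply, Prod.mk.injEq]
  split_ifs <;> simp_all

namespace PoincareDatum

variable (P : PoincareDatum)

/-- The braiding of vectors in the spinor basis. -/
def spinR : Matrix ((Fin 2 × Fin 2) × (Fin 2 × Fin 2)) ((Fin 2 × Fin 2) × (Fin 2 × Fin 2)) ℂ :=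
  mid P.lor.X * (P.L ⊗ₖ P.Ltilde) * mid P.lor.X⁻¹

theorem R_eq : P.R = (Vinv ⊗ₖ Vinv) * P.spinR * (V ⊗ₖ V) := by
  simp only [R, spinR, Matrix.mul_assoc]

theorem spinR_apply (p p' r r' : Fin 2 × Fin 2) :
    P.spinR (p, p') (r, r') = (P.spinW p'.1 r.1 * P.spinWstar p'.2 r.2) p r' := by
  obtain ⟨M, N⟩ := p
  obtain ⟨A, B⟩ := p'
  obtain ⟨C, D⟩ := r
  obtain ⟨K, L⟩ := r'
  simp only [spinR, mul_mid_apply, mid_mul_apply, Matrix.kronecker_apply]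
  simp only [Matrix.mul_apply, Fintype.sum_prod_type, spinW_apply, spinWstar_apply]
  simp only [Fin.sum_univ_two]
  ring

theorem lambda_vec (k l : Fin 4) (i j : Fin 4) :
    lambda P.vecW P.vecWstar k l i j = P.R (i, k) (l, j) := by
  have h : ∀ p r : Fin 2 × Fin 2, (P.vecW p.1 r.1 * P.vecWstar p.2 r.2) i j =
      ∑ p', ∑ r', Vinv i p' * P.spinR (p', p) (r, r') * V r' j := by
    intro p r
    have : P.vecW p.1 r.1 * P.vecWstar p.2 r.2 =
        Vinv * (P.spinW p.1 r.1 * P.spinWstar p.2 r.2) * V :=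
      (map_mul vectorBasis _ _).symm
    rw [this, Matrix.mul_apply]
    simp only [Matrix.mul_apply (M := Vinv), Finset.sum_mul, spinR_apply]
    rw [Finset.sum_comm]
  rw [lambda_eq_sum_pairs]
  simp only [Matrix.sum_apply, Matrix.smul_apply, h, R_eq]
  simp only [Matrix.mul_apply, Matrix.kronecker_apply, Finset.sum_mul, Finset.mul_sum, smul_eq_mul, Fintype.sum_prod_type (α₁ := Fin 2 × Fin 2) (α₂ := Fin 2 × Fin 2)]
  rw [Finset.sum_comm]
  refine Finset.sum_congr rfl fun r _ => ?_
  refine (Finset.sum_congr rfl fun p _ => Finset.sum_comm).trans ?_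
  rw [Finset.sum_comm]
  refine Finset.sum_congr rfl fun r' _ => ?_
  rw [Finset.sum_comm]
  refine Finset.sum_congr rfl fun p' _ => Finset.sum_congr rfl fun p _ => ?_
  ring

theorem L_mul_L_eq : P.L * P.L = P.lor.q • 1 := by
  ext ⟨A, B⟩ ⟨C, D⟩
  simpa only [Matrix.mul_apply, Fintype.sum_prod_type, Matrix.smul_apply, Matrix.one_apply,
    smul_eq_mul, Prod.mk.injEq] using P.L_mul_L A B C D

theorem Ltilde_mul_Ltilde : P.Ltilde * P.Ltilde = P.lor.q • 1 := by
  calc P.Ltilde * P.Ltilde = (P.lor.q * P.lor.q) •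
        (flip * (P.L * (flip * flip) * P.L) * flip) := by
        simp only [Ltilde, Matrix.smul_mul, Matrix.mul_smul, smul_smul, Matrix.mul_assoc]
    _ = _ := by
        rw [LorentzType.flip_mul_flip, Matrix.mul_one, L_mul_L_eq, Matrix.mul_smul,
          Matrix.smul_mul, Matrix.mul_one, LorentzType.flip_mul_flip, P.lor.q_mul_q, one_smul]

/-- The inner `X⁻¹` and `X` cancel, and `L²` and `L̃²` each give `q`, with `q² = 1`. -/
theorem spinR_mul_spinR : P.spinR * P.spinR = 1 := by
  calc P.spinR * P.spinR = mid P.lor.X * ((P.L ⊗ₖ P.Ltilde) *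
        (mid P.lor.X⁻¹ * mid P.lor.X) * (P.L ⊗ₖ P.Ltilde)) * mid P.lor.X⁻¹ := by
        simp only [spinR, Matrix.mul_assoc]
    _ = _ := by
        rw [mid_mul_mid, P.lor.X_inv_mul, mid_one, Matrix.mul_one, ← Matrix.mul_kronecker_mul,
          L_mul_L_eq, Ltilde_mul_Ltilde, Matrix.smul_kronecker, Matrix.kronecker_smul, smul_smul,
          P.lor.q_mul_q, one_smul, Matrix.one_kronecker_one, Matrix.mul_one, mid_mul_mid,
          P.lor.X_mul_inv, mid_one]

theorem R_mul_R : P.R * P.R = 1 := by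
  calc P.R * P.R = (Vinv ⊗ₖ Vinv) * (P.spinR * ((V ⊗ₖ V) * (Vinv ⊗ₖ Vinv)) * P.spinR) *
        (V ⊗ₖ V) := by simp only [R_eq, Matrix.mul_assoc]
    _ = _ := by
        rw [← Matrix.mul_kronecker_mul, V_mul_Vinv, Matrix.one_kronecker_one, Matrix.mul_one,
          spinR_mul_spinR, Matrix.mul_one, ← Matrix.mul_kronecker_mul, Vinv_mul_V,
          Matrix.one_kronecker_one]

theorem lambda_vec_eq (k l : Fin 4) :
    lambda P.vecW P.vecWstar k l = Matrix.of fun i j => P.R (i, k) (l, j) := by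
  ext i j
  exact P.lambda_vec k l i j

theorem affW_mul_affWstar (A B C D : Fin 2) : P.affW A C * P.affWstar B D =
    Matrix.fromBlocks (P.vecW A C * P.vecWstar B D)
      (Matrix.of fun i _ => ∑ j, P.vecW A C i j * P.HVtilde (j, B) D +
        P.HV (i, A) C * if B = D then 1 else 0) 0
      (Matrix.of fun _ _ => (if A = C then 1 else 0) * if B = D then 1 else 0) := by
  refine blocks_ext (fun i j => ?_) (fun i => ?_) (fun j => ?_) ?_
  all_goals simp [affW, affWstar, Matrix.mul_apply, Fintype.sum_sum_type]

theorem lambda_aff (k l : Fin 4) :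
    lambda P.affW P.affWstar k l =
      Matrix.fromBlocks (Matrix.of fun i j => P.R (i, k) (l, j)) (Matrix.of fun i _ => P.Z (i, k) l)
        0 (Matrix.of fun _ _ => if k = l then 1 else 0) := by
  refine blocks_ext (fun i j => ?_) (fun i => ?_) (fun j => ?_) ?_
  · rw [Matrix.fromBlocks_apply₁₁, Matrix.of_apply, ← lambda_vec]
    simp only [lambda, affW_mul_affWstar, Matrix.sum_apply, Matrix.smul_apply,
      Matrix.fromBlocks_apply₁₁]
  · simp only [lambda, affW_mul_affWstar, Matrix.sum_apply, Matrix.smul_apply,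
      Matrix.fromBlocks_apply₁₂, Matrix.of_apply, Z, vecW_apply]
    refine Finset.sum_congr rfl fun A _ => Finset.sum_congr rfl fun B _ =>
      Finset.sum_congr rfl fun C _ => Finset.sum_congr rfl fun D _ => ?_
    rw [smul_eq_mul]
    ring
  · simp only [lambda, affW_mul_affWstar, Matrix.sum_apply, Matrix.smul_apply,
      Matrix.fromBlocks_apply₂₁, Matrix.zero_apply, smul_zero, Finset.sum_const_zero]
  · rw [Matrix.fromBlocks_apply₂₂, Matrix.of_apply, ← sum_Vinv_mul_V, Fintype.sum_prod_type]
    simp only [lambda, affW_mul_affWstar, Matrix.sum_apply, Matrix.smul_apply,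
      Matrix.fromBlocks_apply₂₂, Matrix.of_apply, smul_eq_mul]
    simp [-Fin.sum_univ_two]

variable {P}

/-- `Λ` intertwines `w` and `w*` with their vector matrices, hence words in them, and `Λ` evaluated
in the vector representation is `R`. Applied to the vector representation itself this is
Yang–Baxter; the off-diagonal block for the affine one links `R` and `Z`. -/
theorem lambda_exchange {n : Type} [Fintype n] [DecidableEq n] {w ws : Fin 2 → Fin 2 → Matrix n n ℂ}
    (h : LorentzRep P.lor w ws) (i k l m : Fin 4) :
    ∑ c, ∑ j, P.R (j, c) (l, m) • (lambda w ws i j * lambda w ws k c) =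
      ∑ c, ∑ j, P.R (i, k) (c, j) • (lambda w ws c l * lambda w ws j m) := by
  have h1 := congrFun (congrFun (h.intertwines_lambda_w.lambda h.intertwines_lambda_ws k l) i) m
  rw [Matrix.mul_sum, Matrix.sum_mul, Matrix.sum_apply, Matrix.sum_apply] at h1
  simp only [Matrix.mul_apply, lambda_vec_eq, constMat_apply, Matrix.of_apply,
    Matrix.scalar_apply] at h1
  simp [← Algebra.smul_def, Matrix.diagonal_apply] at h1
  simpa only [← Algebra.commutes, ← Algebra.smul_def, mul_smul_comm] using h1

theorem yang_baxter (P : PoincareDatum) (a i k l m b : Fin 4) :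
    ∑ c, ∑ j, ∑ p, P.R (j, c) (l, m) * (P.R (a, i) (j, p) * P.R (p, k) (c, b)) =
      ∑ c, ∑ j, ∑ p, P.R (i, k) (c, j) * (P.R (a, c) (l, p) * P.R (p, j) (m, b)) := by
  have h := congrFun (congrFun (lambda_exchange P.lorentzRep_vec i k l m) a) b
  simpa only [lambda_vec_eq, Matrix.sum_apply, Matrix.smul_apply, Matrix.mul_apply,
    Matrix.of_apply, smul_eq_mul, Finset.mul_sum] using h

theorem R_Z_exchange (hP : P.Admissible) (a i k l m : Fin 4) :
    ∑ c, ∑ j, P.R (j, c) (l, m) *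
        (∑ p, P.R (a, i) (j, p) * P.Z (p, k) c + P.Z (a, i) j * if k = c then 1 else 0) =
      ∑ c, ∑ j, P.R (i, k) (c, j) *
        (∑ p, P.R (a, c) (l, p) * P.Z (p, j) m + P.Z (a, c) l * if j = m then 1 else 0) := by
  have h := congrFun (congrFun (lambda_exchange (lorentzRep_aff hP) i k l m) (Sum.inl a))
    (Sum.inr ())
  simpa [lambda_aff, Matrix.sum_apply, Matrix.mul_apply, Fintype.sum_sum_type,
    Fin.sum_univ_two] using h

/-- In the off-diagonal block, the formula for `H̃` is exactly what cancels the conjugate of `H`. -/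
theorem conj_affW_mul_affWstar (A B : Fin 2) :
    ∑ C, (P.affW A C).map (starRingEnd ℂ) * P.affWstar C B = if A = B then 1 else 0 := by
  refine blocks_ext (fun i k => ?_) (fun i => ?_) (fun j => ?_) ?_
  · have h := P.conj_vecW_mul A B i k
    have h' : (if A = B then 1 else 0 : Matrix (Fin 4 ⊕ Unit) (Fin 4 ⊕ Unit) ℂ)
        (Sum.inl i) (Sum.inl k) = if A = B ∧ i = k then 1 else 0 := by
      split_ifs <;> simp_all [Matrix.one_apply]
    rw [h', ← h, Matrix.sum_apply]
    simp [affW, affWstar, Matrix.mul_apply, Fintype.sum_sum_type, -Fin.sum_univ_two]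
  · have h' : (if A = B then 1 else 0 : Matrix (Fin 4 ⊕ Unit) (Fin 4 ⊕ Unit) ℂ)
        (Sum.inl i) (Sum.inr ()) = 0 := by
      split_ifs <;> simp
    have h : ∑ C, ∑ j, starRingEnd ℂ (P.vecW A C i j) * P.HVtilde (j, C) B =
        - starRingEnd ℂ (P.HV (i, A) B) := by
      simp only [HVtilde_apply, mul_neg, Finset.sum_neg_distrib, Finset.mul_sum, ← mul_assoc]
      rw [sum_comm_pairs]
      simp only [← Finset.sum_mul, P.conj_vecW_mul, ite_and]
      simp [-Fin.sum_univ_two]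
    rw [h', Matrix.sum_apply]
    simp only [affW, affWstar, Matrix.mul_apply, Fintype.sum_sum_type, Finset.sum_add_distrib,
      Matrix.map_apply, Matrix.fromBlocks_apply₁₁, Matrix.fromBlocks_apply₁₂,
      Matrix.fromBlocks_apply₂₂, Matrix.of_apply, h]
    simp [-Fin.sum_univ_two]
  · rw [Matrix.sum_apply]
    split_ifs <;> simp [affW, affWstar, Matrix.mul_apply, Fintype.sum_sum_type]
  · rw [Matrix.sum_apply]
    split_ifs with h <;>
    simp [affW, affWstar, Matrix.mul_apply, Fintype.sum_sum_type, -Fin.sum_univ_two, h]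

/-- Viewed as `2 × 2` matrices over the ring of complex `5 × 5` matrices, the two families are
inverse on one side by the conjugate of the preceding identity, hence on both. -/
theorem conj_affWstar_mul_affW (A B : Fin 2) :
    ∑ C, (P.affWstar A C).map (starRingEnd ℂ) * P.affW C B = if A = B then 1 else 0 := by
  let M : Matrix (Fin 2) (Fin 2) (Matrix (Fin 4 ⊕ Unit) (Fin 4 ⊕ Unit) ℂ) :=
    Matrix.of fun A C => P.affW A C
  let N : Matrix (Fin 2) (Fin 2) (Matrix (Fin 4 ⊕ Unit) (Fin 4 ⊕ Unit) ℂ) :=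
    Matrix.of fun A C => (P.affWstar A C).map (starRingEnd ℂ)
  have h : M * N = 1 := by
    ext1 A B
    have h := congrArg (starRingEnd ℂ).mapMatrix (conj_affW_mul_affWstar (P := P) A B)
    rw [map_sum] at h
    simp only [map_mul, RingHom.mapMatrix_apply] at h
    have h1 : ∀ m : Matrix (Fin 4 ⊕ Unit) (Fin 4 ⊕ Unit) ℂ,
        (m.map (starRingEnd ℂ)).map (starRingEnd ℂ) = m := by
      intro m
      ext i j
      exact Complex.conj_conj _
    simp only [h1] at h
    rw [Matrix.mul_apply, Matrix.one_apply]
    refine h.trans ?_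
    split_ifs
    · exact map_one (starRingEnd ℂ).mapMatrix
    · exact map_zero (starRingEnd ℂ).mapMatrix
  have h2 : N * M = 1 := mul_eq_one_comm.mp h
  have h' := congrFun (congrFun h2 A) B
  rw [Matrix.mul_apply, Matrix.one_apply] at h'
  exact h'

/-- `Λ` is selfadjoint, so its conjugate in the affine representation is a product in reversed
order; the inner pair cancels first and then the outer one. The blocks of this identity contain the
reality of `R` and of `Z`. -/
theorem conj_lambda_aff_mul (k l : Fin 4) :
    ∑ c, (lambda P.affW P.affWstar k c).map (starRingEnd ℂ) * lambda P.affW P.affWstar c l =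
      if k = l then 1 else 0 := by
  -- Conjugation swaps the two spinor indices of `V`, so the reversed product is again of the form
  -- `lambda`, but over the opposite ring; there the general product formula can be used.
  have h0 : ∀ k c, (lambda P.affW P.affWstar k c).map (starRingEnd ℂ) = MulOpposite.unop
      (lambda (fun A B => MulOpposite.op ((P.affWstar A B).map (starRingEnd ℂ)))
        (fun A B => MulOpposite.op ((P.affW A B).map (starRingEnd ℂ))) k c) := by
    intro k c
    ext i j
    simp only [lambda, Matrix.map_apply, Matrix.sum_apply, Matrix.smul_apply, Matrix.mul_apply,
      map_sum, map_mul, smul_eq_mul, conj_V, conj_Vinv, MulOpposite.unop_smul, MulOpposite.unop_mul,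
      MulOpposite.unop_op, Finset.unop_sum]
    rw [Finset.sum_comm]
    refine Finset.sum_congr rfl fun _ _ => Finset.sum_congr rfl fun _ _ => ?_
    rw [Finset.sum_comm]
  have h := sum_lambda_lambda
    ((LinearMap.mul ℂ (Matrix (Fin 4 ⊕ Unit) (Fin 4 ⊕ Unit) ℂ)).comp
      (MulOpposite.opLinearEquiv ℂ).symm.toLinearMap)
    (fun A B => MulOpposite.op ((P.affWstar A B).map (starRingEnd ℂ)))
    (fun A B => MulOpposite.op ((P.affW A B).map (starRingEnd ℂ))) P.affW P.affWstar k l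
  simp only [LinearMap.comp_apply, LinearMap.mul_apply', LinearEquiv.coe_coe,
    MulOpposite.coe_opLinearEquiv_symm, MulOpposite.unop_mul, MulOpposite.unop_op] at h
  simp only [h0, h]
  have h1 : ∀ A B C D : Fin 2, ∑ r : Fin 2 × Fin 2, (P.affW B r.2).map (starRingEnd ℂ) *
      (P.affWstar A r.1).map (starRingEnd ℂ) * (P.affW r.1 C * P.affWstar r.2 D) =
      if A = C ∧ B = D then 1 else 0 := by
    intro A B C D
    rw [Fintype.sum_prod_type, Finset.sum_comm]
    calc _ = ∑ M, (P.affW B M).map (starRingEnd ℂ) * (∑ K, (P.affWstar A K).map (starRingEnd ℂ) *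
          P.affW K C) * P.affWstar M D := by
          simp only [Finset.mul_sum, Finset.sum_mul, mul_assoc]
      _ = _ := by
          rw [conj_affWstar_mul_affW]
          split_ifs with h2 h3 h3
          · simp only [mul_one]
            rw [conj_affW_mul_affWstar, if_pos h3.2]
          · simp only [mul_one]
            rw [conj_affW_mul_affWstar, if_neg fun h => h3 ⟨h2, h⟩]
          · exact absurd h3.1 h2
          · simp
  simp only [h1, ← Prod.ext_iff, smul_ite, smul_zero, Finset.sum_ite_eq, Finset.mem_univ, if_true,
    ← Finset.sum_smul, sum_Vinv_mul_V]
  split_ifs <;> simp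

theorem conj_R_mul_R (i k l m : Fin 4) :
    ∑ c, ∑ j, starRingEnd ℂ (P.R (i, k) (c, j)) * P.R (j, c) (l, m) =
      if k = l ∧ i = m then 1 else 0 := by
  have h := congrFun (congrFun (conj_lambda_aff_mul (P := P) k l) (Sum.inl i)) (Sum.inl m)
  have h' : (if k = l then 1 else 0 : Matrix (Fin 4 ⊕ Unit) (Fin 4 ⊕ Unit) ℂ)
      (Sum.inl i) (Sum.inl m) = if k = l ∧ i = m then 1 else 0 := by
    split_ifs <;> simp_all [Matrix.one_apply]
  rw [← h', ← h, Matrix.sum_apply]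
  simp [lambda_aff, Matrix.mul_apply, Fintype.sum_sum_type]

theorem conj_R_mul_Z (i k l : Fin 4) :
    ∑ c, ∑ j, starRingEnd ℂ (P.R (i, k) (c, j)) * P.Z (j, c) l + starRingEnd ℂ (P.Z (i, k) l) =
      0 := by
  have h := congrFun (congrFun (conj_lambda_aff_mul (P := P) k l) (Sum.inl i)) (Sum.inr ())
  have h' : (if k = l then 1 else 0 : Matrix (Fin 4 ⊕ Unit) (Fin 4 ⊕ Unit) ℂ)
      (Sum.inl i) (Sum.inr ()) = 0 := by
    split_ifs <;> simp
  rw [← h', ← h, Matrix.sum_apply]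
  simp [lambda_aff, Matrix.mul_apply, Fintype.sum_sum_type, Finset.sum_add_distrib]

theorem sum_R_mul_R (i j k l : Fin 4) :
    ∑ a, ∑ b, P.R (i, j) (a, b) * P.R (a, b) (k, l) = if i = k ∧ j = l then 1 else 0 := by
  have h := congrFun (congrFun P.R_mul_R (i, j)) (k, l)
  simpa only [Matrix.mul_apply, Fintype.sum_prod_type, Matrix.one_apply, Prod.mk.injEq] using h

/-- `conj_R_mul_R` makes the conjugate of `R`, up to flips, an inverse of `R`, and `R` is its own
inverse. -/
theorem conj_R (i k c j : Fin 4) : starRingEnd ℂ (P.R (i, k) (c, j)) = P.R (k, i) (j, c) := by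
  calc starRingEnd ℂ (P.R (i, k) (c, j)) = ∑ a, ∑ b, starRingEnd ℂ (P.R (i, k) (a, b)) *
        ∑ l, ∑ m, P.R (b, a) (l, m) * P.R (l, m) (j, c) := by
        simp only [sum_R_mul_R]
        simp [ite_and]
    _ = ∑ l, ∑ m, (∑ a, ∑ b, starRingEnd ℂ (P.R (i, k) (a, b)) * P.R (b, a) (l, m)) *
        P.R (l, m) (j, c) := by
        simp only [Finset.mul_sum, Finset.sum_mul, mul_assoc]
        rw [sum_comm_pairs]
    _ = _ := by simp [conj_R_mul_R, ite_and]

theorem conj_Z (i k l : Fin 4) :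
    starRingEnd ℂ (P.Z (i, k) l) = -∑ c, ∑ j, P.R (k, i) (j, c) * P.Z (j, c) l := by
  rw [eq_neg_of_add_eq_zero_right (conj_R_mul_Z i k l)]
  simp only [conj_R]

end PoincareDatum

end

/-! ### Complex matrices acting on vectors over an algebra, and tensor legs. -/

section

section Act

variable {α β γ F : Type} [Fintype β] [Fintype γ] [Ring F] [Algebra ℂ F]

/-- The action of a complex matrix on a vector with entries in a complex algebra. -/
def act (M : Matrix α β ℂ) (v : β → F) : α → F := fun a => ∑ b, M a b • v b

theorem act_act (M : Matrix α β ℂ) (N : Matrix β γ ℂ) (v : γ → F) :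
    act M (act N v) = act (M * N) v := by
  funext a
  simp only [act, Finset.smul_sum, smul_smul, Matrix.mul_apply, Finset.sum_smul]
  rw [Finset.sum_comm]

theorem act_add (M : Matrix α β ℂ) (v w : β → F) : act M (v + w) = act M v + act M w := by
  funext a
  simp [act, Finset.sum_add_distrib]

theorem act_sub (M : Matrix α β ℂ) (v w : β → F) : act M (v - w) = act M v - act M w := by
  funext a
  simp [act, smul_sub]

theorem act_zero (M : Matrix α β ℂ) : act M (0 : β → F) = 0 := by
  funext a
  simp [act]

theorem zero_act (v : β → F) : act (0 : Matrix α β ℂ) v = 0 := by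
  funext a
  simp [act]

theorem add_act (M N : Matrix α β ℂ) (v : β → F) : act (M + N) v = act M v + act N v := by
  funext a
  simp [act, add_smul, Finset.sum_add_distrib]

theorem sub_act (M N : Matrix α β ℂ) (v : β → F) : act (M - N) v = act M v - act N v := by
  funext a
  simp [act, sub_smul]

theorem one_act [Fintype α] [DecidableEq α] (v : α → F) : act (1 : Matrix α α ℂ) v = v := by
  funext a
  simp [act, Matrix.one_apply]

end Act

section Legs

/-- The action of a matrix on the first two of three tensor factors. -/
def leg12 (M : Matrix (Fin 4 × Fin 4) (Fin 4 × Fin 4) ℂ) :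
    Matrix (Fin 4 × Fin 4 × Fin 4) (Fin 4 × Fin 4 × Fin 4) ℂ :=
  Matrix.of fun p p' => if p.2.2 = p'.2.2 then M (p.1, p.2.1) (p'.1, p'.2.1) else 0

/-- The action of a matrix on the last two of three tensor factors. -/
def leg23 (M : Matrix (Fin 4 × Fin 4) (Fin 4 × Fin 4) ℂ) :
    Matrix (Fin 4 × Fin 4 × Fin 4) (Fin 4 × Fin 4 × Fin 4) ℂ :=
  Matrix.of fun p p' => if p.1 = p'.1 then M p.2 p'.2 else 0

/-- The matrix `Z ⊗ 1`. -/
def tensorOne (M : Matrix (Fin 4 × Fin 4) (Fin 4) ℂ) :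
    Matrix (Fin 4 × Fin 4 × Fin 4) (Fin 4 × Fin 4) ℂ :=
  Matrix.of fun p p' => if p.2.2 = p'.2 then M (p.1, p.2.1) p'.1 else 0

/-- The matrix `1 ⊗ Z`. -/
def oneTensor (M : Matrix (Fin 4 × Fin 4) (Fin 4) ℂ) :
    Matrix (Fin 4 × Fin 4 × Fin 4) (Fin 4 × Fin 4) ℂ :=
  Matrix.of fun p p' => if p.1 = p'.1 then M p.2 p'.2 else 0

variable {α : Type} (M N : Matrix (Fin 4 × Fin 4) (Fin 4 × Fin 4) ℂ)
  (Z : Matrix (Fin 4 × Fin 4) (Fin 4) ℂ)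

theorem leg12_mul_apply (K : Matrix (Fin 4 × Fin 4 × Fin 4) α ℂ) (i j k : Fin 4) (a : α) :
    (leg12 M * K) (i, j, k) a = ∑ p, ∑ r, M (i, j) (p, r) * K (p, r, k) a := by
  simp [leg12, Matrix.mul_apply, Fintype.sum_prod_type]

theorem leg23_mul_apply (K : Matrix (Fin 4 × Fin 4 × Fin 4) α ℂ) (i j k : Fin 4) (a : α) :
    (leg23 M * K) (i, j, k) a = ∑ p, ∑ r, M (j, k) (p, r) * K (i, p, r) a := by
  simp [leg23, Matrix.mul_apply, Fintype.sum_prod_type]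

theorem tensorOne_mul_apply (K : Matrix (Fin 4 × Fin 4) α ℂ) (i j k : Fin 4) (a : α) :
    (tensorOne Z * K) (i, j, k) a = ∑ p, Z (i, j) p * K (p, k) a := by
  simp [tensorOne, Matrix.mul_apply, Fintype.sum_prod_type]

theorem oneTensor_mul_apply (K : Matrix (Fin 4 × Fin 4) α ℂ) (i j k : Fin 4) (a : α) :
    (oneTensor Z * K) (i, j, k) a = ∑ p, Z (j, k) p * K (i, p) a := by
  simp [oneTensor, Matrix.mul_apply, Fintype.sum_prod_type]

theorem leg12_one : leg12 1 = 1 := by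
  ext ⟨i, j, k⟩ ⟨i', j', k'⟩
  simp only [leg12, Matrix.of_apply, Matrix.one_apply, Prod.mk.injEq]
  split_ifs <;> simp_all

theorem leg23_one : leg23 1 = 1 := by
  ext ⟨i, j, k⟩ ⟨i', j', k'⟩
  simp only [leg23, Matrix.of_apply, Matrix.one_apply, Prod.mk.injEq]
  split_ifs <;> simp_all

theorem leg12_sub : leg12 (M - N) = leg12 M - leg12 N := by
  ext
  simp only [leg12, Matrix.of_apply, Matrix.sub_apply]
  split_ifs <;> simp

theorem leg23_sub : leg23 (M - N) = leg23 M - leg23 N := by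
  ext
  simp only [leg23, Matrix.of_apply, Matrix.sub_apply]
  split_ifs <;> simp

theorem leg12_mul : leg12 (M * N) = leg12 M * leg12 N := by
  ext ⟨i, j, k⟩ ⟨i', j', k'⟩
  rw [leg12_mul_apply]
  simp only [leg12, Matrix.of_apply, Matrix.mul_apply, Fintype.sum_prod_type]
  split_ifs <;> simp

theorem leg12_mul_oneTensor :
    leg12 M * oneTensor Z = Matrix.of fun p p' : _ × _ =>
      ∑ r, M (p.1, p.2.1) (p'.1, r) * Z (r, p.2.2) p'.2 := by
  ext ⟨i, j, k⟩ ⟨i', j'⟩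
  rw [leg12_mul_apply]
  simp only [oneTensor, Matrix.of_apply, mul_ite, mul_zero]
  rw [Finset.sum_comm]
  simp

variable {F : Type} [Ring F] [Algebra ℂ F]

theorem leg12_act_apply (v : Fin 4 × Fin 4 × Fin 4 → F) (i j k : Fin 4) :
    act (leg12 M) v (i, j, k) = ∑ p, ∑ r, M (i, j) (p, r) • v (p, r, k) := by
  simp [leg12, act, Fintype.sum_prod_type]

theorem leg23_act_apply (v : Fin 4 × Fin 4 × Fin 4 → F) (i j k : Fin 4) :
    act (leg23 M) v (i, j, k) = ∑ p, ∑ r, M (j, k) (p, r) • v (i, p, r) := by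
  simp [leg23, act, Fintype.sum_prod_type]

theorem tensorOne_act_apply (v : Fin 4 × Fin 4 → F) (i j k : Fin 4) :
    act (tensorOne Z) v (i, j, k) = ∑ p, Z (i, j) p • v (p, k) := by
  simp [tensorOne, act, Fintype.sum_prod_type]

theorem oneTensor_act_apply (v : Fin 4 × Fin 4 → F) (i j k : Fin 4) :
    act (oneTensor Z) v (i, j, k) = ∑ p, Z (j, k) p • v (i, p) := by
  simp [oneTensor, act, Fintype.sum_prod_type]

end Legs

namespace PoincareDatum

theorem leg_yang_baxter (P : PoincareDatum) :
    leg12 P.R * leg23 P.R * leg12 P.R = leg23 P.R * leg12 P.R * leg23 P.R := by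
  ext ⟨a, i, k⟩ ⟨l, m, b⟩
  have h := P.yang_baxter a i k l m b
  rw [Matrix.mul_assoc, Matrix.mul_assoc, leg12_mul_apply, leg23_mul_apply]
  simp only [leg12_mul_apply, leg23_mul_apply, Finset.mul_sum]
  simp only [leg12, leg23, Matrix.of_apply, mul_ite, mul_zero, Finset.sum_ite_irrel,
    Finset.sum_ite_eq', Finset.mem_univ, if_true, Finset.sum_const_zero]
  rw [← h]
  refine (Finset.sum_congr rfl fun j _ => Finset.sum_comm).trans ?_
  rw [Finset.sum_comm]
  refine Finset.sum_congr rfl fun c _ => Finset.sum_congr rfl fun j _ =>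
    Finset.sum_congr rfl fun p _ => ?_
  rw [← mul_assoc, mul_comm]

/-- The matrix `(R ⊗ 1)(1 ⊗ Z) + Z ⊗ 1`. -/
def RZ (P : PoincareDatum) : Matrix (Fin 4 × Fin 4 × Fin 4) (Fin 4 × Fin 4) ℂ :=
  leg12 P.R * oneTensor P.Z + tensorOne P.Z

/-- The index-free form of `R_Z_exchange`. It serves both the linear part of the relations for the
derivative matrices and the commutation of derivatives. -/
theorem RZ_mul_R {P : PoincareDatum} (hP : P.Admissible) : P.RZ * P.R = leg23 P.R * P.RZ := by
  ext ⟨a, i, k⟩ ⟨l, m⟩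
  have h := R_Z_exchange hP a i k l m
  rw [leg23_mul_apply, RZ, leg12_mul_oneTensor]
  simp only [tensorOne, Matrix.mul_apply, Matrix.add_apply, Matrix.of_apply, Fintype.sum_prod_type]
  calc _ = _ := by
        rw [Finset.sum_comm]
        refine Finset.sum_congr rfl fun c _ => Finset.sum_congr rfl fun j _ => ?_
        rw [mul_comm, mul_ite, mul_one, mul_zero]
    _ = _ := h
    _ = _ := by
        simp only [mul_ite, mul_one, mul_zero]

end PoincareDatum

end

/-! ### Adjoint relations, reality of `T` and the universal property of `𝒞`. -/

/-- The defining relation of a quantum Minkowski space, for elements of an algebra. -/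
def minkowskiRelation {F : Type} [Ring F] [Algebra ℂ F] (P : PoincareDatum) (x : Fin 4 → F) :
    Fin 4 × Fin 4 → F :=
  act (P.R - 1) ((fun p => x p.1 * x p.2) - act P.Z x + fun p => algebraMap ℂ F (P.T p.1 p.2))

theorem minkowskiFreeRelations_eq (P : PoincareDatum) :
    minkowskiFreeRelations P = Set.range (minkowskiRelation P (FreeAlgebra.ι ℂ)) := by
  ext p
  simp only [minkowskiFreeRelations, Set.mem_ofPred_eq, Set.mem_range, Prod.exists,
    minkowskiRelation, act, Fintype.sum_prod_type, Pi.add_apply, Pi.sub_apply, eq_comm]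

theorem map_minkowskiRelation {F F' : Type} [Ring F] [Algebra ℂ F] [Ring F'] [Algebra ℂ F']
    (P : PoincareDatum) (φ : F →ₐ[ℂ] F') (x : Fin 4 → F) (p : Fin 4 × Fin 4) :
    φ (minkowskiRelation P x p) = minkowskiRelation P (fun i => φ (x i)) p := by
  simp only [minkowskiRelation, act, map_sum, map_smul, Pi.add_apply, Pi.sub_apply, map_add,
    map_sub, map_mul, AlgHom.commutes]

theorem minkowskiRelation_coord (P : PoincareDatum) (p : Fin 4 × Fin 4) :
    minkowskiRelation P (coord P) p = 0 := by
  have h := (StarPres.mk_relation (σ := id) (P := minkowskiFreeRelations P)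
    (p := minkowskiRelation P (FreeAlgebra.ι ℂ) p)
    (by rw [minkowskiFreeRelations_eq]; exact ⟨p, rfl⟩)).1
  rwa [map_minkowskiRelation] at h

/-- The defect of reality of `T`. -/
def realityDefect (P : PoincareDatum) : Fin 4 × Fin 4 → ℂ :=
  act (P.R - 1) fun p => starRingEnd ℂ (P.T p.2 p.1) - P.T p.1 p.2

/-- A conjugate-linear antimultiplicative map fixing `x` maps the relations to relations, up to
the defect of reality of `T`. -/
theorem antilinear_minkowskiRelation {F : Type} [Ring F] [Algebra ℂ F] (P : PoincareDatum)
    (x : Fin 4 → F) (A : F →+ F) (hs : ∀ (c : ℂ) a, A (c • a) = starRingEnd ℂ c • A a)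
    (hm : ∀ a b, A (a * b) = A b * A a) (h1 : A 1 = 1) (hx : ∀ i, A (x i) = x i)
    (p : Fin 4 × Fin 4) : A (minkowskiRelation P x p) =
      minkowskiRelation P x p.swap + algebraMap ℂ _ (realityDefect P p.swap) := by
  have hc : ∀ c, A (algebraMap ℂ F c) = algebraMap ℂ F (starRingEnd ℂ c) := by
    intro c
    rw [Algebra.algebraMap_eq_smul_one, hs, h1, Algebra.algebraMap_eq_smul_one]
  have hR : ∀ p p', starRingEnd ℂ ((P.R - 1) p p') = (P.R - 1) p.swap p'.swap := by
    rintro ⟨i, j⟩ ⟨k, l⟩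
    rw [Matrix.sub_apply, map_sub, PoincareDatum.conj_R, Matrix.sub_apply]
    simp [Matrix.one_apply, and_comm, apply_ite (starRingEnd ℂ)]
  have hZ : (fun p : Fin 4 × Fin 4 => ∑ m, starRingEnd ℂ (P.Z p.swap m) • x m) =
      - act (P.R * P.Z) x := by
    have hc : ∀ (p : Fin 4 × Fin 4) m, starRingEnd ℂ (P.Z p.swap m) = -(P.R * P.Z) p m := by
      rintro ⟨k, l⟩ m
      rw [Prod.swap_prod_mk, PoincareDatum.conj_Z, Finset.sum_comm, Matrix.mul_apply,
        Fintype.sum_prod_type]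
    funext p
    simp only [hc, act, Pi.neg_apply, neg_smul, Finset.sum_neg_distrib]
  have hA : A (minkowskiRelation P x p) = act (P.R - 1)
      ((fun p => x p.1 * x p.2) + act (P.R * P.Z) x +
        fun p => algebraMap ℂ _ (starRingEnd ℂ (P.T p.2 p.1))) p.swap := by
    rw [← sub_neg_eq_add _ (act _ _), ← hZ]
    simp only [minkowskiRelation, act, map_sum, hs, Pi.add_apply, Pi.sub_apply, map_add,
      map_sub, hm, hx, hc, hR]
    exact Fintype.sum_equiv (Equiv.prodComm _ _) _ _ fun _ => rfl
  -- Conjugating `Z` produced `-RZ`; the projection `R - 1` absorbs `R` with a sign, so the linear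
  -- term of the original relation reappears.
  have h2 : (P.R - 1) * (P.R * P.Z) = - ((P.R - 1) * P.Z) := by
    rw [← Matrix.mul_assoc, Matrix.sub_mul, P.R_mul_R, Matrix.one_mul, ← Matrix.neg_mul, neg_sub]
  have h3 : (fun p => algebraMap ℂ F (realityDefect P p)) =
      act (P.R - 1) (fun p => algebraMap ℂ _ (starRingEnd ℂ (P.T p.2 p.1))) -
        act (P.R - 1) (fun p => algebraMap ℂ _ (P.T p.1 p.2)) := by
    rw [← act_sub]
    funext p
    simp only [realityDefect, act, map_sum, smul_eq_mul, map_mul, map_sub, Algebra.smul_def,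
      Pi.sub_apply]
  rw [hA, congrFun h3 p.swap]
  simp only [minkowskiRelation, act_add, act_sub, act_act, h2, Pi.add_apply, Pi.sub_apply]
  have h4 : act (-((P.R - 1) * P.Z)) x =
      - act ((P.R - 1) * P.Z) x := by
    funext a
    simp [act]
  rw [h4, Pi.neg_apply]
  abel

theorem adj_minkowskiRelation (P : PoincareDatum) (p : Fin 4 × Fin 4) :
    adj id (minkowskiRelation P (FreeAlgebra.ι ℂ) p) =
      minkowskiRelation P (FreeAlgebra.ι ℂ) p.swap + algebraMap ℂ _ (realityDefect P p.swap) :=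
  antilinear_minkowskiRelation P (FreeAlgebra.ι ℂ) (AddMonoidHom.mk' (adj id) (adj_add id))
    (adj_smul id) (adj_mul id) ((adj_algebraMap id 1).trans (by simp)) (adj_gen id) p

/-- The adjoint of a relation differs from another relation by this scalar, so the scalar is zero in
`𝒞`; since `𝒞` is not the zero ring, it is zero in `ℂ`. -/
theorem realityDefect_eq_zero {P : PoincareDatum} (hP : P.Admissible) (p : Fin 4 × Fin 4) :
    realityDefect P p = 0 := by
  have := hP.minkowski_nontrivial
  have h1 := (StarPres.mk_relation (σ := id) (P := minkowskiFreeRelations P)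
    (p := minkowskiRelation P (FreeAlgebra.ι ℂ) p.swap)
    (by rw [minkowskiFreeRelations_eq]; exact ⟨p.swap, rfl⟩)).2
  have h2 := (StarPres.mk_relation (σ := id) (P := minkowskiFreeRelations P)
    (p := minkowskiRelation P (FreeAlgebra.ι ℂ) p)
    (by rw [minkowskiFreeRelations_eq]; exact ⟨p, rfl⟩)).1
  rw [adj_minkowskiRelation, Prod.swap_swap, map_add, h2, zero_add, AlgHom.commutes] at h1
  exact (algebraMap ℂ (MinkowskiAlgebra P)).injective (h1.trans (map_zero _).symm)

/-- The universal property of the algebra of a quantum Minkowski space. -/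
def minkowskiLift {F : Type} [Ring F] [Algebra ℂ F] {P : PoincareDatum} (hP : P.Admissible)
    (x : Fin 4 → F) (h : ∀ p, minkowskiRelation P x p = 0) : MinkowskiAlgebra P →ₐ[ℂ] F :=
  RingQuot.liftAlgHom ℂ ⟨FreeAlgebra.lift ℂ x, by
    have h0 : ∀ p, FreeAlgebra.lift ℂ x (minkowskiRelation P (FreeAlgebra.ι ℂ) p) = 0 := by
      intro p
      rw [map_minkowskiRelation]
      simpa only [FreeAlgebra.lift_ι_apply] using h p
    rintro a b ⟨rfl, ha | ⟨c, hc, rfl⟩⟩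
    · rw [minkowskiFreeRelations_eq] at ha
      obtain ⟨p, rfl⟩ := ha
      rw [h0, map_zero]
    · rw [minkowskiFreeRelations_eq] at hc
      obtain ⟨p, rfl⟩ := hc
      rw [adj_minkowskiRelation, map_add, h0, realityDefect_eq_zero hP, map_zero, map_zero,
        add_zero]⟩

theorem minkowskiLift_coord {F : Type} [Ring F] [Algebra ℂ F] {P : PoincareDatum}
    (hP : P.Admissible) (x : Fin 4 → F) (h : ∀ p, minkowskiRelation P x p = 0) (i : Fin 4) :
    minkowskiLift hP x h (coord P i) = x i := by
  simp [minkowskiLift, coord, StarPres.mk]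

theorem minkowski_induction {P : PoincareDatum} {p : MinkowskiAlgebra P → Prop} (one : p 1)
    (smul : ∀ (c : ℂ) f, p f → p (c • f)) (add : ∀ f g, p f → p g → p (f + g))
    (coord_mul : ∀ k f, p f → p (coord P k * f)) (f : MinkowskiAlgebra P) : p f := by
  have key : ∀ (a : FreeAlgebra ℂ (Fin 4)) (g : MinkowskiAlgebra P), p g →
      p (StarPres.mk id (minkowskiFreeRelations P) a * g) := by
    intro a
    induction a using FreeAlgebra.induction with
    | grade0 c =>
      intro g hg
      rw [AlgHom.commutes, ← Algebra.smul_def]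
      exact smul c g hg
    | grade1 k => exact fun g hg => coord_mul k g hg
    | mul a b ha hb =>
      intro g hg
      rw [map_mul, mul_assoc]
      exact ha _ (hb _ hg)
    | add a b ha hb =>
      intro g hg
      rw [map_add, add_mul]
      exact add _ _ (ha _ hg) (hb _ hg)
  obtain ⟨a, rfl⟩ := RingQuot.mkAlgHom_surjective ℂ _ f
  have := key a 1 one
  rwa [mul_one] at this

/-! ### Existence and uniqueness of the partial derivatives. -/

section

theorem leg_sub_one_mul (P : PoincareDatum) :
    leg12 (P.R - 1) * (leg23 P.R * leg12 P.R) = leg23 P.R * leg12 P.R * leg23 (P.R - 1) := by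
  rw [leg12_sub, leg23_sub, leg12_one, leg23_one, Matrix.sub_mul, Matrix.mul_sub, Matrix.one_mul,
    Matrix.mul_one, ← Matrix.mul_assoc, P.leg_yang_baxter]

/-- By `RZ_mul_R` the bracket becomes `(R₁₂ + 1)(1 ⊗ Z)R`, and `R₁₂ - 1` annihilates it because `R²
= 1`. -/
theorem leg12_sub_one_mul_linear {P : PoincareDatum} (hP : P.Admissible) :
    leg12 (P.R - 1) * (leg23 P.R * leg12 P.R * oneTensor P.Z + leg23 P.R * tensorOne P.Z +
      oneTensor P.Z * P.R - tensorOne P.Z * P.R) = 0 := by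
  have h := PoincareDatum.RZ_mul_R hP
  have h1 : leg23 P.R * leg12 P.R * oneTensor P.Z + leg23 P.R * tensorOne P.Z =
      leg12 P.R * (oneTensor P.Z * P.R) + tensorOne P.Z * P.R := by
    rw [PoincareDatum.RZ, Matrix.add_mul, Matrix.mul_add, ← Matrix.mul_assoc] at h
    rw [← Matrix.mul_assoc, h]
  have h2 : leg12 (P.R - 1) * (leg12 P.R + 1) = 0 := by
    rw [← leg12_one, ← show leg12 (P.R - (-1)) = leg12 P.R + leg12 1 by
      rw [sub_neg_eq_add]
      ext
      simp only [leg12, Matrix.of_apply, Matrix.add_apply]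
      split_ifs <;> simp, ← leg12_mul, sub_neg_eq_add, Matrix.sub_mul, Matrix.mul_add, P.R_mul_R]
    ext
    simp [leg12]
    intro _
    ring
  rw [h1]
  calc _ = leg12 (P.R - 1) * ((leg12 P.R + 1) * (oneTensor P.Z * P.R)) := by
        rw [Matrix.add_mul, Matrix.one_mul]
        congr 1
        abel
    _ = 0 := by rw [← Matrix.mul_assoc, h2, Matrix.zero_mul]

section Derivative

variable {F : Type} [Ring F] [Algebra ℂ F] (P : PoincareDatum) (x : Fin 4 → F)

/-- The entries `R^{kl}_{in} x^n + Z^{kl}_i`. -/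
def derivBlock (i : Fin 4) (p : Fin 4 × Fin 4) : F :=
  ∑ n, P.R p (i, n) • x n + algebraMap ℂ F (P.Z p i)

/-- The matrix of left multiplication by `x^k`, acting on a function and its partial
derivatives. -/
def derivMatrix (k : Fin 4) : Matrix (Fin 4 ⊕ Unit) (Fin 4 ⊕ Unit) F :=
  Matrix.fromBlocks (Matrix.of fun i l => derivBlock P x i (k, l))
    (Matrix.of fun i _ => if k = i then 1 else 0) 0 (Matrix.of fun _ _ => x k)

/-- The vector `e_i ⊗ v`. -/
def single {α : Type} (i : Fin 4) (v : α → F) : Fin 4 × α → F :=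
  fun p => if p.1 = i then v p.2 else 0

theorem derivBlock_eq (i : Fin 4) : derivBlock P x i =
    act P.R (single i x) + act P.Z fun j => if j = i then 1 else 0 := by
  funext p
  simp [derivBlock, act, single, Fintype.sum_prod_type, Algebra.algebraMap_eq_smul_one]

theorem oneTensor_act_single (i : Fin 4) (v : Fin 4 → F) :
    act (oneTensor P.Z) (single i v) = single i (act P.Z v) := by
  funext ⟨j, k, l⟩
  rw [oneTensor_act_apply]
  simp only [single, act]
  split_ifs <;> simp

theorem leg23_act_single (M : Matrix (Fin 4 × Fin 4) (Fin 4 × Fin 4) ℂ) (i : Fin 4)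
    (v : Fin 4 × Fin 4 → F) : act (leg23 M) (single i v) = single i (act M v) := by
  funext ⟨j, k, l⟩
  rw [leg23_act_apply]
  simp only [single, act, Fintype.sum_prod_type]
  split_ifs <;> simp

theorem sum_derivBlock_mul (i : Fin 4) : (fun p : Fin 4 × Fin 4 × Fin 4 =>
      ∑ c, derivBlock P x i (p.1, c) * derivBlock P x c (p.2.1, p.2.2)) =
    act (leg23 P.R * leg12 P.R) (single i fun p => x p.1 * x p.2) +
      act (leg23 P.R * tensorOne P.Z) (single i x) + act (oneTensor P.Z) (derivBlock P x i) := by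
  have h : (fun p : Fin 4 × Fin 4 × Fin 4 => derivBlock P x i (p.1, p.2.1) * x p.2.2) =
      act (leg12 P.R) (single i fun p => x p.1 * x p.2) + act (tensorOne P.Z) (single i x) := by
    funext ⟨k, c, m⟩
    simp [derivBlock, leg12_act_apply, tensorOne_act_apply, single, add_mul, Finset.sum_mul,
      Algebra.smul_def, mul_assoc]
  rw [← act_act, ← act_act, ← act_add, ← h]
  funext ⟨k, l, j⟩
  rw [Pi.add_apply, leg23_act_apply, oneTensor_act_apply, ← Finset.sum_add_distrib]
  refine Finset.sum_congr rfl fun c _ => ?_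
  rw [derivBlock.eq_1 P x c, mul_add, Finset.mul_sum, ← Algebra.commutes, ← Algebra.smul_def]
  simp only [mul_smul_comm]

variable {P x}

/-- Sort by degree in `x`. Yang–Baxter carries `R - 1` to the quadratic monomials, where the
relation lowers their degree. The linear terms then vanish by `leg12_sub_one_mul_linear`, and the
constant ones form `F̃`. -/
theorem derivBlock_relation (hP : P.Admissible) (hF : ∀ i j k m, P.Ftilde i j k m = 0)
    (hx : ∀ p, minkowskiRelation P x p = 0) (i : Fin 4) :
    act (leg12 (P.R - 1)) ((fun p : Fin 4 × Fin 4 × Fin 4 =>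
        ∑ c, derivBlock P x i (p.1, c) * derivBlock P x c (p.2.1, p.2.2)) -
      act (tensorOne P.Z) (derivBlock P x i) +
      fun p => if i = p.2.2 then algebraMap ℂ F (P.T p.1 p.2.1) else 0) = 0 := by
  set q : Fin 4 × Fin 4 → F := fun p => x p.1 * x p.2 with hq
  set t : Fin 4 × Fin 4 → F := fun p => algebraMap ℂ F (P.T p.1 p.2) with ht
  set e : Fin 4 → F := fun j => if j = i then 1 else 0 with he
  have h1 : act (leg12 (P.R - 1)) (act (leg23 P.R * leg12 P.R) (single i q)) =
      act (leg12 (P.R - 1)) (act (leg23 P.R * leg12 P.R * oneTensor P.Z) (single i x) -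
        act (leg23 P.R * leg12 P.R) (single i t)) := by
    have h2 : act (P.R - 1) q = act (P.R - 1) (act P.Z x - t) := by
      have h3 : act (P.R - 1) (q - act P.Z x + t) = 0 := funext hx
      rw [← sub_eq_zero, ← act_sub, ← h3]
      congr 1
      abel
    rw [act_act, leg_sub_one_mul, ← act_act, leg23_act_single, h2, ← leg23_act_single, act_act,
      ← leg_sub_one_mul, ← act_act, ← act_act _ (oneTensor P.Z), oneTensor_act_single, ← act_sub]
    congr 2
    funext ⟨a, b⟩
    simp only [single, Pi.sub_apply]
    split_ifs <;> simp
  have h4 : act (leg12 (P.R - 1)) (act (oneTensor P.Z * P.Z - tensorOne P.Z * P.Z) e -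
      act (leg23 P.R * leg12 P.R) (single i t) +
      fun p => if i = p.2.2 then algebraMap ℂ F (P.T p.1 p.2.1) else 0) = 0 := by
    funext ⟨a, b, j⟩
    have h5 := congrArg (algebraMap ℂ F) (hF a b j i)
    rw [map_zero] at h5
    refine Eq.trans ?_ h5
    rw [leg12_act_apply, PoincareDatum.Ftilde]
    simp only [map_sum, map_mul, Algebra.smul_def]
    refine Finset.sum_congr rfl fun p _ => Finset.sum_congr rfl fun r _ => ?_
    congr 1
    rw [Pi.add_apply, Pi.sub_apply, ← act_act, leg23_act_apply, map_sub, map_add, map_sub]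
    simp only [leg12_act_apply]
    have h6 : act (oneTensor P.Z * P.Z - tensorOne P.Z * P.Z) e (p, r, j) =
        algebraMap ℂ F (∑ n, P.Z (r, j) n * P.Z (p, n) i) -
          algebraMap ℂ F (∑ n, P.Z (p, r) n * P.Z (n, j) i) := by
      rw [← oneTensor_mul_apply, ← tensorOne_mul_apply]
      simp [act, he, Algebra.algebraMap_eq_smul_one, sub_smul]
    rw [h6, sub_add_eq_add_sub]
    refine congrArg₂ (· - ·) (congrArg₂ (· + ·) rfl ?_) ?_
    · by_cases hij : i = j
      · simp [hij]
      · simp [hij, Ne.symm hij]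
    · simp [single, ht, Algebra.smul_def, Finset.mul_sum, mul_assoc]
      refine Finset.sum_congr rfl fun _ _ => ?_
      rw [Finset.sum_comm]
      refine Finset.sum_congr rfl fun _ _ => Finset.sum_congr rfl fun _ _ => ?_
      rw [← mul_assoc, ← mul_assoc, Algebra.commutes]
  rw [sum_derivBlock_mul, derivBlock_eq, ← he]
  have h6 := congrArg (fun M => act M (single i x)) (leg12_sub_one_mul_linear hP)
  simp only [zero_act] at h6
  rw [← act_act] at h6
  simp only [act_add, act_sub, act_act _ _ e, act_act _ _ (single i x), sub_act, add_act] at h1 h4 h6 ⊢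
  rw [h1]
  calc _ = _ + _ := ?_
    _ = 0 + 0 := congrArg₂ (· + ·) h6 h4
    _ = 0 := add_zero 0
  abel

/-- The upper left block is `derivBlock_relation`. In the upper right block the terms with `Z`
cancel and `(R - 1)(R + 1) = 0` remains; the corner is the relation for `x`. -/
theorem minkowskiRelation_derivMatrix (hP : P.Admissible)
    (hF : ∀ i j k m, P.Ftilde i j k m = 0) (hx : ∀ p, minkowskiRelation P x p = 0)
    (p : Fin 4 × Fin 4) : minkowskiRelation P (derivMatrix P x) p = 0 := by
  have h1 : ∀ r s, minkowskiRelation P (derivMatrix P x) p r s = act (P.R - 1)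
      (fun p => (derivMatrix P x p.1 * derivMatrix P x p.2) r s -
        ∑ m, P.Z p m • derivMatrix P x m r s + if r = s then algebraMap ℂ F (P.T p.1 p.2) else 0)
      p := by
    intro r s
    simp only [minkowskiRelation, act, Matrix.sum_apply, Matrix.smul_apply, Pi.add_apply,
      Pi.sub_apply, Matrix.add_apply, Matrix.sub_apply, Matrix.algebraMap_matrix_apply]
  ext (i | i) (j | j)
  · have h2 := congrFun (derivBlock_relation hP hF hx i) (p.1, p.2, j)
    rw [leg12_act_apply] at h2
    rw [h1, Matrix.zero_apply]
    refine Eq.trans ?_ h2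
    rw [act, Fintype.sum_prod_type]
    refine Finset.sum_congr rfl fun k _ => Finset.sum_congr rfl fun l _ => ?_
    simp [derivMatrix, Matrix.mul_apply, Fintype.sum_sum_type, tensorOne_act_apply]
  · rw [h1, Matrix.zero_apply]
    have h3 : act (P.R - 1) (act (P.R + 1) (single i x)) = 0 := by
      rw [act_act, Matrix.sub_mul, Matrix.mul_add, P.R_mul_R, Matrix.mul_one, Matrix.one_mul,
        add_comm, sub_self, zero_act]
    refine Eq.trans ?_ (congrFun h3 p)
    congr 1
    funext ⟨k, l⟩
    simp [derivMatrix, Matrix.mul_apply, Fintype.sum_sum_type, derivBlock, add_act, one_act,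
      single]
    simp [act, Fintype.sum_prod_type, single, Algebra.algebraMap_eq_smul_one]
    abel
  · rw [h1, Matrix.zero_apply]
    simp [derivMatrix, Matrix.mul_apply, Fintype.sum_sum_type, act]
  · rw [h1, Matrix.zero_apply]
    refine Eq.trans ?_ (hx p)
    rw [minkowskiRelation]
    congr 1
    funext ⟨k, l⟩
    simp [derivMatrix, Matrix.mul_apply, Fintype.sum_sum_type, act]

end Derivative

section Partial

variable {P : PoincareDatum} (hP : P.Admissible) (hF : ∀ i j k m, P.Ftilde i j k m = 0)

/-- The homomorphism whose matrix entries are the partial derivatives. -/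
def derivHom : MinkowskiAlgebra P →ₐ[ℂ]
    Matrix (Fin 4 ⊕ Unit) (Fin 4 ⊕ Unit) (MinkowskiAlgebra P) :=
  minkowskiLift hP (derivMatrix P (coord P))
    (minkowskiRelation_derivMatrix hP hF (minkowskiRelation_coord P))

theorem derivHom_coord (k : Fin 4) :
    derivHom hP hF (coord P k) = derivMatrix P (coord P) k :=
  minkowskiLift_coord _ _ _ k

/-- The partial derivatives on a quantum Minkowski space. -/
def partialDeriv (i : Fin 4) : MinkowskiAlgebra P →ₗ[ℂ] MinkowskiAlgebra P where
  toFun f := derivHom hP hF f (Sum.inl i) (Sum.inr ())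
  map_add' f g := by rw [map_add, Matrix.add_apply]
  map_smul' c f := by rw [map_smul, Matrix.smul_apply, RingHom.id_apply]

/-- The corner entry must return `f` itself so that the upper right block contributes the term
`δ^k_i f` in the Leibniz rule. -/
theorem derivHom_corner (f : MinkowskiAlgebra P) :
    derivHom hP hF f (Sum.inr ()) (Sum.inr ()) = f := by
  induction f using minkowski_induction with
  | one => simp
  | smul c f h => rw [map_smul, Matrix.smul_apply, h]
  | add f g hf hg => rw [map_add, Matrix.add_apply, hf, hg]
  | coord_mul k f h =>
    rw [map_mul, derivHom_coord]
    simp [Matrix.mul_apply, Fintype.sum_sum_type, derivMatrix, h]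

theorem isPartialDerivatives_partialDeriv : IsPartialDerivatives P (partialDeriv hP hF) where
  map_one i := by simp [partialDeriv]
  map_coord_mul i k f := by
    have h := derivHom_corner hP hF f
    simp only [partialDeriv, LinearMap.coe_mk, AddHom.coe_mk]
    rw [map_mul, derivHom_coord]
    simp [Matrix.mul_apply, Fintype.sum_sum_type, derivMatrix, h, derivBlock, add_comm]

theorem IsPartialDerivatives.unique {pd pd' : Fin 4 → MinkowskiAlgebra P →ₗ[ℂ] MinkowskiAlgebra P}
    (h : IsPartialDerivatives P pd) (h' : IsPartialDerivatives P pd') : pd = pd' := by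
  suffices hs : ∀ f i, pd i f = pd' i f from funext fun i => LinearMap.ext fun f => hs f i
  intro f
  induction f using minkowski_induction with
  | one => intro i; rw [h.map_one, h'.map_one]
  | smul c f hf => intro i; rw [map_smul, map_smul, hf]
  | add f g hf hg => intro i; rw [map_add, map_add, hf, hg]
  | coord_mul k f hf => intro i; simp only [h.map_coord_mul, h'.map_coord_mul, hf]

end Partial

end

/-! ### `R`-symmetry of second derivatives. -/

section

theorem neg_act {α β F : Type} [Fintype β] [Ring F] [Algebra ℂ F] (M : Matrix α β ℂ) (v : β → F) :
    act (-M) v = -act M v := by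
  funext a
  simp [act]

theorem transpose_leg12 (M : Matrix (Fin 4 × Fin 4) (Fin 4 × Fin 4) ℂ) :
    (leg12 M)ᵀ = leg12 Mᵀ := by
  ext ⟨i, j, k⟩ ⟨i', j', k'⟩
  simp only [leg12, Matrix.transpose_apply, Matrix.of_apply, eq_comm]

theorem transpose_leg23 (M : Matrix (Fin 4 × Fin 4) (Fin 4 × Fin 4) ℂ) :
    (leg23 M)ᵀ = leg23 Mᵀ := by
  ext ⟨i, j, k⟩ ⟨i', j', k'⟩
  simp only [leg23, Matrix.transpose_apply, Matrix.of_apply, eq_comm]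

variable {P : PoincareDatum} {pd : Fin 4 → MinkowskiAlgebra P →ₗ[ℂ] MinkowskiAlgebra P}

/-- The Leibniz rule applied twice, sorted into first derivatives of `f`, second derivatives with a
coordinate in front, and second derivatives with scalar coefficients. Each group is a transposed
matrix acting on a vector supported at `m`, so matrix identities can be applied to it. -/
theorem IsPartialDerivatives.second_coord_mul (h : IsPartialDerivatives P pd) (m : Fin 4)
    (f : MinkowskiAlgebra P) : (fun p : Fin 4 × Fin 4 => pd p.2 (pd p.1 (coord P m * f))) =
      single m (fun p => pd p f) + act P.Rᵀ (single m fun p => pd p f) +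
      (fun p => ∑ t, coord P t * act (leg12 P.R * leg23 P.R)ᵀ
        (single m fun p : Fin 4 × Fin 4 => pd p.2 (pd p.1 f)) (p.1, p.2, t)) +
      act P.RZᵀ (single m fun p => pd p.2 (pd p.1 f)) := by
  have h1 : ∀ (M : Matrix (Fin 4 × Fin 4) (Fin 4 × Fin 4) ℂ) (v : Fin 4 → MinkowskiAlgebra P),
      act Mᵀ (single m v) = fun p => ∑ r, M (m, r) p • v r := by
    intro M v
    funext p
    simp [act, single, Fintype.sum_prod_type]
  have h2 : ∀ {α : Type} (M : Matrix (Fin 4 × Fin 4 × Fin 4) α ℂ)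
      (v : Fin 4 × Fin 4 → MinkowskiAlgebra P),
      act Mᵀ (single m v) = fun p => ∑ r, ∑ s, M (m, r, s) p • v (r, s) := by
    intro α M v
    funext p
    simp [act, single, Fintype.sum_prod_type]
  rw [h1, h2, h2]
  funext ⟨l, k⟩
  have h3 : ∀ r s t, (leg12 P.R * leg23 P.R) (m, r, s) (l, k, t) =
      ∑ n, P.R (m, r) (l, n) * P.R (n, s) (k, t) := by
    intro r s t
    rw [leg12_mul_apply]
    simp [leg23]
  have h4 : ∀ r s, P.RZ (m, r, s) (l, k) =
      ∑ n, P.R (m, r) (l, n) * P.Z (n, s) k + P.Z (m, r) l * if s = k then 1 else 0 := by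
    intro r s
    rw [PoincareDatum.RZ, leg12_mul_oneTensor]
    simp [tensorOne]
  have h5 : ∀ n g, pd k (coord P n * g) = (if n = k then g else 0) +
      (∑ s, ∑ t, P.R (n, s) (k, t) • (coord P t * pd s g) + ∑ s, P.Z (n, s) k • pd s g) := by
    intro n g
    rw [h.map_coord_mul, ← Finset.sum_add_distrib]
    simp only [add_mul, Finset.sum_mul, smul_mul_assoc, Algebra.smul_def (P.Z _ _)]
  have h6 : pd k (pd l (coord P m * f)) = (if m = l then pd k f else 0) +
      (∑ r, ∑ n, P.R (m, r) (l, n) • pd k (coord P n * pd r f) +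
        ∑ r, P.Z (m, r) l • pd k (pd r f)) := by
    rw [h.map_coord_mul, map_add, map_sum, ← Finset.sum_add_distrib]
    simp only [add_mul, Finset.sum_mul, smul_mul_assoc, ← Algebra.smul_def (P.Z _ _), map_add,
      map_sum, map_smul, apply_ite (pd k), map_zero]
  simp only [h6, h5, h3, h4, Pi.add_apply, single]
  simp only [smul_add, Finset.sum_add_distrib, add_smul, Finset.sum_smul, mul_smul, Finset.smul_sum,
    Finset.mul_sum, mul_smul_comm]
  have e1 : ∑ r, ∑ n, (P.R (m, r) (l, n) • if n = k then pd r f else 0) =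
      ∑ r, P.R (m, r) (l, k) • pd r f := by
    simp
  have e2 : ∑ t, ∑ r, ∑ s, ∑ n, P.R (m, r) (l, n) • P.R (n, s) (k, t) •
      (coord P t * pd s (pd r f)) = ∑ r, ∑ n, ∑ s, ∑ t, P.R (m, r) (l, n) • P.R (n, s) (k, t) •
      (coord P t * pd s (pd r f)) := by
    rw [Finset.sum_comm]
    refine Finset.sum_congr rfl fun r _ => ?_
    refine (Finset.sum_congr rfl fun t _ => Finset.sum_comm).trans ?_
    rw [Finset.sum_comm]
    exact Finset.sum_congr rfl fun n _ => Finset.sum_comm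
  have e3 : ∑ r, ∑ s, ∑ n, P.R (m, r) (l, n) • P.Z (n, s) k • pd s (pd r f) =
      ∑ r, ∑ n, ∑ s, P.R (m, r) (l, n) • P.Z (n, s) k • pd s (pd r f) :=
    Finset.sum_congr rfl fun r _ => Finset.sum_comm
  have e4 : ∑ r, ∑ s, P.Z (m, r) l • (if s = k then (1 : ℂ) else 0) • pd s (pd r f) =
      ∑ r, P.Z (m, r) l • pd k (pd r f) := by
    simp
  rw [e1, e2, e3, e4]
  simp only [eq_comm (a := m)]
  abel

/-- Induction on words. When a coordinate is prepended, the first derivatives drop out by `(1 + R)(1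
- R) = 0`; Yang–Baxter and `RZ_mul_R` move `1 - R` onto the second derivatives of `f` in the other
two groups, where the induction hypothesis applies. -/
theorem IsPartialDerivatives.commutation (hP : P.Admissible) (h : IsPartialDerivatives P pd)
    (f : MinkowskiAlgebra P) :
    act (1 - P.R)ᵀ (fun p : Fin 4 × Fin 4 => pd p.2 (pd p.1 f)) = 0 := by
  induction f using minkowski_induction with
  | one => simp only [h.map_one, map_zero]; exact act_zero _
  | smul c f hf =>
    have h1 : (fun p : Fin 4 × Fin 4 => pd p.2 (pd p.1 (c • f))) =
        c • fun p : Fin 4 × Fin 4 => pd p.2 (pd p.1 f) := by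
      funext p
      simp only [map_smul, Pi.smul_apply]
    have h2 : ∀ (M : Matrix (Fin 4 × Fin 4) (Fin 4 × Fin 4) ℂ) (v : _ → MinkowskiAlgebra P),
        act M (c • v) = c • act M v := by
      intro M v
      funext p
      simp only [act, Pi.smul_apply, Finset.smul_sum, smul_comm c]
    rw [h1, h2, hf, smul_zero]
  | add f g hf hg =>
    have h1 : (fun p : Fin 4 × Fin 4 => pd p.2 (pd p.1 (f + g))) =
        (fun p : Fin 4 × Fin 4 => pd p.2 (pd p.1 f)) + fun p => pd p.2 (pd p.1 g) := by
      funext p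
      simp only [map_add, Pi.add_apply]
    rw [h1, act_add, hf, hg, add_zero]
  | coord_mul m f hf =>
    have h1 : ∀ v : Fin 4 × Fin 4 × Fin 4 → MinkowskiAlgebra P,
        act (1 - P.R)ᵀ (fun p : Fin 4 × Fin 4 => ∑ t, coord P t * v (p.1, p.2, t)) =
          fun p => ∑ t, coord P t * act (leg12 (1 - P.R)ᵀ) v (p.1, p.2, t) := by
      intro v
      funext ⟨l, k⟩
      simp only [leg12_act_apply, Finset.mul_sum, mul_smul_comm]
      simp only [act, Finset.smul_sum, Fintype.sum_prod_type]
      exact (Finset.sum_congr rfl fun _ _ => Finset.sum_comm).trans Finset.sum_comm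
    have h2 : leg12 (1 - P.R)ᵀ * (leg12 P.R * leg23 P.R)ᵀ =
        (leg12 P.R * leg23 P.R)ᵀ * leg23 (1 - P.R)ᵀ := by
      rw [← transpose_leg12, ← transpose_leg23, ← Matrix.transpose_mul, ← Matrix.transpose_mul,
        leg12_sub, leg23_sub, leg12_one, leg23_one, Matrix.mul_sub, Matrix.sub_mul, Matrix.one_mul,
        Matrix.mul_one, P.leg_yang_baxter, Matrix.mul_assoc]
    have h3 : (1 - P.R)ᵀ * P.RZᵀ = P.RZᵀ * leg23 (1 - P.R)ᵀ := by
      rw [← transpose_leg23, ← Matrix.transpose_mul, ← Matrix.transpose_mul,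
        leg23_sub, leg23_one, Matrix.mul_sub, Matrix.sub_mul, Matrix.one_mul,
        Matrix.mul_one, PoincareDatum.RZ_mul_R hP]
    have h4 : (1 - P.R)ᵀ * P.Rᵀ = - (1 - P.R)ᵀ := by
      rw [← Matrix.transpose_mul, Matrix.mul_sub, P.R_mul_R, Matrix.mul_one, ← Matrix.transpose_neg,
        neg_sub]
    have h5 : act (leg23 (1 - P.R)ᵀ) (single m fun p : Fin 4 × Fin 4 => pd p.2 (pd p.1 f)) = 0 := by
      rw [leg23_act_single, hf]
      funext p
      simp [single]
    rw [h.second_coord_mul, act_add, act_add, act_add, h1, act_act, act_act, act_act, h2, h3, h4,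
      ← act_act, ← act_act, h5, act_zero, act_zero, neg_act]
    funext p
    simp

theorem IsPartialDerivatives.comm (hP : P.Admissible) (h : IsPartialDerivatives P pd)
    (k l : Fin 4) (f : MinkowskiAlgebra P) :
    pd k (pd l f) = ∑ j, ∑ i, P.R (j, i) (l, k) • pd i (pd j f) := by
  have h1 := congrFun (h.commutation hP f) (l, k)
  rw [Matrix.transpose_sub, sub_act, Matrix.transpose_one, one_act, Pi.sub_apply, Pi.zero_apply,
    sub_eq_zero] at h1
  rw [h1]
  simp [act, Fintype.sum_prod_type]

end

/-! ### The metric and the Clifford relations in spinor coordinates. -/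

section

theorem kronecker_mulVec {α β γ δ : Type} [Fintype β] [Fintype δ] (M : Matrix α β ℂ)
    (N : Matrix γ δ ℂ) (u : β → ℂ) (v : δ → ℂ) :
    (M ⊗ₖ N) *ᵥ (fun p => u p.1 * v p.2) = fun p => (M *ᵥ u) p.1 * (N *ᵥ v) p.2 := by
  funext ⟨a, c⟩
  simp only [Matrix.mulVec, dotProduct, Matrix.kroneckerMap_apply, Fintype.sum_prod_type,
    Finset.sum_mul_sum]
  refine Finset.sum_congr rfl fun _ _ => Finset.sum_congr rfl fun _ _ => ?_
  ring

theorem mid_mulVec (M : Matrix (Fin 2 × Fin 2) (Fin 2 × Fin 2) ℂ)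
    (v : (Fin 2 × Fin 2) × (Fin 2 × Fin 2) → ℂ) (A B C D : Fin 2) :
    (mid M *ᵥ v) ((A, B), (C, D)) = ∑ S, ∑ U, M (B, C) (S, U) * v ((A, S), (U, D)) := by
  simp only [mid, Matrix.mulVec, dotProduct, Matrix.of_apply, Fintype.sum_prod_type]
  simp [ite_and, -Fin.sum_univ_two]

theorem sum_V_mul_pauli (A B S Q : Fin 2) :
    ∑ j, V (A, B) j * pauli j S Q = if A = Q ∧ B = S then 2 else 0 := by
  have h := sum_V_mul_Vinv (A, B) (Q, S)
  simp only [Vinv, Matrix.of_apply, mul_left_comm _ (1 / 2 : ℂ), ← Finset.mul_sum,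
    Prod.mk.injEq] at h
  have h2 : ∑ j, V (A, B) j * pauli j S Q = 2 * (1 / 2 * ∑ j, V (A, B) j * pauli j S Q) := by ring
  rw [h2, h]
  split_ifs <;> simp

namespace PoincareDatum

variable (P : PoincareDatum)

/-- The change of basis from spinors to vectors, after exchange of the middle factors. -/
def toVec : Matrix (Fin 4 × Fin 4) ((Fin 2 × Fin 2) × (Fin 2 × Fin 2)) ℂ :=
  (Vinv ⊗ₖ Vinv) * mid P.lor.X

/-- The inverse of `toVec`. -/
def ofVec : Matrix ((Fin 2 × Fin 2) × (Fin 2 × Fin 2)) (Fin 4 × Fin 4) ℂ :=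
  mid P.lor.X⁻¹ * (V ⊗ₖ V)

theorem ofVec_mul_toVec : P.ofVec * P.toVec = 1 := by
  calc P.ofVec * P.toVec = mid P.lor.X⁻¹ * ((V ⊗ₖ V) * (Vinv ⊗ₖ Vinv)) * mid P.lor.X := by
        simp only [ofVec, toVec, Matrix.mul_assoc]
    _ = 1 := by
        rw [← Matrix.mul_kronecker_mul, V_mul_Vinv, Matrix.one_kronecker_one, Matrix.mul_one,
          mid_mul_mid, P.lor.X_inv_mul, mid_one]

theorem toVec_mul_ofVec : P.toVec * P.ofVec = 1 := by
  calc P.toVec * P.ofVec = (Vinv ⊗ₖ Vinv) * (mid P.lor.X * mid P.lor.X⁻¹) * (V ⊗ₖ V) := by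
        simp only [ofVec, toVec, Matrix.mul_assoc]
    _ = 1 := by
        rw [mid_mul_mid, P.lor.X_mul_inv, mid_one, Matrix.mul_one, ← Matrix.mul_kronecker_mul,
          Vinv_mul_V, Matrix.one_kronecker_one]

theorem R_mul_toVec : P.R * P.toVec = P.toVec * (P.L ⊗ₖ P.Ltilde) := by
  have h : P.R = P.toVec * (P.L ⊗ₖ P.Ltilde) * P.ofVec := by
    simp only [R, toVec, ofVec, Matrix.mul_assoc]
  rw [h, Matrix.mul_assoc, ofVec_mul_toVec, Matrix.mul_one]

theorem L_mulVec (u : Fin 2 × Fin 2 → ℂ) (A B : Fin 2) : (P.L *ᵥ u) (A, B) =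
    P.kappa * (u (A, B) + P.lor.q * P.lor.E A B * ∑ C, ∑ D, P.lor.E' C D * u (C, D)) := by
  simp only [Matrix.mulVec, dotProduct, Fintype.sum_prod_type, L_apply, ite_and]
  fin_cases A <;> fin_cases B <;> simp <;> ring

theorem Ltilde_mulVec (u : Fin 2 × Fin 2 → ℂ) (A B : Fin 2) : (P.Ltilde *ᵥ u) (A, B) =
    P.lor.q * P.kappa * (u (A, B) + P.lor.q * P.lor.E B A * ∑ C, ∑ D, P.lor.E' C D * u (D, C)) := by
  simp only [Matrix.mulVec, dotProduct, Fintype.sum_prod_type, L_apply, Ltilde_apply, ite_and]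
  fin_cases A <;> fin_cases B <;> simp <;> ring

theorem L_mulVec_E : (P.L *ᵥ fun p => P.lor.E p.1 p.2) = fun p => -P.kappa * P.lor.E p.1 p.2 := by
  funext ⟨A, B⟩
  rw [L_mulVec, P.lor.E'_apply_E]
  linear_combination (-2 * P.kappa * P.lor.E A B) * P.lor.q_mul_q

theorem Ltilde_mulVec_E : (P.Ltilde *ᵥ fun p => P.lor.E p.2 p.1) =
    fun p => -(P.lor.q * P.kappa) * P.lor.E p.2 p.1 := by
  funext ⟨A, B⟩
  rw [Ltilde_mulVec, P.lor.E'_apply_E]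
  linear_combination (-2 * P.lor.q * P.kappa * P.lor.E B A) * P.lor.q_mul_q

theorem q_mul_kappa : P.lor.q * (P.kappa * P.kappa) = 1 := by
  rw [kappa_mul_kappa, P.lor.q_mul_q]

theorem g_eq : (fun p : Fin 4 × Fin 4 => P.lor.g p.1 p.2) = P.toVec *ᵥ
    fun p => (-2 * P.lor.qHalf) * (P.lor.E p.1.1 p.1.2 * P.lor.E p.2.2 p.2.1) := by
  have h : (fun p : (Fin 2 × Fin 2) × (Fin 2 × Fin 2) =>
      (-2 * P.lor.qHalf) * (P.lor.E p.1.1 p.1.2 * P.lor.E p.2.2 p.2.1)) = (-2 * P.lor.qHalf) •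
      fun p => P.lor.E p.1.1 p.1.2 * P.lor.E p.2.2 p.2.1 := rfl
  rw [h, Matrix.mulVec_smul]
  rfl

/-- In the coordinates where `R` is `L ⊗ L̃`, the metric is a multiple of `E ⊗ τE`. The eigenvalues
there are `-κ` and `-qκ`, with product `qκ² = 1`. -/
theorem R_mulVec_g : (P.R *ᵥ fun p => P.lor.g p.1 p.2) = fun p => P.lor.g p.1 p.2 := by
  have h := kronecker_mulVec P.L P.Ltilde (fun p => P.lor.E p.1 p.2) (fun p => P.lor.E p.2 p.1)
  rw [L_mulVec_E, Ltilde_mulVec_E] at h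
  have h1 : (fun p : (Fin 2 × Fin 2) × (Fin 2 × Fin 2) =>
      (-2 * P.lor.qHalf) * (P.lor.E p.1.1 p.1.2 * P.lor.E p.2.2 p.2.1)) = (-2 * P.lor.qHalf) •
      fun p => P.lor.E p.1.1 p.1.2 * P.lor.E p.2.2 p.2.1 := rfl
  rw [g_eq, Matrix.mulVec_mulVec, R_mul_toVec, ← Matrix.mulVec_mulVec, h1, Matrix.mulVec_smul, h]
  congr 2
  funext p
  linear_combination (P.lor.E p.1.1 p.1.2 * P.lor.E p.2.2 p.2.1) * P.q_mul_kappa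

theorem qHalf_ne_zero : P.lor.qHalf ≠ 0 := by
  intro h0
  have := P.q_mul_kappa
  simp [kappa, h0] at this

theorem g_ne_zero : ∃ i j, P.lor.g i j ≠ 0 := by
  by_contra! h
  have h1 : (fun p : Fin 4 × Fin 4 => P.lor.g p.1 p.2) = 0 := funext fun p => h p.1 p.2
  have h2 := congrArg (fun v => P.ofVec *ᵥ v) (P.g_eq.symm.trans h1)
  simp only [Matrix.mulVec_mulVec, ofVec_mul_toVec, Matrix.one_mulVec, Matrix.mulVec_zero] at h2
  -- At this entry both factors equal `E` at `(0, 1)`, which is `1` in all families, leaving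
  -- `-2q^{1/2}`.
  have h3 := congrFun h2 ((0, 1), (1, 0))
  obtain ⟨c, hE, -, -⟩ := P.lor.E_normal_form
  simp [hE, P.qHalf_ne_zero] at h3

/-- A symmetrized vector in the image of `toVec`. -/
theorem add_R_mulVec {Y : Fin 4 × Fin 4 → ℂ} {u v : Fin 2 × Fin 2 → ℂ} {c : ℂ}
    (hY : (P.ofVec *ᵥ Y) = fun p => c * (u p.1 * v p.2)) :
    Y + P.R *ᵥ Y = P.toVec *ᵥ fun p => c * (u p.1 * v p.2 + (P.L *ᵥ u) p.1 * (P.Ltilde *ᵥ v) p.2) := by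
  have h : Y = P.toVec *ᵥ fun p => c * (u p.1 * v p.2) := by
    rw [← hY, Matrix.mulVec_mulVec, toVec_mul_ofVec, Matrix.one_mulVec]
  have h1 : (fun p : (Fin 2 × Fin 2) × (Fin 2 × Fin 2) => c * (u p.1 * v p.2)) =
      c • fun p : (Fin 2 × Fin 2) × (Fin 2 × Fin 2) => u p.1 * v p.2 := rfl
  rw [h, Matrix.mulVec_mulVec, R_mul_toVec, ← Matrix.mulVec_mulVec, ← Matrix.mulVec_add, h1,
    Matrix.mulVec_smul, kronecker_mulVec, ← smul_add]
  rfl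

theorem q_mul_qHalf_inv : P.lor.q * P.lor.qHalf⁻¹ = P.lor.qHalf := by
  rw [← P.lor.qHalf_mul_qHalf, mul_assoc, mul_inv_cancel₀ P.qHalf_ne_zero, mul_one]

theorem sum_V_mul_Amat (C D R S : Fin 2) :
    ∑ i, V (C, D) i * P.lor.Amat i R S =
      2 * P.lor.qHalf⁻¹ * ∑ K, ∑ L, P.lor.E K R * P.lor.X⁻¹ (C, D) (L, K) * P.lor.E L S := by
  have hD : ∀ A B K L, P.lor.D (A, B) (K, L) = P.lor.X⁻¹ (B, A) (L, K) := by
    intro A B K L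
    rw [LorentzType.D, LorentzType.mul_flip_apply, LorentzType.flip_mul_apply]
  have h : ∀ K L, ∑ i, V (C, D) i * P.lor.pauliD i K L = 2 * P.lor.X⁻¹ (C, D) (L, K) := by
    intro K L
    calc _ = ∑ A, ∑ B, (∑ i, V (C, D) i * pauli i A B) * P.lor.X⁻¹ (B, A) (L, K) := by
          simp only [LorentzType.pauliD, Matrix.of_apply, hD, Finset.mul_sum, Finset.sum_mul,
            mul_assoc]
          rw [Finset.sum_comm]
          exact Finset.sum_congr rfl fun _ _ => Finset.sum_comm
      _ = _ := by
          simp only [sum_V_mul_pauli, ite_and]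
          simp [-Fin.sum_univ_two]
  calc _ = P.lor.qHalf⁻¹ * ∑ K, ∑ L, P.lor.E K R *
        (∑ i, V (C, D) i * P.lor.pauliD i K L) * P.lor.E L S := by
        simp only [LorentzType.Amat, Matrix.smul_apply, Matrix.mul_apply, Matrix.transpose_apply,
          smul_eq_mul, Fin.sum_univ_two, Fin.sum_univ_four]
        ring
    _ = _ := by
        simp only [h]
        simp only [Fin.sum_univ_two]
        ring

theorem kronecker_V_mulVec (Y : Fin 4 × Fin 4 → ℂ) (p p' : Fin 2 × Fin 2) :
    ((V ⊗ₖ V) *ᵥ Y) (p, p') = ∑ j, ∑ i, V p j * V p' i * Y (j, i) := by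
  simp only [Matrix.mulVec, dotProduct, Matrix.kroneckerMap_apply, Fintype.sum_prod_type]

/-- Completeness of the Pauli matrices turns `σ_j` into Kronecker deltas. The `X⁻¹` inside `A_i` and
the one in `ofVec` then carry a strand through `E`, so a product vector is left. -/
theorem ofVec_A_mul_pauli (R Q : Fin 2) :
    (P.ofVec *ᵥ fun p => (P.lor.Amat p.2 * pauli p.1) R Q) = fun p =>
      4 * P.lor.qHalf⁻¹ * (((if p.1.1 = Q then 1 else 0) * P.lor.E p.1.2 R) *
        P.lor.E p.2.2 p.2.1) := by
  have h : ∀ A B C D, ((V ⊗ₖ V) *ᵥ fun p => (P.lor.Amat p.2 * pauli p.1) R Q) ((A, B), (C, D)) =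
      4 * P.lor.qHalf⁻¹ * ((if A = Q then 1 else 0) *
        ∑ K, ∑ L, P.lor.E K R * P.lor.X⁻¹ (C, D) (L, K) * P.lor.E L B) := by
    intro A B C D
    calc _ = ∑ S, (∑ i, V (C, D) i * P.lor.Amat i R S) * ∑ j, V (A, B) j * pauli j S Q := by
          rw [kronecker_V_mulVec]
          simp only [Matrix.mul_apply, Finset.mul_sum]
          refine (Finset.sum_congr rfl fun _ _ => Finset.sum_comm).trans ?_
          rw [Finset.sum_comm]
          refine Finset.sum_congr rfl fun _ _ => Finset.sum_congr rfl fun _ _ => ?_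
          rw [Finset.sum_mul]
          refine Finset.sum_congr rfl fun _ _ => ?_
          ring
      _ = _ := by
          simp only [sum_V_mul_Amat, sum_V_mul_pauli, ite_and, mul_ite, mul_zero]
          split_ifs
          · simp only [Finset.sum_ite_eq, Finset.mem_univ, if_true]
            ring
          · simp
  funext ⟨⟨A, B⟩, ⟨C, D⟩⟩
  rw [ofVec, ← Matrix.mulVec_mulVec, mid_mulVec]
  simp only [h]
  calc _ = 4 * P.lor.qHalf⁻¹ * ((if A = Q then 1 else 0) * ∑ K, P.lor.E K R * ∑ L, ∑ S, ∑ U,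
        P.lor.E L S * (P.lor.X⁻¹ (B, C) (S, U) * P.lor.X⁻¹ (U, D) (L, K))) := by
        simp only [Fin.sum_univ_two]
        ring
    _ = _ := by
        simp only [P.lor.X_inv_X_inv_E]
        simp only [mul_ite, mul_zero, Finset.sum_ite_eq, Finset.mem_univ, if_true]
        ring

/-- In this order crossing turns the `X⁻¹` inside `A_i` into `X`, which cancels the one in `ofVec`;
the first factor is now `E`. -/
theorem ofVec_pauli_mul_A (R Q : Fin 2) :
    (P.ofVec *ᵥ fun p => (pauli p.2 * P.lor.Amat p.1) R Q) = fun p =>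
      4 * P.lor.qHalf⁻¹ * (P.lor.E p.1.1 p.1.2 *
        ((if p.2.2 = R then 1 else 0) * P.lor.E p.2.1 Q)) := by
  have h : ∀ A B C D, ((V ⊗ₖ V) *ᵥ fun p => (pauli p.2 * P.lor.Amat p.1) R Q) ((A, B), (C, D)) =
      4 * P.lor.qHalf⁻¹ * ((if D = R then 1 else 0) *
        ∑ K, ∑ L, P.lor.E K C * P.lor.X⁻¹ (A, B) (L, K) * P.lor.E L Q) := by
    intro A B C D
    calc _ = ∑ S, (∑ i, V (C, D) i * pauli i R S) * ∑ j, V (A, B) j * P.lor.Amat j S Q := by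
          rw [kronecker_V_mulVec]
          simp only [Matrix.mul_apply, Finset.mul_sum]
          refine (Finset.sum_congr rfl fun _ _ => Finset.sum_comm).trans ?_
          rw [Finset.sum_comm]
          refine Finset.sum_congr rfl fun _ _ => Finset.sum_congr rfl fun _ _ => ?_
          rw [Finset.sum_mul]
          refine Finset.sum_congr rfl fun _ _ => ?_
          ring
      _ = _ := by
          simp only [sum_V_mul_Amat, sum_V_mul_pauli, and_comm (a := C = _), ite_and, ite_mul,
            zero_mul]
          split_ifs
          · simp only [Finset.sum_ite_eq, Finset.mem_univ, if_true]
            ring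
          · simp
  funext ⟨⟨A, B⟩, ⟨C, D⟩⟩
  rw [ofVec, ← Matrix.mulVec_mulVec, mid_mulVec]
  simp only [h]
  calc _ = 4 * P.lor.qHalf⁻¹ * ((if D = R then 1 else 0) * ∑ L, (∑ S, ∑ U,
        P.lor.X⁻¹ (B, C) (S, U) * ∑ K, P.lor.X⁻¹ (A, S) (L, K) * P.lor.E K U) * P.lor.E L Q) := by
        simp only [Fin.sum_univ_two]
        ring
    _ = 4 * P.lor.qHalf⁻¹ * ((if D = R then 1 else 0) * ∑ L, (∑ T, P.lor.E A T * ∑ S, ∑ U,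
        P.lor.X⁻¹ (B, C) (S, U) * P.lor.X (S, U) (T, L)) * P.lor.E L Q) := by
        simp only [← LorentzType.X_crossing]
        simp only [Fin.sum_univ_two]
        ring
    _ = _ := by
        simp only [P.lor.X_inv_mul_apply, ite_and, mul_ite, mul_one, mul_zero,
          Finset.sum_ite_eq, Finset.mem_univ, if_true, ite_mul, zero_mul]
        ring

/-- In spinor coordinates the product is a multiple of `u ⊗ τE`. Since `L̃` scales `τE` by `-qκ` and
`Lu = κ(u + qE(E'u))`, the terms in `u` cancel upon adding the `R`-image and only `E ⊗ τE` survives,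
with `E'u` an entry of the identity matrix. In `pauli_mul_A_symm` the two factors exchange roles. -/
theorem A_mul_pauli_symm (i j : Fin 4) :
    P.lor.Amat i * pauli j + ∑ l, ∑ k, P.R (j, i) (l, k) • (P.lor.Amat k * pauli l) =
      (2 * P.lor.g j i) • (1 : Matrix (Fin 2) (Fin 2) ℂ) := by
  ext R Q
  have h := P.add_R_mulVec (u := fun p => (if p.1 = Q then 1 else 0) * P.lor.E p.2 R)
    (v := fun p => P.lor.E p.2 p.1) (P.ofVec_A_mul_pauli R Q)
  have h1 : (fun p : (Fin 2 × Fin 2) × (Fin 2 × Fin 2) => 4 * P.lor.qHalf⁻¹ *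
      (((if p.1.1 = Q then 1 else 0) * P.lor.E p.1.2 R) * P.lor.E p.2.2 p.2.1 +
      (P.L *ᵥ fun p => (if p.1 = Q then 1 else 0) * P.lor.E p.2 R) p.1 *
        (P.Ltilde *ᵥ fun p => P.lor.E p.2 p.1) p.2)) =
      (2 * (1 : Matrix (Fin 2) (Fin 2) ℂ) R Q) • fun p => (-2 * P.lor.qHalf) *
        (P.lor.E p.1.1 p.1.2 * P.lor.E p.2.2 p.2.1) := by
    funext ⟨⟨A, B⟩, ⟨C, D⟩⟩
    have h2 : ∑ C, ∑ D, P.lor.E' C D * ((if C = Q then 1 else 0) * P.lor.E D R) =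
        (1 : Matrix (Fin 2) (Fin 2) ℂ) R Q := by
      have h3 := P.lor.E'_mul_E_apply Q R
      rw [Matrix.one_apply]
      simp only [eq_comm (a := R), ← h3, ite_mul, mul_ite, one_mul, zero_mul, mul_zero]
      rw [Finset.sum_comm]
      simp [-Fin.sum_univ_two]
    rw [Pi.smul_apply, Ltilde_mulVec_E, L_mulVec, h2, smul_eq_mul]
    linear_combination (-4 * P.lor.qHalf⁻¹ * P.lor.E D C * ((if A = Q then 1 else 0) * P.lor.E B R
      + P.lor.q * P.lor.E A B * (1 : Matrix (Fin 2) (Fin 2) ℂ) R Q)) * P.q_mul_kappa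
      - 4 * (1 : Matrix (Fin 2) (Fin 2) ℂ) R Q * P.lor.E A B * P.lor.E D C * P.q_mul_qHalf_inv
  rw [h1, Matrix.mulVec_smul, ← g_eq] at h
  have h4 := congrFun h (j, i)
  simp only [Matrix.add_apply, Matrix.sum_apply, Matrix.smul_apply, smul_eq_mul]
  simp only [Pi.add_apply, Pi.smul_apply, Matrix.mulVec, dotProduct, Fintype.sum_prod_type,
    smul_eq_mul] at h4
  rw [h4]
  ring

theorem pauli_mul_A_symm (i j : Fin 4) :
    pauli i * P.lor.Amat j + ∑ l, ∑ k, P.R (j, i) (l, k) • (pauli k * P.lor.Amat l) =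
      (2 * P.lor.g j i) • (1 : Matrix (Fin 2) (Fin 2) ℂ) := by
  ext R Q
  have h := P.add_R_mulVec (u := fun p => P.lor.E p.1 p.2)
    (v := fun p => (if p.2 = R then 1 else 0) * P.lor.E p.1 Q) (P.ofVec_pauli_mul_A R Q)
  have h1 : (fun p : (Fin 2 × Fin 2) × (Fin 2 × Fin 2) => 4 * P.lor.qHalf⁻¹ *
      (P.lor.E p.1.1 p.1.2 * ((if p.2.2 = R then 1 else 0) * P.lor.E p.2.1 Q) +
      (P.L *ᵥ fun p => P.lor.E p.1 p.2) p.1 *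
        (P.Ltilde *ᵥ fun p => (if p.2 = R then 1 else 0) * P.lor.E p.1 Q) p.2)) =
      (2 * (1 : Matrix (Fin 2) (Fin 2) ℂ) R Q) • fun p => (-2 * P.lor.qHalf) *
        (P.lor.E p.1.1 p.1.2 * P.lor.E p.2.2 p.2.1) := by
    funext ⟨⟨A, B⟩, ⟨C, D⟩⟩
    have h2 : ∑ C, ∑ D, P.lor.E' C D * ((if C = R then 1 else 0) * P.lor.E D Q) =
        (1 : Matrix (Fin 2) (Fin 2) ℂ) R Q := by
      have h3 := P.lor.E'_mul_E_apply R Q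
      rw [Matrix.one_apply]
      simp only [← h3, ite_mul, mul_ite, one_mul, zero_mul, mul_zero]
      rw [Finset.sum_comm]
      simp [-Fin.sum_univ_two]
    rw [Pi.smul_apply, Ltilde_mulVec, L_mulVec_E, h2, smul_eq_mul]
    linear_combination (-4 * P.lor.qHalf⁻¹ * P.lor.E A B * ((if D = R then 1 else 0) * P.lor.E C Q
      + P.lor.q * P.lor.E D C * (1 : Matrix (Fin 2) (Fin 2) ℂ) R Q)) * P.q_mul_kappa
      - 4 * (1 : Matrix (Fin 2) (Fin 2) ℂ) R Q * P.lor.E A B * P.lor.E D C * P.q_mul_qHalf_inv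
  rw [h1, Matrix.mulVec_smul, ← g_eq] at h
  have h4 := congrFun h (j, i)
  simp only [Matrix.add_apply, Matrix.sum_apply, Matrix.smul_apply, smul_eq_mul]
  simp only [Pi.add_apply, Pi.smul_apply, Matrix.mulVec, dotProduct, Fintype.sum_prod_type,
    smul_eq_mul] at h4
  rw [h4]
  ring

end PoincareDatum

end

/-! ### The Dirac operator and its square. -/

section

/-- Second derivatives of a coordinate vanish, so only the first-derivative terms of
`second_coord_mul` remain, and these are constants. -/
theorem IsPartialDerivatives.second_coord_mul_coord {P : PoincareDatum}
    {pd : Fin 4 → MinkowskiAlgebra P →ₗ[ℂ] MinkowskiAlgebra P} (h : IsPartialDerivatives P pd)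
    (m n l k : Fin 4) : pd k (pd l (coord P m * coord P n)) =
      ((if l = m ∧ k = n then 1 else 0) + P.R (m, n) (l, k)) • (1 : MinkowskiAlgebra P) := by
  have h1 : ∀ p, pd p (coord P n) = if p = n then 1 else 0 := by
    intro p
    have := h.map_coord_mul p n 1
    simp only [mul_one, h.map_one, mul_zero, Finset.sum_const_zero, add_zero] at this
    rw [this]
    simp only [eq_comm]
  have h2 : ∀ p s, pd s (pd p (coord P n)) = 0 := by
    intro p s
    rw [h1]
    split_ifs
    · exact h.map_one s
    · exact map_zero _
  have h3 := congrFun (h.second_coord_mul m (coord P n)) (l, k)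
  have h4 : (single m fun p : Fin 4 × Fin 4 => pd p.2 (pd p.1 (coord P n))) = 0 := by
    funext p
    simp [single, h2]
  simp only [h4, act_zero] at h3
  rw [h3]
  simp [act, single, h1, Fintype.sum_prod_type, add_smul, ite_and]

theorem dirac_comp_dirac_tmul {P : PoincareDatum}
    (γ : Fin 4 → Matrix (Fin 2 ⊕ Fin 2) (Fin 2 ⊕ Fin 2) ℂ)
    (pd : Fin 4 → MinkowskiAlgebra P →ₗ[ℂ] MinkowskiAlgebra P) (v : Fin 2 ⊕ Fin 2 → ℂ)
    (f : MinkowskiAlgebra P) : (dirac P γ pd ∘ₗ dirac P γ pd) (v ⊗ₜ f) =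
      ∑ l, ∑ k, ((γ k * γ l) *ᵥ v) ⊗ₜ[ℂ] pd k (pd l f) := by
  simp only [dirac, LinearMap.comp_apply, LinearMap.sum_apply, TensorProduct.map_tmul, map_sum,
    Matrix.toLin'_apply, Matrix.mulVec_mulVec]

theorem map_laplacian_tmul {P : PoincareDatum}
    (pd : Fin 4 → MinkowskiAlgebra P →ₗ[ℂ] MinkowskiAlgebra P) (v : Fin 2 ⊕ Fin 2 → ℂ)
    (f : MinkowskiAlgebra P) :
    TensorProduct.map (LinearMap.id : (Fin 2 ⊕ Fin 2 → ℂ) →ₗ[ℂ] _) (laplacian P pd) (v ⊗ₜ f) =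
      ∑ l, ∑ k, (P.lor.g l k • v) ⊗ₜ[ℂ] pd k (pd l f) := by
  simp only [laplacian, TensorProduct.map_tmul, LinearMap.sum_apply, LinearMap.smul_apply,
    LinearMap.comp_apply, TensorProduct.tmul_sum, TensorProduct.tmul_smul, TensorProduct.smul_tmul',
    LinearMap.id_apply]

/-- The Clifford relations of the quantum Minkowski space. -/
def IsClifford (P : PoincareDatum) (γ : Fin 4 → Matrix (Fin 2 ⊕ Fin 2) (Fin 2 ⊕ Fin 2) ℂ) : Prop :=
  ∀ i j : Fin 4, γ i * γ j + ∑ l, ∑ k, P.R (j, i) (l, k) • (γ k * γ l) =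
    (2 * P.lor.g j i) • (1 : Matrix (Fin 2 ⊕ Fin 2) (Fin 2 ⊕ Fin 2) ℂ)

section Dirac

variable {P : PoincareDatum} {γ : Fin 4 → Matrix (Fin 2 ⊕ Fin 2) (Fin 2 ⊕ Fin 2) ℂ}
  {pd : Fin 4 → MinkowskiAlgebra P →ₗ[ℂ] MinkowskiAlgebra P}

/-- The symmetry of second derivatives lets `R` be transferred to the products of gamma matrices.
Averaging the two expressions for the square makes the left side of the Clifford relation appear. -/
theorem IsClifford.dirac_sq (hP : P.Admissible) (h : IsPartialDerivatives P pd)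
    (hγ : IsClifford P γ) : dirac P γ pd ∘ₗ dirac P γ pd =
      TensorProduct.map LinearMap.id (laplacian P pd) := by
  refine TensorProduct.ext' fun v f => ?_
  rw [dirac_comp_dirac_tmul, map_laplacian_tmul]
  have h1 : ∑ l, ∑ k, ((γ k * γ l) *ᵥ v) ⊗ₜ[ℂ] pd k (pd l f) =
      ∑ j, ∑ i, ((∑ l, ∑ k, P.R (j, i) (l, k) • (γ k * γ l)) *ᵥ v) ⊗ₜ[ℂ] pd i (pd j f) := by
    simp only [Matrix.sum_mulVec, Matrix.smul_mulVec, TensorProduct.sum_tmul]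
    rw [sum_comm_pairs]
    refine Finset.sum_congr rfl fun l _ => Finset.sum_congr rfl fun k _ => ?_
    rw [h.comm hP k l f]
    simp only [TensorProduct.tmul_sum, TensorProduct.tmul_smul, TensorProduct.smul_tmul']
  have h2 : (2 : ℂ) • ∑ l, ∑ k, ((γ k * γ l) *ᵥ v) ⊗ₜ[ℂ] pd k (pd l f) =
      (2 : ℂ) • ∑ l, ∑ k, (P.lor.g l k • v) ⊗ₜ[ℂ] pd k (pd l f) := by
    rw [two_smul]
    nth_rewrite 2 [h1]
    simp only [← Finset.sum_add_distrib, ← TensorProduct.add_tmul, ← Matrix.add_mulVec, hγ _ _,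
      Matrix.smul_mulVec, Matrix.one_mulVec, mul_smul, Finset.smul_sum, TensorProduct.smul_tmul']
  exact smul_right_injective _ two_ne_zero h2

/-- Test the square on quadratic monomials: the left side becomes the `R`-symmetrized product of
gamma matrices and the right side `g + Rg`, which is `2g`. -/
theorem isClifford_of_dirac_sq [Nontrivial (MinkowskiAlgebra P)] (h : IsPartialDerivatives P pd)
    (hd : dirac P γ pd ∘ₗ dirac P γ pd = TensorProduct.map LinearMap.id (laplacian P pd)) :
    IsClifford P γ := by
  intro n m
  -- A functional not vanishing on `1` extracts the spinor coefficient from `ℂ⁴ ⊗ 1`.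
  obtain ⟨φ, hφ⟩ : ∃ φ : Module.Dual ℂ (MinkowskiAlgebra P), φ 1 ≠ 0 := by
    by_contra! h0
    exact one_ne_zero ((Module.forall_dual_apply_eq_zero_iff ℂ (1 : MinkowskiAlgebra P)).mp h0)
  refine Matrix.ext_of_mulVec_single fun s => ?_
  set v : Fin 2 ⊕ Fin 2 → ℂ := Pi.single s 1
  have h1 := congrArg (fun f => f (v ⊗ₜ (coord P m * coord P n))) hd
  simp only [dirac_comp_dirac_tmul, map_laplacian_tmul, h.second_coord_mul_coord] at h1
  have h2 := congrArg (fun z => TensorProduct.rid ℂ _ (TensorProduct.map LinearMap.id φ z)) h1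
  simp only [map_sum, TensorProduct.map_tmul, LinearMap.id_apply, map_smul, TensorProduct.rid_tmul,
    smul_eq_mul, mul_comm _ (φ 1), mul_smul, ← Finset.smul_sum] at h2
  have h3 := smul_right_injective _ hφ h2
  have h4 := congrFun P.R_mulVec_g (m, n)
  simp only [Matrix.mulVec, dotProduct, Fintype.sum_prod_type] at h4
  simp only [add_smul, Finset.sum_add_distrib, smul_smul, ← Finset.sum_smul, h4, ite_and] at h3
  simp at h3
  simp only [add_mul, Finset.sum_add_distrib, h4, ite_mul, one_mul, zero_mul] at h3
  simp at h3
  simp only [Matrix.add_mulVec, Matrix.sum_mulVec, Matrix.smul_mulVec, Matrix.one_mulVec, h3,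
    two_mul, add_smul]

theorem gamma_mul_gamma (d : LorentzType) (a b : ℂ) (i j : Fin 4) :
    d.gamma a b i * d.gamma a b j = (a * b) •
      Matrix.fromBlocks (d.Amat i * pauli j) 0 0 (pauli i * d.Amat j) := by
  simp [LorentzType.gamma, Matrix.fromBlocks_multiply, Matrix.fromBlocks_smul, smul_smul, mul_comm]

/-- Products of two gamma matrices are block diagonal and proportional to `ab`, so the symmetrized
product is `ab · 2g`; a nonzero entry of `g` then forces `ab = 1`. -/
theorem isClifford_gamma_iff (P : PoincareDatum) (a b : ℂ) :
    IsClifford P (P.lor.gamma a b) ↔ a * b = 1 := by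
  have h : ∀ i j, P.lor.gamma a b i * P.lor.gamma a b j +
      ∑ l, ∑ k, P.R (j, i) (l, k) • (P.lor.gamma a b k * P.lor.gamma a b l) =
      (a * b) • (2 * P.lor.g j i) • (1 : Matrix (Fin 2 ⊕ Fin 2) (Fin 2 ⊕ Fin 2) ℂ) := by
    intro i j
    simp only [gamma_mul_gamma, smul_comm _ (a * b), ← Finset.smul_sum, ← smul_add]
    congr 1
    have h1 : ∑ l, ∑ k, P.R (j, i) (l, k) •
        Matrix.fromBlocks (P.lor.Amat k * pauli l) 0 0 (pauli k * P.lor.Amat l) =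
        Matrix.fromBlocks (∑ l, ∑ k, P.R (j, i) (l, k) • (P.lor.Amat k * pauli l)) 0 0
          (∑ l, ∑ k, P.R (j, i) (l, k) • (pauli k * P.lor.Amat l)) := by
      ext (r | r) (s | s) <;> simp [Matrix.sum_apply]
    rw [h1, Matrix.fromBlocks_add, P.A_mul_pauli_symm, P.pauli_mul_A_symm, add_zero,
      ← Matrix.fromBlocks_one, Matrix.fromBlocks_smul, smul_zero]
  constructor
  · intro hc
    obtain ⟨i, j, hg⟩ := P.g_ne_zero
    have h1 := (h j i).symm.trans (hc j i)
    have h2 := congrFun (congrFun h1 (Sum.inl 0)) (Sum.inl 0)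
    simp at h2
    exact (mul_eq_right₀ (mul_ne_zero two_ne_zero hg)).mp h2
  · intro hab i j
    rw [h, hab, one_smul]

theorem spinorScaling_mul_gamma (d : LorentzType) (a b : ℂ) {x : ℂ} (hx : x ≠ 0) (i : Fin 4) :
    d.gamma (x⁻¹ * a) (x * b) i =
      spinorScaling x * d.gamma a b i * (spinorScaling x)⁻¹ := by
  have h : (spinorScaling x)⁻¹ = Matrix.fromBlocks (x⁻¹ • 1) 0 0 1 := by
    apply Matrix.inv_eq_right_inv
    simp [spinorScaling, Matrix.fromBlocks_multiply, smul_smul, hx]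
  rw [h]
  simp [spinorScaling, LorentzType.gamma, Matrix.fromBlocks_multiply, smul_smul, mul_comm]

end Dirac

end

end QuantumMinkowski

end

theorem theorem2p2 (P : QuantumMinkowski.PoincareDatum) (hP : P.Admissible)
    (hF : ∀ i j k m, P.Ftilde i j k m = 0)
    (a b : ℂ) (γ : Fin 4 → Matrix (Fin 2 ⊕ Fin 2) (Fin 2 ⊕ Fin 2) ℂ)
    (hγ : ∀ i, γ i = P.lor.gamma a b i) :
    (∃! pd : Fin 4 → QuantumMinkowski.MinkowskiAlgebra P →ₗ[ℂ]
        QuantumMinkowski.MinkowskiAlgebra P,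
      QuantumMinkowski.IsPartialDerivatives P pd) ∧
    (∀ pd : Fin 4 → QuantumMinkowski.MinkowskiAlgebra P →ₗ[ℂ]
        QuantumMinkowski.MinkowskiAlgebra P,
      QuantumMinkowski.IsPartialDerivatives P pd →
      [ QuantumMinkowski.dirac P γ pd ∘ₗ QuantumMinkowski.dirac P γ pd =
          TensorProduct.map LinearMap.id (QuantumMinkowski.laplacian P pd),
        ∀ i j : Fin 4, γ i * γ j + ∑ l, ∑ k, P.R (j, i) (l, k) • (γ k * γ l) =
          (2 * P.lor.g j i) • (1 : Matrix (Fin 2 ⊕ Fin 2) (Fin 2 ⊕ Fin 2) ℂ),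
        a * b = 1 ].TFAE) ∧
    (∀ x : ℂ, x ≠ 0 → ∀ i, P.lor.gamma (x⁻¹ * a) (x * b) i =
      QuantumMinkowski.spinorScaling x * γ i * (QuantumMinkowski.spinorScaling x)⁻¹) ∧
    (a * b = 1 → ∃ x : ℂ, x ≠ 0 ∧ ∀ i, P.lor.gamma 1 1 i =
      QuantumMinkowski.spinorScaling x * γ i * (QuantumMinkowski.spinorScaling x)⁻¹) := by
  obtain rfl : γ = P.lor.gamma a b := funext hγ
  have := hP.minkowski_nontrivial
  refine ⟨⟨QuantumMinkowski.partialDeriv hP hF,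
    QuantumMinkowski.isPartialDerivatives_partialDeriv hP hF, fun pd h =>
      h.unique (QuantumMinkowski.isPartialDerivatives_partialDeriv hP hF)⟩,
    fun pd h => ?_, fun x hx i => QuantumMinkowski.spinorScaling_mul_gamma _ a b hx i, fun hab => ?_⟩
  · tfae_have 2 → 1 := QuantumMinkowski.IsClifford.dirac_sq hP h
    tfae_have 1 → 2 := QuantumMinkowski.isClifford_of_dirac_sq h
    tfae_have 2 ↔ 3 := QuantumMinkowski.isClifford_gamma_iff P a b
    tfae_finish
  · have ha : a ≠ 0 := left_ne_zero_of_mul_eq_one hab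
    -- The scaling `x = a` makes `x⁻¹a = 1`, and then `xb = ab = 1`.
    refine ⟨a, ha, fun i => ?_⟩
    rw [← QuantumMinkowski.spinorScaling_mul_gamma _ a b ha, inv_mul_cancel₀ ha, hab]
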